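/- Let $\mathbb{H}$ and $\mathbb{U}$ be (real or complex) Hilbert spaces, let $(A,\mathcal D(A))$ be the infinitesimal generator of a strongly continuous group $(S(t))_{t\in\mathbb{R}}=(e^{tA})_{t\in\mathbb R}$ on $\mathbb{H}$, and equip $\mathcal D(A^*)$ with the graph scalar product $\langle z_1,z_2\rangle_{\mathbb H}+\langle A^*z_1,A^*z_2\rangle_{\mathbb H}$; $\mathcal D(A^*)'$ is its dual with pivot space $\mathbb H$. Let $B\in\mathcal L(\mathbb U,\mathcal D(A^*)')$ be an admissible control operator: for all $T>0$ and $u\in L^2((0,T);\mathbb U)$, the function $t\mapsto\int_0^tS(t-s)Bu(s)\,ds$ belongs to $C([0,T];\mathbb H)$. Let $\lambda,\lambda_1,\gamma\in\mathbb R$ with $\gamma<\lambda$. Let $Q\in\mathcal L(\mathbb H)$ be symmetric, invertible and coercive ($\langle Qx,x\rangle\ge\kappa\|x\|^2$ for all $x$, for some $\kappa>0$), let $W\in\mathcal L(\mathbb U)$ be symmetric and non-negative, and assume $AQ+QA^*-BWB^*+2\lambda Q=0$, i.e. $$\langle Qx,A^*y\rangle_{\mathbb H}+\langle A^*x,Qy\rangle_{\mathbb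 H}-\langle WB^*x,B^*y\rangle_{\mathbb U}+2\lambda\langle Qx,y\rangle_{\mathbb H}=0\qquad\forall\,x,y\in\mathcal D(A^*).$$ Let $f:\mathbb H\to\mathbb H$ be continuous, such that for every $\epsilon>0$ there is $\delta>0$ with $\|f(x)\|\le\epsilon\|x\|$ whenever $\|x\|<\delta$, and Lipschitz in a neighbourhood of $0$: there are $r,\Lambda>0$ with $\|f(x)-f(x')\|\le\Lambda\|x-x'\|$ whenever $\|x\|,\|x'\|<r$. Consider the system $$\left\{\begin{array}{l} y'=Ay+f(y)-BWB^*\widetilde y \quad\text{in }(0,+\infty),\\ \widetilde y'=-A^*\widetilde y-2\lambda\widetilde y+Q^{-1}f(Q\widetilde y)+\lambda_1Q^{-1}(y-Q\widetilde y)\quad\text{in }(0,+\infty),\\ y(0)=y_0,\quad\widetilde y(0)=\widetilde y_0.\end{array}\right.\tag{1}$$ A weak solution of (1) on $[0,T]$ is a pair $(y,\widetilde y)\in C([0,T];\mathbb H)^2$ with these initial values such that, for all $\varphi\in\mathcal D(A^*)$ and $\psi\in\mathcal D(A)$, in the sense of distributions on $(0,T)$, $$\tfrac{d}{dt}\langle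 y,\varphi\rangle=\langle y,A^*\varphi\rangle+\langle f(y),\varphi\rangle-\langle WB^*\widetilde y,B^*\varphi\rangle_{\mathbb U},$$ $$\tfrac{d}{dt}\langle\widetilde y,\psi\rangle=-\langle\widetilde y,A\psi\rangle+\big\langle-2\lambda\widetilde y+Q^{-1}f(Q\widetilde y)+\lambda_1Q^{-1}(y-Q\widetilde y),\psi\big\rangle.$$ Here $B^*\widetilde y\in L^2((0,T);\mathbb U)$ is the function given by the continuous extension of $B^*$ to weak solutions of $z'=-A^*z+g$, $g\in L^1((0,T);\mathbb H)$; equivalently, it is the function $v\in L^2((0,T);\mathbb U)$ with $\int_0^t\widetilde y\,ds\in\mathcal D(A^*)$ and $B^*\int_0^t\widetilde y\,ds=\int_0^tv\,ds$ for all $t\in[0,T]$. A global weak solution is a pair that is a weak solution on $[0,T]$ for every $T>0$. For the generator $\widetilde A$ of a semigroup, let $\omega_0(\widetilde A)=\inf_{t>0}\frac1t\log\|e^{t\widetilde A}\|$ be its growth bound. **(i)** Let $\hat\omega_0(A)\ge\omega_0(A)$ and $\hat\omega_0(-A^*)\ge\omega_0(-A^*)$ be real numbers such that, for some $c>0$,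 $$\|e^{tA}\|\le c\,e^{t\hat\omega_0(A)}\quad\text{and}\quad\|e^{-tA^*}\|\le c\,e^{t\hat\omega_0(-A^*)}\qquad\text{for }t\ge0,$$ and assume $$\lambda_1-2\lambda>\hat\omega_0(A)-\hat\omega_0(-A^*),\qquad 2\gamma-\hat\omega_0(-A^*)>0.$$ Then there exist $\varepsilon>0$ and $C>0$ such that, for all $y_0,\widetilde y_0\in\mathbb H$ with $(\|y_0\|^2+\|\widetilde y_0\|^2)^{1/2}\le\varepsilon$, system (1) has a global weak solution $(y,\widetilde y)$, it is unique (for each $T>0$, every weak solution on $[0,T]$ coincides with it on $[0,T]$), and $$\|y(t)\|+\|\widetilde y(t)\|\le C\,e^{(\hat\omega_0(-A^*)-2\gamma)t}\big(\|y(0)\|+\|\widetilde y(0)\|\big)\qquad\text{for all }t\ge0.$$ **(ii)** If $A$ is skew-adjoint ($A^*=-A$) and $\lambda_1>2\lambda>2\gamma>0$, then there exist $\varepsilon>0$ and $C>0$ such that, for all $y_0,\widetilde y_0\in\mathbb H$ with $(\|y_0\|^2+\|\widetilde y_0\|^2)^{1/2}\le\varepsilon$, system (1) has a unique global weak solution in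 the same sense, and $$\|y(t)\|+\|\widetilde y(t)\|\le C\,e^{-2\gamma t}\big(\|y(0)\|+\|\widetilde y(0)\|\big)\qquad\text{for all }t\ge0.$$ -/

import Mathlib

open MeasureTheory Filter Topology Set
open scoped InnerProductSpace ContDiff

noncomputable section

/-! ### Strongly continuous groups and their generators -/

/-- A strongly continuous group `(S(t))` of bounded operators on `H`, indexed by `t : ℝ`. -/
structure C0Group (𝕜 H : Type*) [RCLike 𝕜] [NormedAddCommGroup H] [InnerProductSpace 𝕜 H] where
  toFun : ℝ → H →L[𝕜] H
  map_zero : toFun 0 = ContinuousLinearMap.id 𝕜 H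
  map_add : ∀ s t : ℝ, toFun (s + t) = (toFun s).comp (toFun t)
  tendsto_zero : ∀ x : H, Tendsto (fun t : ℝ => toFun t x) (𝓝 0) (𝓝 x)

namespace C0Group

variable {𝕜 H : Type*} [RCLike 𝕜] [NormedAddCommGroup H] [InnerProductSpace 𝕜 H]

instance : CoeFun (C0Group 𝕜 H) (fun _ => ℝ → H →L[𝕜] H) := ⟨C0Group.toFun⟩

/-- `z = A x`, that is, `z = lim_{t → 0} (S(t) x - x) / t`. -/
def HasGenerator (S : C0Group 𝕜 H) (x z : H) : Prop :=
  Tendsto (fun t : ℝ => ((t : 𝕜)⁻¹) • (S t x - x)) (𝓝[≠] 0) (𝓝 z)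

theorem HasGenerator.add {S : C0Group 𝕜 H} {x x' z z' : H}
    (h : S.HasGenerator x z) (h' : S.HasGenerator x' z') :
    S.HasGenerator (x + x') (z + z') := by
  refine (Tendsto.add h h').congr fun t => ?_
  rw [← smul_add, ContinuousLinearMap.map_add]
  congr 1
  abel

theorem HasGenerator.smul {S : C0Group 𝕜 H} {x z : H} (a : 𝕜)
    (h : S.HasGenerator x z) : S.HasGenerator (a • x) (a • z) := by
  refine (Tendsto.const_smul h a).congr fun t => ?_
  rw [ContinuousLinearMap.map_smul, ← smul_sub, smul_comm]

theorem HasGenerator.map {S : C0Group 𝕜 H} {x z : H} (τ : ℝ)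
    (h : S.HasGenerator x z) : S.HasGenerator (S τ x) (S τ z) := by
  refine (((S τ).continuous.tendsto z).comp h).congr fun t => ?_
  have h1 : S τ (S t x) = S t (S τ x) := by
    rw [← ContinuousLinearMap.comp_apply, ← ContinuousLinearMap.comp_apply,
      ← S.map_add, ← S.map_add, add_comm]
  simp only [Function.comp_apply, ContinuousLinearMap.map_smul, ContinuousLinearMap.map_sub, h1]

/-- The infinitesimal generator `(A, D(A))` of the group. -/
def generator (S : C0Group 𝕜 H) : H →ₗ.[𝕜] H where
  domain :=
    { carrier := {x | ∃ z, S.HasGenerator x z}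
      add_mem' := fun ⟨_, h⟩ ⟨_, h'⟩ => ⟨_, h.add h'⟩
      zero_mem' := ⟨0, by simp [HasGenerator]⟩
      smul_mem' := fun a _ ⟨_, h⟩ => ⟨_, h.smul a⟩ }
  toFun :=
    { toFun := fun x => x.2.choose
      map_add' := fun x y =>
        tendsto_nhds_unique (x + y).2.choose_spec (x.2.choose_spec.add y.2.choose_spec)
      map_smul' := fun a x =>
        tendsto_nhds_unique (a • x).2.choose_spec (x.2.choose_spec.smul a) }

theorem hasGenerator_generator (S : C0Group 𝕜 H) (x : S.generator.domain) :
    S.HasGenerator x (S.generator x) := x.2.choose_spec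

theorem HasGenerator.generator_eq {S : C0Group 𝕜 H} {x z : H} (h : S.HasGenerator x z) :
    S.generator ⟨x, z, h⟩ = z :=
  tendsto_nhds_unique (S.hasGenerator_generator ⟨x, z, h⟩) h

variable [CompleteSpace H]

/-- The Hilbert space `D(A*)`, where `A*` is the adjoint of the generator `A`, with the scalar
product `⟨z₁, z₂⟩ + ⟨A* z₁, A* z₂⟩`: it is realised as the graph of `A*` in the Hilbert sum `H ⊕ H`,
so an element `z` is the pair of the vector `z.vec` and its image `z.adj = A* z`. -/
def AdjDomain (S : C0Group 𝕜 H) : Submodule 𝕜 (WithLp 2 (H × H)) :=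
  S.generator.adjoint.graph.comap (WithLp.linearEquiv 2 𝕜 (H × H)).toLinearMap

/-- An element of `D(A*)`, as a vector of `H`. -/
def AdjDomain.vec {S : C0Group 𝕜 H} (z : S.AdjDomain) : H := z.1.fst

/-- The vector `A* z` for `z ∈ D(A*)`. -/
def AdjDomain.adj {S : C0Group 𝕜 H} (z : S.AdjDomain) : H := z.1.snd

theorem AdjDomain.inner_eq {S : C0Group 𝕜 H} (z w : S.AdjDomain) :
    ⟪z, w⟫_𝕜 = ⟪AdjDomain.vec z, AdjDomain.vec w⟫_𝕜 + ⟪AdjDomain.adj z, AdjDomain.adj w⟫_𝕜 := rfl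

/-- A vector in the domain of the operator `A*`, as an element of the Hilbert space `D(A*)`. -/
def AdjDomain.mk {S : C0Group 𝕜 H} (x : S.generator.adjoint.domain) : S.AdjDomain :=
  ⟨WithLp.toLp 2 ((x : H), S.generator.adjoint x), S.generator.adjoint.mem_graph x⟩

theorem AdjDomain.vec_mem {S : C0Group 𝕜 H} (z : S.AdjDomain) :
    AdjDomain.vec z ∈ S.generator.adjoint.domain :=
  LinearPMap.mem_domain_of_mem_graph (y := AdjDomain.adj z) z.2

theorem AdjDomain.adj_eq {S : C0Group 𝕜 H} (z : S.AdjDomain) :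
    AdjDomain.adj z = S.generator.adjoint ⟨AdjDomain.vec z, AdjDomain.vec_mem z⟩ := by
  obtain ⟨y, hy, hy'⟩ := (LinearPMap.mem_graph_iff _).1 z.2
  have h1 : y = ⟨AdjDomain.vec z, AdjDomain.vec_mem z⟩ := Subtype.ext hy
  rw [← h1]
  exact hy'.symm

/-- `D(A*)` is invariant under the adjoint group `S(τ)*`. -/
theorem adjoint_apply_mem (S : C0Group 𝕜 H) (τ : ℝ) (x : S.generator.adjoint.domain) :
    (ContinuousLinearMap.adjoint (S τ)) (x : H) ∈ S.generator.adjoint.domain := by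
  rw [LinearPMap.mem_adjoint_domain_iff]
  have hx := (LinearPMap.mem_adjoint_domain_iff _ _).1 x.2
  have hmap : ∀ w : S.generator.domain, S τ (w : H) ∈ S.generator.domain :=
    fun w => ⟨_, (S.hasGenerator_generator w).map τ⟩
  have hc : Continuous fun w : S.generator.domain =>
      (⟨S τ (w : H), hmap w⟩ : S.generator.domain) :=
    ((S τ).continuous.comp continuous_subtype_val).subtype_mk _
  refine (hx.comp hc).congr fun w => ?_
  change ⟪(x : H), S.generator ⟨S τ (w : H), hmap w⟩⟫_𝕜 =
    ⟪(ContinuousLinearMap.adjoint (S τ)) (x : H), S.generator w⟫_𝕜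
  rw [ContinuousLinearMap.adjoint_inner_left]
  exact congrArg _ ((S.hasGenerator_generator w).map τ).generator_eq

/-- The operator `S(τ)*` on `D(A*)`. -/
def adjMap (S : C0Group 𝕜 H) (τ : ℝ) (z : S.AdjDomain) : S.AdjDomain :=
  AdjDomain.mk ⟨(ContinuousLinearMap.adjoint (S τ)) (AdjDomain.vec z),
    S.adjoint_apply_mem τ ⟨AdjDomain.vec z, AdjDomain.vec_mem z⟩⟩

/-- The dual space `D(A*)'` with respect to the pivot space `H`. A vector `h : H` is the functional
`z ↦ ⟪z, h⟫`, so the functionals are conjugate-linear. -/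
abbrev AdjDual (S : C0Group 𝕜 H) : Type _ := S.AdjDomain →L⋆[𝕜] 𝕜

end C0Group

/-- The growth bound `ω₀ = inf_{t > 0} (1 / t) log ‖E(t)‖ ∈ [-∞, ∞)`, with `log 0 = -∞`. -/
def growthBound {𝕜 H : Type*} [RCLike 𝕜] [NormedAddCommGroup H] [InnerProductSpace 𝕜 H]
    (E : ℝ → H →L[𝕜] H) : EReal :=
  ⨅ (t : ℝ) (_ : 0 < t), ENNReal.log ‖E t‖ₑ / (t : EReal)

/-! ### Control operators -/

section Control

variable {𝕜 H U : Type*} [RCLike 𝕜] [NormedAddCommGroup H] [InnerProductSpace 𝕜 H]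
  [CompleteSpace H] [NormedAddCommGroup U] [InnerProductSpace 𝕜 U] [CompleteSpace U]

/-- The operator `B* ∈ L(D(A*), U)` of `B ∈ L(U, D(A*)')`: `⟪B* z, u⟫ = (B u) z`. -/
def controlAdjoint {S : C0Group 𝕜 H} (B : U →L[𝕜] S.AdjDual) : S.AdjDomain →L[𝕜] U :=
  ((InnerProductSpace.toDual 𝕜 U).symm.toContinuousLinearEquiv :
    StrongDual 𝕜 U →L⋆[𝕜] U).comp B.flip

theorem inner_controlAdjoint {S : C0Group 𝕜 H} (B : U →L[𝕜] S.AdjDual) (z : S.AdjDomain) (u : U) :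
    ⟪controlAdjoint B z, u⟫_𝕜 = B u z :=
  InnerProductSpace.toDual_symm_apply

/-- `B` is an admissible control operator: for every `u ∈ L²(0, T; U)` the function
`φ(t) = ∫₀ᵗ S(t - s) B u(s) ds`, an integral in `D(A*)'`, belongs to `C([0, T]; H)`. The extension of
`S(τ)` to `D(A*)'` is `ℓ ↦ ℓ ∘ S(τ)*`. -/
def IsAdmissible {S : C0Group 𝕜 H} (B : U →L[𝕜] S.AdjDual) : Prop :=
  ∀ T : ℝ, 0 < T → ∀ u : ℝ → U, MemLp u 2 (volume.restrict (Ioo 0 T)) →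
    ∃ φ : ℝ → H, ContinuousOn φ (Icc 0 T) ∧
      ∀ t ∈ Icc 0 T, ∀ z : S.AdjDomain,
        ⟪C0Group.AdjDomain.vec z, φ t⟫_𝕜 = ∫ s in (0 : ℝ)..t, B (u s) (S.adjMap (t - s) z)

/-- The identity `A Q + Q A* - B W B* + Q R Q + 2 λ Q = 0`, in the weak sense on `D(A*)`. -/
def RiccatiIdentity {S : C0Group 𝕜 H} (B : U →L[𝕜] S.AdjDual) (Q R : H →L[𝕜] H) (W : U →L[𝕜] U)
    (lam : ℝ) : Prop :=
  ∀ x y : S.AdjDomain,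
    ⟪Q (C0Group.AdjDomain.vec x), C0Group.AdjDomain.adj y⟫_𝕜
      + ⟪C0Group.AdjDomain.adj x, Q (C0Group.AdjDomain.vec y)⟫_𝕜
      - ⟪W (controlAdjoint B x), controlAdjoint B y⟫_𝕜
      + ⟪R (Q (C0Group.AdjDomain.vec x)), Q (C0Group.AdjDomain.vec y)⟫_𝕜
      + 2 * (lam : 𝕜) * ⟪Q (C0Group.AdjDomain.vec x), C0Group.AdjDomain.vec y⟫_𝕜 = 0

/-- `v = B* z` in `L²(0, T; U)`, for a function `z ∈ C([0, T]; H)` which need not take its values in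
`D(A*)`. A weak solution `z` of `z' = - A* z + g` with `g ∈ L¹(0, T; H)` has its primitive `∫₀ᵗ z` in
`D(A*)`, since `A* ∫₀ᵗ z = z(0) - z(t) + ∫₀ᵗ g`, and `B* z` is the function `v` for which
`B* ∫₀ᵗ z = ∫₀ᵗ v`; the integrals are tested against the vectors of `H` and `U`. This is the
pointwise `B* z` if `z ∈ C([0, T]; D(A*))`, it determines `v` almost everywhere, and it passes to the
limit in `z(0) ∈ H`, `g ∈ L¹(0, T; H)`, `v ∈ L²(0, T; U)`: it is the extension of `B*` by density. -/
def IsObservation {S : C0Group 𝕜 H} (B : U →L[𝕜] S.AdjDual) (T : ℝ) (z : ℝ → H) (v : ℝ → U) :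
    Prop :=
  MemLp v 2 (volume.restrict (Ioo 0 T)) ∧
    ∀ t ∈ Icc 0 T, ∃ Z : S.AdjDomain,
      (∀ h : H, ⟪h, C0Group.AdjDomain.vec Z⟫_𝕜 = ∫ s in (0 : ℝ)..t, ⟪h, z s⟫_𝕜) ∧
      (∀ w : U, ⟪w, controlAdjoint B Z⟫_𝕜 = ∫ s in (0 : ℝ)..t, ⟪w, v s⟫_𝕜)

/-- `F' = G` in the sense of distributions on `(0, T)`. -/
def HasDistribDeriv (T : ℝ) (F G : ℝ → 𝕜) : Prop :=
  ∀ θ : ℝ → ℝ, ContDiff ℝ ∞ θ → HasCompactSupport θ → tsupport θ ⊆ Ioo 0 T →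
    ∫ t in Ioo 0 T, ((deriv θ t : ℝ) : 𝕜) * F t = - ∫ t in Ioo 0 T, ((θ t : ℝ) : 𝕜) * G t

/-- `(y₁, y₂)` is a weak solution in `C([0, T]; H)²` of the closed-loop system
`y₁' = A y₁ + f(y₁) - B W B* y₂`,
`y₂' = - A* y₂ - 2 λ y₂ + Q⁻¹ f(Q y₂) + λ₁ Q⁻¹ (y₁ - Q y₂)`,
`y₁(0) = a₁`, `y₂(0) = a₂`.
The first equation is tested with `φ ∈ D(A*)` and the second one with `ψ ∈ D((-A*)*) = D(A)`. -/
def IsClosedLoopSolution {S : C0Group 𝕜 H} (B : U →L[𝕜] S.AdjDual) (Q : H ≃L[𝕜] H) (W : U →L[𝕜] U)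
    (f : H → H) (lam lam₁ : ℝ) (a₁ a₂ : H) (T : ℝ) (y₁ y₂ : ℝ → H) : Prop :=
  ContinuousOn y₁ (Icc 0 T) ∧ ContinuousOn y₂ (Icc 0 T) ∧ y₁ 0 = a₁ ∧ y₂ 0 = a₂ ∧
  (∃ v : ℝ → U, IsObservation B T y₂ v ∧
    ∀ φ : S.AdjDomain,
      HasDistribDeriv T (fun t => ⟪C0Group.AdjDomain.vec φ, y₁ t⟫_𝕜)
        (fun t => ⟪C0Group.AdjDomain.adj φ, y₁ t⟫_𝕜 + ⟪C0Group.AdjDomain.vec φ, f (y₁ t)⟫_𝕜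
          - ⟪controlAdjoint B φ, W (v t)⟫_𝕜)) ∧
  (∀ ψ : S.generator.domain,
    HasDistribDeriv T (fun t => ⟪(ψ : H), y₂ t⟫_𝕜)
      (fun t => - ⟪S.generator ψ, y₂ t⟫_𝕜 - 2 * (lam : 𝕜) * ⟪(ψ : H), y₂ t⟫_𝕜
        + ⟪(ψ : H), Q.symm (f (Q (y₂ t)))⟫_𝕜
        + (lam₁ : 𝕜) * ⟪(ψ : H), Q.symm (y₁ t - Q (y₂ t))⟫_𝕜))

end Control

end

noncomputable section

open scoped NNReal

set_option linter.unusedSectionVars false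

/-! ### Strongly continuous groups: bounds, continuity, reversal, rescaling, averages of orbits. -/

namespace C0Group

variable {𝕜 H : Type*} [RCLike 𝕜] [NormedAddCommGroup H] [InnerProductSpace 𝕜 H]

/-! The change of unknown `e = y₁ - Q y₂` removes the unbounded control. Formally the Riccati
identity gives `B W B* y₂ = A Q y₂ + Q A* y₂ + 2λ Q y₂`, and subtracting `Q` times the second
equation from the first leaves `e' = (A - λ₁) e + f(e + Q y₂) - f(Q y₂)`, `y₂' = (-A* - 2λ) y₂ + Q⁻¹
f(Q y₂) + λ₁ Q⁻¹ e`. The operator `B` is gone, and since `f(x) = o(‖x‖)` the linearisation at 0 is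
triangular: `e` decays at rate `β = λ₁ - ωA` and drives `y₂`, which decays at rate `α = 2λ - ωA'`.
The hypotheses say exactly that `α < β`, and that the target rate `μ = 2γ - ωA'` satisfies `0 < μ <
α`. The strict gaps absorb the coupling and the small nonlinear terms.

For weak solutions the change of unknown is made on time integrals. If `v` is the observation of
`y₂`, then `Z = ∫₀ᵗ y₂` lies in `D(A*)`, `A* Z` is known from the second equation and `B* Z = ∫₀ᵗ
v`; the Riccati identity at `(φ, Z)` then evaluates the control term
(`RiccatiIdentity.integral_inner_observation`). Conversely, admissibility provides the observation:
by duality `B*` is `L²`-bounded along orbits of the adjoint group, so the observations of smoothed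
trajectories converge in `L²` (`IsAdmissible.exists_isObservation`). Since weak and mild solutions
of the linear equation coincide (`eqOn_mild_of_weak`), the closed loop is equivalent to a pair of
mild equations with locally Lipschitz nonlinearities (`isClosedLoopSolution_iff_isMildPair`).

That pair is solved in `exists_stable_isMildPair`. The nonlinearities are truncated to be bounded
and globally Lipschitz. Because `T₁`, `T₂` are groups, the variables `T₁(-t) e`, `T₂(-t) y` satisfy
an ordinary differential equation with a Lipschitz field. A weighted sum `E + η Y` of majorants of
`‖e‖`, `‖y‖` decays (`add_le_exp_of_triangular`), which keeps small solutions in the ball where the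
truncation is inactive; uniqueness propagates by continuation. -/

theorem map_add_apply (S : C0Group 𝕜 H) (s t : ℝ) (x : H) : S (s + t) x = S s (S t x) := by
  rw [S.map_add]; rfl

theorem map_zero_apply (S : C0Group 𝕜 H) (x : H) : S 0 x = x := by
  rw [S.map_zero]; rfl

theorem apply_comm (S : C0Group 𝕜 H) (s t : ℝ) (x : H) : S s (S t x) = S t (S s x) := by
  rw [← map_add_apply, ← map_add_apply, add_comm]

@[simp]
theorem apply_neg_apply (S : C0Group 𝕜 H) (t : ℝ) (x : H) : S t (S (-t) x) = x := by
  rw [← map_add_apply, add_neg_cancel, map_zero_apply]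

theorem continuous_apply (S : C0Group 𝕜 H) (x : H) : Continuous fun t : ℝ => S t x := by
  refine continuous_iff_continuousAt.2 fun t => ?_
  have h1 : Tendsto (fun s : ℝ => s - t) (𝓝 t) (𝓝 0) := by
    have : ContinuousAt (fun s : ℝ => s - t) t := by fun_prop
    simpa [ContinuousAt] using this
  refine ((((S t).continuous.tendsto x).comp (S.tendsto_zero x)).comp h1 |>.congr fun s => ?_).trans
    (by rfl)
  simp only [Function.comp_apply]
  rw [← map_add_apply, add_sub_cancel]

variable [CompleteSpace H]

/-- Orbits are continuous, hence bounded on compact intervals, and the uniform boundedness principle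
applies. -/
theorem exists_norm_le (S : C0Group 𝕜 H) (R : ℝ) :
    ∃ M : ℝ, 0 < M ∧ ∀ t ∈ Icc (-R) R, ‖S t‖ ≤ M := by
  obtain ⟨C, hC⟩ := banach_steinhaus (g := fun t : Icc (-R) R => S (t : ℝ)) fun x => by
    obtain ⟨C, hC⟩ := (isCompact_Icc (a := -R) (b := R)).exists_bound_of_continuousOn
      (S.continuous_apply x).continuousOn
    exact ⟨C, fun t => hC t t.2⟩
  exact ⟨max C 1, by positivity, fun t ht => (hC ⟨t, ht⟩).trans (le_max_left _ _)⟩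

theorem continuous_uncurry (S : C0Group 𝕜 H) : Continuous fun p : ℝ × H => S p.1 p.2 := by
  refine continuous_iff_continuousAt.2 fun ⟨t, x⟩ => ?_
  obtain ⟨M, hM, hS⟩ := S.exists_norm_le (|t| + 1)
  have h1 : Tendsto (fun p : ℝ × H => S p.1 x) (𝓝 (t, x)) (𝓝 (S t x)) :=
    ((S.continuous_apply x).comp continuous_fst).tendsto (t, x)
  have h2 : Tendsto (fun p : ℝ × H => S p.1 (p.2 - x)) (𝓝 (t, x)) (𝓝 0) := by
    refine squeeze_zero_norm' (a := fun p : ℝ × H => M * ‖p.2 - x‖) ?_ ?_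
    · have h3 : ∀ᶠ p : ℝ × H in 𝓝 (t, x), |p.1| < |t| + 1 := by
        have : Continuous fun p : ℝ × H => |p.1| := by fun_prop
        exact this.continuousAt.eventually (gt_mem_nhds (by simp))
      filter_upwards [h3] with p hp
      exact (S p.1).le_of_opNorm_le (hS _ (abs_le.1 hp.le)) _
    · have : Continuous fun p : ℝ × H => M * ‖p.2 - x‖ := by fun_prop
      simpa using this.tendsto (t, x)
  have h4 := h1.add h2
  simp only [add_zero] at h4
  refine h4.congr fun p => ?_
  rw [← _root_.map_add, add_sub_cancel]

theorem continuous_comp (S : C0Group 𝕜 H) {X : Type*} [TopologicalSpace X] {a : X → ℝ}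
    {g : X → H} (ha : Continuous a) (hg : Continuous g) : Continuous fun x => S (a x) (g x) :=
  S.continuous_uncurry.comp (ha.prodMk hg)

/-- The reversed group `t ↦ S(-t)`. -/
def rev (S : C0Group 𝕜 H) : C0Group 𝕜 H where
  toFun t := S (-t)
  map_zero := by rw [neg_zero, S.map_zero]
  map_add s t := by rw [neg_add, S.map_add]
  tendsto_zero x := by
    simpa [Function.comp_def, map_zero_apply] using
      ((S.continuous_apply x).comp continuous_neg).tendsto 0

theorem rev_apply (S : C0Group 𝕜 H) (t : ℝ) : S.rev t = S (-t) := rfl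

/-- The rescaled group `t ↦ e^{a t} S(t)`. -/
def scale (S : C0Group 𝕜 H) (a : ℝ) : C0Group 𝕜 H where
  toFun t := ((Real.exp (a * t) : ℝ) : 𝕜) • S t
  map_zero := by simp [S.map_zero]
  map_add s t := by
    ext x
    simp only [mul_add, Real.exp_add, S.map_add, _root_.smul_apply,
      ContinuousLinearMap.comp_apply, ContinuousLinearMap.map_smul, smul_smul, RCLike.ofReal_mul]
  tendsto_zero x := by
    have h : Continuous fun t : ℝ => ((Real.exp (a * t) : ℝ) : 𝕜) • S t x :=
      (RCLike.continuous_ofReal.comp (by fun_prop)).smul (S.continuous_apply x)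
    simpa [map_zero_apply] using h.tendsto 0

theorem scale_apply (S : C0Group 𝕜 H) (a t : ℝ) (x : H) :
    S.scale a t x = ((Real.exp (a * t) : ℝ) : 𝕜) • S t x := rfl

theorem norm_scale_le {S : C0Group 𝕜 H} {t M : ℝ} (a : ℝ) (h : ‖S t‖ ≤ M) :
    ‖S.scale a t‖ ≤ Real.exp (a * t) * M := by
  refine (norm_smul_le (((Real.exp (a * t) : ℝ) : 𝕜)) (S t)).trans ?_
  rw [RCLike.norm_ofReal, abs_of_pos (Real.exp_pos _)]
  gcongr

section Real

variable [NormedSpace ℝ H] [IsScalarTower ℝ 𝕜 H]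

theorem hasGenerator_iff_hasDerivAt {S : C0Group 𝕜 H} {x z : H} :
    S.HasGenerator x z ↔ HasDerivAt (fun t : ℝ => S t x) z 0 := by
  rw [hasDerivAt_iff_tendsto_slope, HasGenerator]
  refine tendsto_congr fun t => ?_
  rw [slope_def_module, sub_zero, map_zero_apply, ← RCLike.ofReal_inv,
    ← RCLike.real_smul_eq_coe_smul]

theorem HasGenerator.hasDerivAt {S : C0Group 𝕜 H} {x z : H} (h : S.HasGenerator x z) (t : ℝ) :
    HasDerivAt (fun t : ℝ => S t x) (S t z) t := by
  have h1 := hasGenerator_iff_hasDerivAt.1 (h.map t)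
  have h2 : HasDerivAt (fun s : ℝ => S (s - t) (S t x)) (S t z) t := by
    rw [← sub_self t] at h1
    simpa using h1.comp_sub_const t t
  refine h2.congr_of_eventuallyEq (Eventually.of_forall fun s => ?_)
  simp only
  rw [← map_add_apply, sub_add_cancel]

theorem HasGenerator.rev {S : C0Group 𝕜 H} {x z : H} (h : S.HasGenerator x z) :
    S.rev.HasGenerator x (-z) := by
  rw [hasGenerator_iff_hasDerivAt]
  have h1 := hasGenerator_iff_hasDerivAt.1 h
  rw [← neg_zero] at h1
  simpa [Function.comp_def, rev_apply] using h1.scomp 0 (hasDerivAt_neg (0 : ℝ))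

theorem HasGenerator.scale {S : C0Group 𝕜 H} {x z : H} (h : S.HasGenerator x z) (a : ℝ) :
    (S.scale a).HasGenerator x (z + (a : 𝕜) • x) := by
  rw [hasGenerator_iff_hasDerivAt] at h ⊢
  have h1 : HasDerivAt (fun t : ℝ => Real.exp (a * t)) a 0 := by
    simpa using ((hasDerivAt_id (0 : ℝ)).const_mul a).exp
  have h2 := h1.smul h
  simp only [mul_zero, Real.exp_zero, one_smul, map_zero_apply] at h2
  rw [← RCLike.real_smul_eq_coe_smul]
  refine h2.congr_of_eventuallyEq (Eventually.of_forall fun t => ?_)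
  simp only [scale_apply, Pi.smul_apply', RCLike.real_smul_eq_coe_smul (K := 𝕜)]

/-- `∫₀^τ S(s) x ds` belongs to the domain of the generator. -/
theorem hasGenerator_integral (S : C0Group 𝕜 H) (τ : ℝ) (x : H) :
    S.HasGenerator (∫ s in (0 : ℝ)..τ, S s x) (S τ x - x) := by
  rw [hasGenerator_iff_hasDerivAt]
  have hc := S.continuous_apply x
  have hi : ∀ a b : ℝ, IntervalIntegrable (fun s => S s x) volume a b :=
    fun a b => hc.intervalIntegrable a b
  -- The group law shifts the interval of integration, so differentiability at 0 reduces to the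
  -- fundamental theorem of calculus.
  have h1 : ∀ t : ℝ, S t (∫ s in (0 : ℝ)..τ, S s x) =
      (∫ s in (0 : ℝ)..(t + τ), S s x) - ∫ s in (0 : ℝ)..t, S s x := by
    intro t
    rw [intervalIntegral.integral_interval_sub_left (hi _ _) (hi _ _),
      ← ContinuousLinearMap.intervalIntegral_comp_comm _ (hi _ _)]
    simp_rw [← map_add_apply]
    rw [intervalIntegral.integral_comp_add_left (fun s => S s x), add_zero]
  simp_rw [h1]
  have h2 : ∀ t : ℝ, HasDerivAt (fun t => ∫ s in (0 : ℝ)..t, S s x) (S t x) t := fun t =>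
    intervalIntegral.integral_hasDerivAt_right (hi _ _)
      hc.aestronglyMeasurable.stronglyMeasurableAtFilter hc.continuousAt
  have h3 : HasDerivAt (fun t => ∫ s in (0 : ℝ)..(t + τ), S s x) (S τ x) 0 := by
    have := h2 (0 + τ)
    simpa using this.comp_add_const 0 τ
  simpa [map_zero_apply] using! h3.sub (h2 0)

theorem tendsto_average (S : C0Group 𝕜 H) (x : H) :
    Tendsto (fun τ : ℝ => τ⁻¹ • ∫ s in (0 : ℝ)..τ, S s x) (𝓝[≠] 0) (𝓝 x) := by
  have hc := S.continuous_apply x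
  have h2 : HasDerivAt (fun t => ∫ s in (0 : ℝ)..t, S s x) (S 0 x) 0 :=
    intervalIntegral.integral_hasDerivAt_right (hc.intervalIntegrable _ _)
      hc.aestronglyMeasurable.stronglyMeasurableAtFilter hc.continuousAt
  rw [hasDerivAt_iff_tendsto_slope, map_zero_apply] at h2
  refine h2.congr fun t => ?_
  simp [slope_def_module]

/-- The averages `τ⁻¹ ∫₀^τ S(s) x ds` lie in the domain and tend to `x`. Density is what makes
`LinearPMap.adjoint` the genuine adjoint. -/
theorem dense_generator_domain (S : C0Group 𝕜 H) : Dense (S.generator.domain : Set H) := by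
  intro x
  refine mem_closure_of_tendsto (S.tendsto_average x) (Eventually.of_forall fun τ => ?_)
  rw [RCLike.real_smul_eq_coe_smul (K := 𝕜)]
  exact S.generator.domain.smul_mem _ ⟨_, S.hasGenerator_integral τ x⟩

theorem norm_integral_le (S : C0Group 𝕜 H) {R M : ℝ} (hM : ∀ t ∈ Icc (-R) R, ‖S t‖ ≤ M)
    {τ : ℝ} (hτ : |τ| ≤ R) (x : H) : ‖∫ s in (0 : ℝ)..τ, S s x‖ ≤ M * ‖x‖ * |τ| := by
  have h := intervalIntegral.norm_integral_le_of_norm_le_const (a := 0) (b := τ)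
    (C := M * ‖x‖) (f := fun s => S s x) fun s hs => by
      refine (S s).le_of_opNorm_le (hM s ?_) x
      obtain ⟨h1, h2⟩ := abs_le.1 hτ
      rcases le_total 0 τ with h0 | h0
      · rw [uIoc_of_le h0] at hs
        exact ⟨by linarith [hs.1], by linarith [hs.2]⟩
      · rw [uIoc_of_ge h0] at hs
        exact ⟨by linarith [hs.1], by linarith [hs.2]⟩
  simpa using h

/-- The operator `∫₀^τ S(s) ds`. -/
def integralCLM (S : C0Group 𝕜 H) (τ : ℝ) : H →L[𝕜] H :=
  LinearMap.mkContinuousOfExistsBound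
    { toFun := fun x => ∫ s in (0 : ℝ)..τ, S s x
      map_add' := fun x y => by
        simp_rw [_root_.map_add]
        exact intervalIntegral.integral_add ((S.continuous_apply x).intervalIntegrable _ _)
          ((S.continuous_apply y).intervalIntegrable _ _)
      map_smul' := fun a x => by
        simp_rw [ContinuousLinearMap.map_smul]
        exact intervalIntegral.integral_smul a _ }
    (by
      obtain ⟨M, -, hM⟩ := S.exists_norm_le |τ|
      refine ⟨M * |τ|, fun x => ?_⟩
      have := S.norm_integral_le hM le_rfl x
      simp only [LinearMap.coe_mk, AddHom.coe_mk]
      linarith)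

theorem integralCLM_apply (S : C0Group 𝕜 H) (τ : ℝ) (x : H) :
    S.integralCLM τ x = ∫ s in (0 : ℝ)..τ, S s x := rfl

end Real

end C0Group

section Inner

variable {𝕜 E : Type*} [RCLike 𝕜] [NormedAddCommGroup E] [InnerProductSpace 𝕜 E] [CompleteSpace E]
  [NormedSpace ℝ E]

theorem inner_intervalIntegral_right {g : ℝ → E} {a b : ℝ} (hg : IntervalIntegrable g volume a b)
    (x : E) : ⟪x, ∫ s in a..b, g s⟫_𝕜 = ∫ s in a..b, ⟪x, g s⟫_𝕜 := by
  simpa using ((innerSL 𝕜 x).intervalIntegral_comp_comm hg).symm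

theorem inner_intervalIntegral_left {g : ℝ → E} {a b : ℝ} (hg : IntervalIntegrable g volume a b)
    (x : E) : ⟪∫ s in a..b, g s, x⟫_𝕜 = ∫ s in a..b, ⟪g s, x⟫_𝕜 := by
  rw [← inner_conj_symm, inner_intervalIntegral_right hg]
  simp only [intervalIntegral, _root_.map_sub, ← integral_conj, inner_conj_symm]

end Inner

/-! ### The adjoint group, and `D(A*)` as the domain of its generator. -/

namespace C0Group

variable {𝕜 H : Type*} [RCLike 𝕜] [NormedAddCommGroup H] [InnerProductSpace 𝕜 H] [CompleteSpace H]

section Real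

variable [NormedSpace ℝ H] [IsScalarTower ℝ 𝕜 H]

theorem AdjDomain.inner_adj {S : C0Group 𝕜 H} (z : S.AdjDomain) (x : S.generator.domain) :
    ⟪AdjDomain.adj z, (x : H)⟫_𝕜 = ⟪AdjDomain.vec z, S.generator x⟫_𝕜 := by
  rw [AdjDomain.adj_eq]
  exact LinearPMap.adjoint_isFormalAdjoint S.dense_generator_domain
    ⟨AdjDomain.vec z, AdjDomain.vec_mem z⟩ x

theorem AdjDomain.inner_adj_of_hasGenerator {S : C0Group 𝕜 H} (z : S.AdjDomain) {x w : H}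
    (h : S.HasGenerator x w) : ⟪AdjDomain.adj z, x⟫_𝕜 = ⟪AdjDomain.vec z, w⟫_𝕜 := by
  rw [← h.generator_eq]
  exact AdjDomain.inner_adj z ⟨x, w, h⟩

theorem AdjDomain.exists_of_inner {S : C0Group 𝕜 H} {x z : H}
    (h : ∀ w : S.generator.domain, ⟪z, (w : H)⟫_𝕜 = ⟪x, S.generator w⟫_𝕜) :
    ∃ Z : S.AdjDomain, AdjDomain.vec Z = x ∧ AdjDomain.adj Z = z := by
  have hx := LinearPMap.mem_adjoint_domain_of_exists x ⟨z, h⟩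
  refine ⟨AdjDomain.mk ⟨x, hx⟩, rfl, ?_⟩
  exact LinearPMap.adjoint_apply_eq S.dense_generator_domain ⟨x, hx⟩ h

theorem AdjDomain.inner_adj_integral {S : C0Group 𝕜 H} (z : S.AdjDomain) (τ : ℝ) (x : H) :
    ⟪AdjDomain.adj z, ∫ s in (0 : ℝ)..τ, S s x⟫_𝕜 = ⟪AdjDomain.vec z, S τ x - x⟫_𝕜 :=
  AdjDomain.inner_adj_of_hasGenerator z (S.hasGenerator_integral τ x)

/-- For every `φ`, the vector `(∫₀^τ S(s) ds)* φ` lies in `D(A*)`, with image `S(τ)* φ - φ`. A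
vector `x` orthogonal to `D(A*)` is therefore orthogonal to these, so `⟪φ, τ⁻¹ ∫₀^τ S(s) x ds⟫ = 0`,
and `τ → 0` gives `⟪φ, x⟫ = 0`. -/
theorem dense_vec (S : C0Group 𝕜 H) : Dense {x : H | ∃ z : S.AdjDomain, AdjDomain.vec z = x} := by
  have h : Dense (S.generator.adjoint.domain : Set H) := by
    rw [Submodule.dense_iff_topologicalClosure_eq_top, Submodule.topologicalClosure_eq_top_iff,
      Submodule.eq_bot_iff]
    intro x hx
    rw [Submodule.mem_orthogonal] at hx
    have h0 : ∀ (φ : H) (τ : ℝ), ⟪φ, τ⁻¹ • ∫ s in (0 : ℝ)..τ, S s x⟫_𝕜 = 0 := by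
      intro φ τ
      obtain ⟨Z, hZ, -⟩ := AdjDomain.exists_of_inner (S := S)
        (x := (S.integralCLM τ).adjoint φ) (z := (S τ).adjoint φ - φ) fun w => by
          rw [ContinuousLinearMap.adjoint_inner_left, inner_sub_left,
            ContinuousLinearMap.adjoint_inner_left, integralCLM_apply, ← inner_sub_right]
          congr 1
          have hw := S.hasGenerator_generator w
          rw [intervalIntegral.integral_eq_sub_of_hasDerivAt (fun t _ => hw.hasDerivAt t)
            ((S.continuous_apply _).intervalIntegrable _ _), map_zero_apply]
      have h1 := hx _ (AdjDomain.vec_mem Z)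
      rw [hZ, ContinuousLinearMap.adjoint_inner_left, integralCLM_apply] at h1
      rw [RCLike.real_smul_eq_coe_smul (K := 𝕜), inner_smul_right, h1, mul_zero]
    have h2 : ∀ φ : H, ⟪φ, x⟫_𝕜 = 0 := fun φ => by
      have h3 : Tendsto (fun τ : ℝ => ⟪φ, τ⁻¹ • ∫ s in (0 : ℝ)..τ, S s x⟫_𝕜) (𝓝[≠] 0)
          (𝓝 ⟪φ, x⟫_𝕜) := Tendsto.inner tendsto_const_nhds (S.tendsto_average x)
      simp_rw [h0] at h3
      exact tendsto_nhds_unique h3 tendsto_const_nhds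
    exact inner_self_eq_zero.1 (h2 x)
  exact h.mono fun x hx => ⟨AdjDomain.mk ⟨x, hx⟩, rfl⟩

/-- On `D(A*)` one has `S(t)* z - z = (∫₀ᵗ S(s) ds)* A* z`, of norm at most `M |t| ‖A* z‖`. Density
of `D(A*)` and the uniform bound of `S(t)*` near 0 extend the convergence to `H`. -/
theorem tendsto_adjoint_zero (S : C0Group 𝕜 H) (x : H) :
    Tendsto (fun t : ℝ => (S t).adjoint x) (𝓝 0) (𝓝 x) := by
  obtain ⟨M, hM, hS⟩ := S.exists_norm_le 1
  have hev : ∀ᶠ t : ℝ in 𝓝 0, |t| < 1 :=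
    (continuous_abs.tendsto' 0 0 abs_zero).eventually (gt_mem_nhds one_pos)
  have hD : ∀ z : S.AdjDomain, Tendsto (fun t : ℝ => (S t).adjoint (AdjDomain.vec z)) (𝓝 0)
      (𝓝 (AdjDomain.vec z)) := by
    intro z
    rw [tendsto_iff_norm_sub_tendsto_zero]
    refine squeeze_zero' (Eventually.of_forall fun _ => norm_nonneg _)
      (g := fun t => M * ‖AdjDomain.adj z‖ * |t|) ?_
      (by
        have : Continuous fun t : ℝ => M * ‖AdjDomain.adj z‖ * |t| := by fun_prop
        simpa using this.tendsto 0)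
    filter_upwards [hev] with t ht
    refine (le_of_eq ?_).trans (b := ‖(S.integralCLM t).adjoint (AdjDomain.adj z)‖) ?_ |>.trans
      (b := ‖(S.integralCLM t).adjoint (AdjDomain.adj z)‖) ?_
    · congr 1
      refine ext_inner_right 𝕜 fun x => ?_
      rw [ContinuousLinearMap.adjoint_inner_left, integralCLM_apply, AdjDomain.inner_adj_integral z,
        inner_sub_left, ContinuousLinearMap.adjoint_inner_left, inner_sub_right]
    · exact le_rfl
    · have h1 : ‖(S.integralCLM t).adjoint‖ ≤ M * |t| := by
        rw [LinearIsometryEquiv.norm_map]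
        refine ContinuousLinearMap.opNorm_le_bound _ (by positivity) fun x => ?_
        have := S.norm_integral_le hS ht.le x
        rw [integralCLM_apply]
        linarith
      refine (ContinuousLinearMap.le_of_opNorm_le _ h1 _).trans (le_of_eq (by ring))
  rw [Metric.tendsto_nhds]
  intro ε hε
  obtain ⟨y, ⟨z, rfl⟩, hy⟩ := Metric.mem_closure_iff.1 (S.dense_vec x) (ε / (2 * (M + 1)))
    (by positivity)
  filter_upwards [hev, Metric.tendsto_nhds.1 (hD z) (ε / 2) (half_pos hε)] with t ht h2
  have h3 : ‖(S t).adjoint (x - AdjDomain.vec z)‖ ≤ M * ‖x - AdjDomain.vec z‖ := by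
    refine ContinuousLinearMap.le_of_opNorm_le _ ?_ _
    rw [LinearIsometryEquiv.norm_map]
    exact hS _ (abs_le.1 ht.le)
  rw [dist_eq_norm] at hy h2 ⊢
  have h4 : (M + 1) * ‖x - AdjDomain.vec z‖ < ε / 2 := by
    rw [lt_div_iff₀ (by positivity)] at hy
    linarith
  calc ‖(S t).adjoint x - x‖ = ‖(S t).adjoint (x - AdjDomain.vec z)
        + ((S t).adjoint (AdjDomain.vec z) - AdjDomain.vec z) - (x - AdjDomain.vec z)‖ := by
        rw [_root_.map_sub]; congr 1; abel
    _ ≤ ‖(S t).adjoint (x - AdjDomain.vec z)‖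
        + ‖(S t).adjoint (AdjDomain.vec z) - AdjDomain.vec z‖ + ‖x - AdjDomain.vec z‖ :=
        (norm_sub_le _ _).trans (add_le_add_left (norm_add_le _ _) _)
    _ < ε := by linarith

end Real

/-- The adjoint group `t ↦ S(t)*`. -/
def dual (S : C0Group 𝕜 H) : C0Group 𝕜 H where
  toFun t := (S t).adjoint
  map_zero := by rw [S.map_zero]; exact ContinuousLinearMap.adjoint_id
  map_add s t := by rw [add_comm, S.map_add, ContinuousLinearMap.adjoint_comp]
  tendsto_zero x := by
    let _ : NormedSpace ℝ H := NormedSpace.restrictScalars ℝ 𝕜 H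
    have : IsScalarTower ℝ 𝕜 H := IsScalarTower.of_algebraMap_smul fun _ _ => rfl
    exact S.tendsto_adjoint_zero x

/-- The groups `S` and `S'` are adjoint to each other. -/
def IsDual (S S' : C0Group 𝕜 H) : Prop := ∀ (t : ℝ) (x y : H), ⟪S' t x, y⟫_𝕜 = ⟪x, S t y⟫_𝕜

theorem isDual_dual (S : C0Group 𝕜 H) : S.IsDual S.dual := fun t x y =>
  ContinuousLinearMap.adjoint_inner_left (S t) y x

theorem IsDual.symm {S S' : C0Group 𝕜 H} (h : S.IsDual S') : S'.IsDual S := fun t x y => by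
  rw [← inner_conj_symm, ← h t y x, inner_conj_symm]

theorem IsDual.rev {S S' : C0Group 𝕜 H} (h : S.IsDual S') : S.rev.IsDual S'.rev :=
  fun t x y => h (-t) x y

theorem IsDual.scale {S S' : C0Group 𝕜 H} (h : S.IsDual S') (a : ℝ) :
    (S.scale a).IsDual (S'.scale a) := fun t x y => by
  rw [scale_apply, scale_apply, inner_smul_left, inner_smul_right, h t x y, RCLike.conj_ofReal]

section Real

variable [NormedSpace ℝ H] [IsScalarTower ℝ 𝕜 H]

/-- Testing against `x` gives `S(τ)* z - z = ∫₀^τ S(s)* A* z ds`, which is differentiable at 0. With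
`AdjDomain.exists_of_hasGenerator_dual` this identifies `A*` with the generator of the adjoint
group. -/
theorem AdjDomain.hasGenerator_dual {S : C0Group 𝕜 H} (z : S.AdjDomain) :
    S.dual.HasGenerator (AdjDomain.vec z) (AdjDomain.adj z) := by
  have h : ∀ τ : ℝ, S.dual τ (AdjDomain.vec z) - AdjDomain.vec z =
      ∫ s in (0 : ℝ)..τ, S.dual s (AdjDomain.adj z) := by
    intro τ
    refine ext_inner_right 𝕜 fun x => ?_
    rw [inner_intervalIntegral_left ((S.dual.continuous_apply _).intervalIntegrable _ _),
      inner_sub_left, S.isDual_dual τ, ← inner_sub_right, ← AdjDomain.inner_adj_integral z,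
      inner_intervalIntegral_right ((S.continuous_apply _).intervalIntegrable _ _)]
    simp_rw [S.isDual_dual _ _ x]
  rw [hasGenerator_iff_hasDerivAt]
  have hc := S.dual.continuous_apply (AdjDomain.adj z)
  have h2 : HasDerivAt (fun t => ∫ s in (0 : ℝ)..t, S.dual s (AdjDomain.adj z))
      (S.dual 0 (AdjDomain.adj z)) 0 :=
    intervalIntegral.integral_hasDerivAt_right (hc.intervalIntegrable _ _)
      hc.aestronglyMeasurable.stronglyMeasurableAtFilter hc.continuousAt
  rw [map_zero_apply] at h2
  have h3 := h2.add_const (AdjDomain.vec z)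
  refine h3.congr_of_eventuallyEq (Eventually.of_forall fun t => ?_)
  simp only
  rw [← h, sub_add_cancel]

theorem HasGenerator.inner_eq {S S' : C0Group 𝕜 H} (hS : S.IsDual S') {x x' y y' : H}
    (hx : S'.HasGenerator x x') (hy : S.HasGenerator y y') : ⟪x', y⟫_𝕜 = ⟪x, y'⟫_𝕜 := by
  have h1 := Tendsto.inner (𝕜 := 𝕜) hx (tendsto_const_nhds (x := y))
  have h2 := Tendsto.inner (𝕜 := 𝕜) (tendsto_const_nhds (x := x)) hy
  refine tendsto_nhds_unique (h1.congr fun t => ?_) h2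
  rw [inner_smul_left, inner_smul_right, inner_sub_left, inner_sub_right, hS t]
  simp

theorem AdjDomain.exists_of_hasGenerator_dual {S : C0Group 𝕜 H} {x z : H}
    (h : S.dual.HasGenerator x z) :
    ∃ Z : S.AdjDomain, AdjDomain.vec Z = x ∧ AdjDomain.adj Z = z :=
  AdjDomain.exists_of_inner fun w => h.inner_eq S.isDual_dual (S.hasGenerator_generator w)

theorem AdjDomain.ext {S : C0Group 𝕜 H} {z w : S.AdjDomain}
    (h : AdjDomain.vec z = AdjDomain.vec w) : z = w := by
  have h1 : AdjDomain.adj z = AdjDomain.adj w :=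
    tendsto_nhds_unique (AdjDomain.hasGenerator_dual z) (h ▸ AdjDomain.hasGenerator_dual w)
  refine Subtype.ext ?_
  refine (WithLp.equiv 2 (H × H)).injective (Prod.ext h h1)

theorem vec_adjMap (S : C0Group 𝕜 H) (τ : ℝ) (z : S.AdjDomain) :
    AdjDomain.vec (S.adjMap τ z) = S.dual τ (AdjDomain.vec z) := rfl

theorem adj_adjMap (S : C0Group 𝕜 H) (τ : ℝ) (z : S.AdjDomain) :
    AdjDomain.adj (S.adjMap τ z) = S.dual τ (AdjDomain.adj z) :=
  tendsto_nhds_unique (AdjDomain.hasGenerator_dual (S.adjMap τ z)) ((AdjDomain.hasGenerator_dual z).map τ)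

theorem continuous_adjDomain_iff {S : C0Group 𝕜 H} {X : Type*} [TopologicalSpace X]
    {g : X → S.AdjDomain} : Continuous g ↔
      (Continuous fun x => AdjDomain.vec (g x)) ∧ Continuous fun x => AdjDomain.adj (g x) := by
  rw [continuous_induced_rng, ← (WithLp.homeomorphProd 2 H H).comp_continuous_iff,
    continuous_prodMk.symm]
  rfl

end Real

end C0Group

/-! ### Mild and weak solutions of the inhomogeneous linear equation. -/

namespace C0Group

variable {𝕜 H : Type*} [RCLike 𝕜] [NormedAddCommGroup H] [InnerProductSpace 𝕜 H] [CompleteSpace H]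
  [NormedSpace ℝ H] [IsScalarTower ℝ 𝕜 H]

/-- The mild solution `S(t) a + ∫₀ᵗ S(t - s) h(s) ds` of `e' = A e + h`, `e(0) = a`. -/
def mild (S : C0Group 𝕜 H) (a : H) (h : ℝ → H) (t : ℝ) : H :=
  S t (a + ∫ s in (0 : ℝ)..t, S (-s) (h s))

theorem mild_zero (S : C0Group 𝕜 H) (a : H) (h : ℝ → H) : S.mild a h 0 = a := by
  simp [mild, map_zero_apply]

theorem hasDerivAt_primitive (S : C0Group 𝕜 H) {h : ℝ → H} (hh : Continuous h) (a : H) (t : ℝ) :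
    HasDerivAt (fun t => a + ∫ s in (0 : ℝ)..t, S (-s) (h s)) (S (-t) (h t)) t := by
  have hc : Continuous fun s => S (-s) (h s) := S.continuous_comp continuous_neg hh
  exact (intervalIntegral.integral_hasDerivAt_right (hc.intervalIntegrable _ _)
    hc.aestronglyMeasurable.stronglyMeasurableAtFilter hc.continuousAt).const_add a

theorem continuous_primitive (S : C0Group 𝕜 H) {h : ℝ → H} (hh : Continuous h) (a : H) :
    Continuous fun t => a + ∫ s in (0 : ℝ)..t, S (-s) (h s) :=
  continuous_iff_continuousAt.2 fun t => (S.hasDerivAt_primitive hh a t).continuousAt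

theorem continuous_mild (S : C0Group 𝕜 H) {h : ℝ → H} (hh : Continuous h) (a : H) :
    Continuous (S.mild a h) :=
  S.continuous_comp continuous_id (S.continuous_primitive hh a)

theorem mild_congr (S : C0Group 𝕜 H) (a : H) {h h' : ℝ → H} {t : ℝ} (ht : 0 ≤ t)
    (hh : EqOn h h' (Icc 0 t)) : S.mild a h t = S.mild a h' t := by
  rw [mild, mild, intervalIntegral.integral_congr (g := fun s => S (-s) (h' s)) fun s hs => ?_]
  rw [uIcc_of_le ht] at hs
  simp only [hh hs]

/-- The mild solution is `S(t) p(t)` with `p` continuously differentiable. It need not be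
differentiable itself, but moving `S(t)` onto `φ` gives `⟪S'(t) φ, p(t)⟫`, where both factors are.
-/
theorem hasDerivAt_inner_mild {S S' : C0Group 𝕜 H} (hS : S.IsDual S') {h : ℝ → H}
    (hh : Continuous h) (a : H) {φ φ' : H} (hφ : S'.HasGenerator φ φ') (t : ℝ) :
    HasDerivAt (fun t => ⟪φ, S.mild a h t⟫_𝕜) (⟪φ', S.mild a h t⟫_𝕜 + ⟪φ, h t⟫_𝕜) t := by
  have h1 := (hφ.hasDerivAt t).inner 𝕜 (S.hasDerivAt_primitive hh a t)
  have hS' : ∀ (t : ℝ) (x y : H), ⟪S' t x, y⟫_𝕜 = ⟪x, S t y⟫_𝕜 := hS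
  simp only [hS', apply_neg_apply] at h1
  rw [add_comm]
  exact h1

theorem inner_mild_eq {S S' : C0Group 𝕜 H} (hS : S.IsDual S') {h : ℝ → H}
    (hh : Continuous h) (a : H) {φ φ' : H} (hφ : S'.HasGenerator φ φ') (t : ℝ) :
    ⟪φ, S.mild a h t⟫_𝕜 = ⟪φ, a⟫_𝕜 + ∫ s in (0 : ℝ)..t, (⟪φ', S.mild a h s⟫_𝕜 + ⟪φ, h s⟫_𝕜) := by
  have hc := S.continuous_mild hh a
  have hc' : Continuous fun s => ⟪φ', S.mild a h s⟫_𝕜 + ⟪φ, h s⟫_𝕜 :=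
    (continuous_const.inner hc).add (continuous_const.inner hh)
  rw [intervalIntegral.integral_eq_sub_of_hasDerivAt
    (fun s _ => hasDerivAt_inner_mild hS hh a hφ s) (hc'.intervalIntegrable _ _), mild_zero]
  abel

/-- Weak solutions of `e' = A e + h` are mild solutions. -/
theorem eqOn_mild_of_weak {S S' : C0Group 𝕜 H} (hS : S.IsDual S') {e h : ℝ → H}
    (he : Continuous e) (hh : Continuous h) {a : H} {T : ℝ}
    (hw : ∀ φ φ' : H, S'.HasGenerator φ φ' → ∀ t ∈ Icc 0 T,
      ⟪φ, e t⟫_𝕜 = ⟪φ, a⟫_𝕜 + ∫ s in (0 : ℝ)..t, (⟪φ', e s⟫_𝕜 + ⟪φ, h s⟫_𝕜)) :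
    EqOn e (S.mild a h) (Icc 0 T) := by
  have hm := S.continuous_mild hh a
  have hd : Continuous fun t => e t - S.mild a h t := he.sub hm
  have hD : ∀ t, HasDerivAt (fun t => ∫ s in (0 : ℝ)..t, (e s - S.mild a h s))
      (e t - S.mild a h t) t := fun t =>
    intervalIntegral.integral_hasDerivAt_right (hd.intervalIntegrable _ _)
      hd.aestronglyMeasurable.stronglyMeasurableAtFilter hd.continuousAt
  have hkey : ∀ φ φ' : H, S'.HasGenerator φ φ' → ∀ t ∈ Icc 0 T,
      ⟪φ, e t - S.mild a h t⟫_𝕜 = ⟪φ', ∫ s in (0 : ℝ)..t, (e s - S.mild a h s)⟫_𝕜 := by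
    intro φ φ' hφ t ht
    have hi1 : IntervalIntegrable (fun s => ⟪φ', e s⟫_𝕜 + ⟪φ, h s⟫_𝕜) volume 0 t :=
      ((continuous_const.inner he).add (continuous_const.inner hh)).intervalIntegrable _ _
    have hi2 : IntervalIntegrable (fun s => ⟪φ', S.mild a h s⟫_𝕜 + ⟪φ, h s⟫_𝕜) volume 0 t :=
      ((continuous_const.inner hm).add (continuous_const.inner hh)).intervalIntegrable _ _
    rw [inner_sub_right, hw φ φ' hφ t ht, inner_mild_eq hS hh a hφ t, add_sub_add_left_eq_sub,
      ← intervalIntegral.integral_sub hi1 hi2,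
      inner_intervalIntegral_right (hd.intervalIntegrable _ _)]
    simp_rw [add_sub_add_right_eq_sub, inner_sub_right]
  -- Let `w` be the primitive of the difference. By `hkey`, `w' = A w` weakly, so `s ↦ ⟪S'(-s) φ,
  -- w(s)⟫` has zero derivative and vanishes at 0. Density of the test vectors gives `S(-t) w(t) =
  -- 0`.
  have hzero : ∀ t ∈ Icc 0 T, ∫ s in (0 : ℝ)..t, (e s - S.mild a h s) = 0 := by
    intro t ht
    have h1 : ∀ φ ∈ S'.generator.domain,
        ⟪φ, S (-t) (∫ s in (0 : ℝ)..t, (e s - S.mild a h s))⟫_𝕜 = ⟪φ, (0 : H)⟫_𝕜 := by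
      rintro φ ⟨φ', hφ⟩
      have h2 : ∀ s, HasDerivAt (fun s => ⟪S'.rev s φ, ∫ r in (0 : ℝ)..s, (e r - S.mild a h r)⟫_𝕜)
          (⟪S'.rev s φ, e s - S.mild a h s⟫_𝕜
            + ⟪S'.rev s (-φ'), ∫ r in (0 : ℝ)..s, (e r - S.mild a h r)⟫_𝕜) s :=
        fun s => (hφ.rev.hasDerivAt s).inner 𝕜 (hD s)
      have h3 := constant_of_has_deriv_right_zero (a := 0) (b := T)
        (f := fun s => ⟪S'.rev s φ, ∫ r in (0 : ℝ)..s, (e r - S.mild a h r)⟫_𝕜)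
        (fun s _ => (h2 s).continuousAt.continuousWithinAt) (fun s hs => by
          convert (h2 s).hasDerivWithinAt using 1
          rw [_root_.map_neg, inner_neg_left, rev_apply,
            hkey _ _ (hφ.map (-s)) s (Ico_subset_Icc_self hs), add_neg_cancel]) t ht
      simpa [rev_apply, hS (-t)] using h3
    have h4 : S (-t) (∫ s in (0 : ℝ)..t, (e s - S.mild a h s)) = 0 :=
      S'.dense_generator_domain.eq_of_inner_right 𝕜 h1
    rw [← S.apply_neg_apply t (∫ s in (0 : ℝ)..t, (e s - S.mild a h s)), h4, _root_.map_zero]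
  intro t ht
  refine sub_eq_zero.1 (S'.dense_generator_domain.eq_of_inner_right 𝕜 ?_)
  rintro φ ⟨φ', hφ⟩
  rw [hkey φ φ' hφ t ht, hzero t ht, inner_zero_right, inner_zero_right]

end C0Group

/-! ### Distributional derivatives on `(0, T)` and primitives. -/

section Distributions

variable {𝕜 : Type*} [RCLike 𝕜]

/-- `G` is only integrable, as the control term requires, so the integration by parts is the one for
absolutely continuous functions. The version over `𝕜` follows by composing with `re` and `im`. -/
theorem integral_deriv_mul_primitive_real {T : ℝ} {θ G : ℝ → ℝ} (hθ : ContDiff ℝ ∞ θ)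
    (h0 : θ 0 = 0) (hT : θ T = 0) (hG : IntervalIntegrable G volume 0 T) :
    ∫ t in (0 : ℝ)..T, deriv θ t * (∫ s in (0 : ℝ)..t, G s) = - ∫ t in (0 : ℝ)..T, θ t * G t := by
  have h1 : AbsolutelyContinuousOnInterval θ 0 T :=
    ((hθ.of_le (by simp)).contDiffOn (n := 1)).absolutelyContinuousOnInterval
  have h2 := hG.absolutelyContinuousOnInterval_intervalIntegral (c := 0) (by simp)
  have h3 := h1.integral_mul_deriv_eq_deriv_mul h2
  simp only [h0, hT, zero_mul, sub_zero, zero_sub] at h3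
  rw [eq_neg_iff_add_eq_zero, ← neg_eq_iff_add_eq_zero, ← h3]
  refine intervalIntegral.integral_congr_ae ?_
  filter_upwards [hG.ae_hasDerivAt_integral] with x hx hx'
  rw [(hx (uIoc_subset_uIcc hx') 0 (by simp)).deriv]

theorem integral_deriv_mul_primitive {T : ℝ} {θ : ℝ → ℝ} {G : ℝ → 𝕜} (hθ : ContDiff ℝ ∞ θ)
    (h0 : θ 0 = 0) (hT : θ T = 0) (hG : IntervalIntegrable G volume 0 T) :
    ∫ t in (0 : ℝ)..T, ((deriv θ t : ℝ) : 𝕜) * (∫ s in (0 : ℝ)..t, G s) =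
      - ∫ t in (0 : ℝ)..T, ((θ t : ℝ) : 𝕜) * G t := by
  have hθ' : Continuous fun t => ((deriv θ t : ℝ) : 𝕜) :=
    RCLike.continuous_ofReal.comp (hθ.continuous_deriv (by simp))
  have hθc : Continuous fun t => ((θ t : ℝ) : 𝕜) := RCLike.continuous_ofReal.comp hθ.continuous
  have hi1 : IntervalIntegrable (fun t => ((deriv θ t : ℝ) : 𝕜) * (∫ s in (0 : ℝ)..t, G s))
      volume 0 T :=
    (hθ'.continuousOn.mul
      (intervalIntegral.continuousOn_primitive_interval' hG (by simp))).intervalIntegrable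
  have hi2 : IntervalIntegrable (fun t => ((θ t : ℝ) : 𝕜) * G t) volume 0 T :=
    hG.continuousOn_mul hθc.continuousOn
  have hsub : ∀ t ∈ uIcc 0 T, IntervalIntegrable G volume 0 t := fun t ht =>
    hG.mono_set (uIcc_subset_uIcc_left ht)
  have key : ∀ L : 𝕜 →L[ℝ] ℝ,
      L (∫ t in (0 : ℝ)..T, ((deriv θ t : ℝ) : 𝕜) * (∫ s in (0 : ℝ)..t, G s)) =
      L (- ∫ t in (0 : ℝ)..T, ((θ t : ℝ) : 𝕜) * G t) := by
    intro L
    have hL : IntervalIntegrable (fun t => L (G t)) volume 0 T :=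
      ⟨L.integrable_comp hG.1, L.integrable_comp hG.2⟩
    have h := integral_deriv_mul_primitive_real hθ h0 hT hL
    rw [_root_.map_neg, ← L.intervalIntegral_comp_comm hi1, ← L.intervalIntegral_comp_comm hi2]
    simp only [← RCLike.real_smul_eq_coe_mul, L.map_smul, smul_eq_mul]
    rw [← h]
    refine intervalIntegral.integral_congr fun t ht => ?_
    rw [L.intervalIntegral_comp_comm (hsub t ht)]
  exact RCLike.ext (key RCLike.reCLM) (key RCLike.imCLM)

theorem hasDistribDeriv_primitive {T : ℝ} (hT : 0 < T) {F G : ℝ → 𝕜} {c : 𝕜}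
    (hG : IntervalIntegrable G volume 0 T)
    (hF : ∀ t ∈ Icc 0 T, F t = c + ∫ s in (0 : ℝ)..t, G s) : HasDistribDeriv T F G := by
  intro θ hθ _ hs
  have hz : ∀ x, x ∉ Ioo 0 T → θ x = 0 := fun x hx => by
    by_contra h
    exact hx (hs (subset_tsupport _ h))
  have h0 : θ 0 = 0 := hz 0 (by simp)
  have h1 : θ T = 0 := hz T (by simp)
  rw [← integral_Ioc_eq_integral_Ioo, ← integral_Ioc_eq_integral_Ioo,
    ← intervalIntegral.integral_of_le hT.le, ← intervalIntegral.integral_of_le hT.le,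
    ← integral_deriv_mul_primitive hθ h0 h1 hG]
  have hθ' : Continuous fun t => ((deriv θ t : ℝ) : 𝕜) :=
    RCLike.continuous_ofReal.comp (hθ.continuous_deriv (by simp))
  have hd : ∀ t, HasDerivAt (fun t => ((θ t : ℝ) : 𝕜)) ((deriv θ t : ℝ) : 𝕜) t := fun t =>
    (RCLike.ofRealCLM (K := 𝕜)).hasFDerivAt.comp_hasDerivAt t
      (hθ.differentiable (by simp) t).hasDerivAt
  have hc : ∫ t in (0 : ℝ)..T, ((deriv θ t : ℝ) : 𝕜) * c = 0 := by
    rw [intervalIntegral.integral_mul_const,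
      intervalIntegral.integral_eq_sub_of_hasDerivAt (f := fun t => ((θ t : ℝ) : 𝕜))
        (fun t _ => hd t)
        (hθ'.intervalIntegrable _ _)]
    simp [h0, h1]
  have hi1 : IntervalIntegrable (fun t => ((deriv θ t : ℝ) : 𝕜) * (∫ s in (0 : ℝ)..t, G s))
      volume 0 T :=
    (hθ'.continuousOn.mul
      (intervalIntegral.continuousOn_primitive_interval' hG (by simp))).intervalIntegrable
  have hi2 : IntervalIntegrable (fun t => ((deriv θ t : ℝ) : 𝕜) * c) volume 0 T :=
    (hθ'.mul continuous_const).intervalIntegrable _ _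
  rw [← zero_add (∫ t in (0 : ℝ)..T, _ * ∫ s in (0 : ℝ)..t, G s), ← hc,
    ← intervalIntegral.integral_add hi2 hi1]
  refine intervalIntegral.integral_congr fun t ht => ?_
  rw [uIcc_of_le hT.le] at ht
  simp only [hF t ht, mul_add]

/-- The lemma of du Bois-Reymond: a test function of zero mean is the derivative of a test function.
With `c = ∫ η F` for a fixed `η` of integral 1, `F - c` is orthogonal to every test function.
Continuity extends the almost everywhere equality to the closed interval. -/
theorem eq_const_of_integral_deriv_mul_eq_zero {T : ℝ} (hT : 0 < T) {F : ℝ → 𝕜}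
    (hF : ContinuousOn F (Icc 0 T))
    (h : ∀ θ : ℝ → ℝ, ContDiff ℝ ∞ θ → HasCompactSupport θ → tsupport θ ⊆ Ioo 0 T →
      ∫ t in Ioo 0 T, ((deriv θ t : ℝ) : 𝕜) * F t = 0) :
    ∀ t ∈ Icc 0 T, F t = F 0 := by
  let b : ContDiffBump (T / 2) := ⟨T / 8, T / 4, by positivity, by linarith⟩
  let η : ℝ → ℝ := b.normed volume
  have hη1 : ∫ x, η x = 1 := b.integral_normed
  have hηd : ContDiff ℝ ∞ η := b.contDiff_normed
  have hηc : HasCompactSupport η := b.hasCompactSupport_normed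
  have hηs : tsupport η ⊆ Ioo 0 T := by
    rw [b.tsupport_normed_eq, Real.closedBall_eq_Icc]
    change Icc (T / 2 - T / 4) (T / 2 + T / 4) ⊆ _
    exact fun x hx => ⟨by linarith [hx.1], by linarith [hx.2]⟩
  set c : 𝕜 := ∫ t in Ioo 0 T, ((η t : ℝ) : 𝕜) * F t with hc
  have hFi : IntegrableOn F (Ioo 0 T) :=
    (hF.integrableOn_Icc).mono_set Ioo_subset_Icc_self
  have hmul : ∀ g : ℝ → ℝ, Continuous g → IntegrableOn (fun t => ((g t : ℝ) : 𝕜) * F t) (Ioo 0 T) :=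
    fun g hg => (((RCLike.continuous_ofReal.comp hg).continuousOn.mul hF).integrableOn_Icc).mono_set
      Ioo_subset_Icc_self
  have key : ∀ χ : ℝ → ℝ, ContDiff ℝ ∞ χ → HasCompactSupport χ → tsupport χ ⊆ Ioo 0 T →
      ∫ t, χ t • (F t - c) = 0 := by
    intro χ hχ hχc hχs
    have hcχ := hχ.continuous
    have hcη := hηd.continuous
    -- Subtracting a multiple of `η` makes the mean zero, so that the primitive `θ` of `g` vanishes
    -- to the right of the support of `g` as well as to its left.
    let g : ℝ → ℝ := fun t => χ t - (∫ x, χ x) * η t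
    have hg : ContDiff ℝ ∞ g := hχ.sub (contDiff_const.mul hηd)
    have hgi : Integrable g := (hcχ.integrable_of_hasCompactSupport hχc).sub
      ((hcη.integrable_of_hasCompactSupport hηc).const_mul _)
    have hg0 : ∫ x, g x = 0 := by
      rw [integral_sub (hcχ.integrable_of_hasCompactSupport hχc)
        ((hcη.integrable_of_hasCompactSupport hηc).const_mul _), integral_const_mul, hη1]
      ring
    have hK : IsCompact (tsupport χ ∪ tsupport η) := hχc.isCompact.union hηc.isCompact
    have hKs : tsupport χ ∪ tsupport η ⊆ Ioo 0 T := union_subset hχs hηs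
    have hgz : ∀ x, x ∉ tsupport χ ∪ tsupport η → g x = 0 := by
      intro x hx
      rw [mem_union, not_or] at hx
      simp [g, image_eq_zero_of_notMem_tsupport hx.1, image_eq_zero_of_notMem_tsupport hx.2]
    obtain ⟨p, q, hp, hq, hKpq⟩ : ∃ p q : ℝ, 0 < p ∧ q < T ∧ tsupport χ ∪ tsupport η ⊆ Icc p q := by
      have hne : (tsupport χ ∪ tsupport η).Nonempty := by
        by_contra hemp
        rw [not_nonempty_iff_eq_empty, union_empty_iff] at hemp
        have : η = 0 := tsupport_eq_empty_iff.1 hemp.2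
        simp [this] at hη1
      exact ⟨_, _, (hKs (hK.sInf_mem hne)).1, (hKs (hK.sSup_mem hne)).2,
        fun x hx => ⟨csInf_le hK.bddBelow hx, le_csSup hK.bddAbove hx⟩⟩
    let θ : ℝ → ℝ := fun t => ∫ s in (0 : ℝ)..t, g s
    have hθd : ∀ t, HasDerivAt θ (g t) t := fun t =>
      intervalIntegral.integral_hasDerivAt_right (hg.continuous.intervalIntegrable _ _)
        hg.continuous.aestronglyMeasurable.stronglyMeasurableAtFilter hg.continuous.continuousAt
    have hθ' : deriv θ = g := funext fun t => (hθd t).deriv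
    have hθ : ContDiff ℝ ∞ θ := by
      rw [contDiff_infty_iff_deriv, hθ']
      exact ⟨fun t => (hθd t).differentiableAt, hg⟩
    have hθ0 : ∀ t, t ∉ Icc p q → θ t = 0 := by
      intro t ht
      rw [mem_Icc, not_and_or, not_le, not_le] at ht
      have hgpq : ∀ x, x ∉ Icc p q → g x = 0 := fun x hx => hgz x fun h' => hx (hKpq h')
      rcases ht with ht | ht
      · refine (intervalIntegral.integral_congr (g := fun _ => 0) fun s hs => ?_).trans (by simp)
        refine hgpq s fun hs' => ?_
        have h2 := hs.2
        rcases le_max_iff.1 h2 with h3 | h3 <;> linarith [hs'.1]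
      · rw [← hg0]
        change ∫ s in (0 : ℝ)..t, g s = _
        refine intervalIntegral.integral_eq_integral_of_support_subset fun x hx => ?_
        have hx' : x ∈ Icc p q := by
          by_contra hx'
          exact hx (hgpq x hx')
        exact ⟨by linarith [hx'.1], by linarith [hx'.2]⟩
    have hθs : tsupport θ ⊆ Icc p q := closure_minimal (fun x hx => by
      by_contra h'
      exact hx (hθ0 x h')) isClosed_Icc
    have h1 := h θ hθ (HasCompactSupport.of_support_subset_isCompact isCompact_Icc
      ((subset_tsupport _).trans hθs)) (hθs.trans fun x hx => ⟨by linarith [hx.1], by linarith [hx.2]⟩)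
    rw [hθ'] at h1
    have hout : ∀ x, x ∉ Ioo 0 T → χ x = 0 := fun x hx =>
      image_eq_zero_of_notMem_tsupport fun h' => hx (hχs h')
    have hχint : ∫ x, χ x = ∫ x in Ioo 0 T, χ x :=
      (setIntegral_eq_integral_of_forall_compl_eq_zero hout).symm
    have h2 : ∀ t, ((g t : ℝ) : 𝕜) * F t =
        ((χ t : ℝ) : 𝕜) * F t - ((∫ x, χ x : ℝ) : 𝕜) * (((η t : ℝ) : 𝕜) * F t) := by
      intro t
      simp only [g, RCLike.ofReal_sub, RCLike.ofReal_mul]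
      ring
    simp only [h2] at h1
    rw [integral_sub (hmul χ hcχ) ((hmul η hcη).const_mul _), integral_const_mul, ← hc] at h1
    rw [← setIntegral_eq_integral_of_forall_compl_eq_zero (s := Ioo 0 T)
      (fun x hx => by rw [hout x hx, zero_smul])]
    simp only [RCLike.real_smul_eq_coe_mul, mul_sub]
    rw [integral_sub (hmul χ hcχ), integral_mul_const, ← h1, hχint, integral_ofReal]
    exact (RCLike.continuous_ofReal.comp hcχ |>.mul continuous_const).continuousOn.integrableOn_Icc.mono_set
      Ioo_subset_Icc_self
  have hae := IsOpen.ae_eq_zero_of_integral_contDiff_smul_eq_zero (μ := volume)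
    (f := fun t => F t - c) isOpen_Ioo
    (((hF.sub continuousOn_const).mono Ioo_subset_Icc_self).locallyIntegrableOn measurableSet_Ioo)
    key
  have heq : EqOn F (fun _ => c) (Icc 0 T) := by
    refine Measure.eqOn_Icc_of_ae_eq (μ := volume) hT.ne ?_ hF continuousOn_const
    rw [← Measure.restrict_congr_set Ioo_ae_eq_Icc]
    refine (ae_restrict_iff' measurableSet_Ioo).2 ?_
    filter_upwards [hae] with x hx hx'
    exact sub_eq_zero.1 (hx hx')
  intro t ht
  rw [heq ht, heq ⟨le_rfl, hT.le⟩]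

theorem HasDistribDeriv.eq_add_integral {T : ℝ} (hT : 0 < T) {F G : ℝ → 𝕜}
    (h : HasDistribDeriv T F G) (hF : ContinuousOn F (Icc 0 T))
    (hG : IntervalIntegrable G volume 0 T) :
    ∀ t ∈ Icc 0 T, F t = F 0 + ∫ s in (0 : ℝ)..t, G s := by
  have hP : HasDistribDeriv T (fun t => ∫ s in (0 : ℝ)..t, G s) G :=
    hasDistribDeriv_primitive hT hG (c := 0) fun t _ => (zero_add _).symm
  have hPc : ContinuousOn (fun t => ∫ s in (0 : ℝ)..t, G s) (Icc 0 T) := by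
    rw [← uIcc_of_le hT.le]
    exact intervalIntegral.continuousOn_primitive_interval' hG (by simp)
  have h1 := eq_const_of_integral_deriv_mul_eq_zero hT (hF.sub hPc) fun θ hθ hc hs => by
    have hθ' : Continuous fun t => ((deriv θ t : ℝ) : 𝕜) :=
      RCLike.continuous_ofReal.comp (hθ.continuous_deriv (by simp))
    simp only [Pi.sub_apply, mul_sub]
    rw [integral_sub, h θ hθ hc hs, hP θ hθ hc hs, sub_self]
    · exact (hθ'.continuousOn.mul hF).integrableOn_Icc.mono_set Ioo_subset_Icc_self
    · exact (hθ'.continuousOn.mul hPc).integrableOn_Icc.mono_set Ioo_subset_Icc_self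
  intro t ht
  have h2 := h1 t ht
  simp only [Pi.sub_apply, intervalIntegral.integral_same, sub_zero] at h2
  rw [← h2, sub_add_cancel]

end Distributions

/-! ### Square-integrable functions of time. -/

theorem sq_intervalIntegral_le {T : ℝ} (hT : 0 < T) {g : ℝ → ℝ} (hg : Continuous g) :
    (∫ s in (0 : ℝ)..T, g s) ^ 2 ≤ T * ∫ s in (0 : ℝ)..T, g s ^ 2 := by
  set m := (∫ s in (0 : ℝ)..T, g s) / T with hm
  have h0 : 0 ≤ ∫ s in (0 : ℝ)..T, (g s - m) ^ 2 :=
    intervalIntegral.integral_nonneg hT.le fun s _ => sq_nonneg _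
  have h1 : ∀ s, (g s - m) ^ 2 = g s ^ 2 - 2 * m * g s + m ^ 2 := fun s => by ring
  simp_rw [h1] at h0
  rw [intervalIntegral.integral_add (Continuous.intervalIntegrable (by fun_prop) _ _)
      (Continuous.intervalIntegrable (by fun_prop) _ _),
    intervalIntegral.integral_sub (Continuous.intervalIntegrable (by fun_prop) _ _)
      (Continuous.intervalIntegrable (by fun_prop) _ _), intervalIntegral.integral_const_mul,
    intervalIntegral.integral_const, smul_eq_mul, sub_zero] at h0
  have h2 : ∫ s in (0 : ℝ)..T, g s = m * T := by rw [hm]; field_simp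
  rw [h2] at h0 ⊢
  nlinarith

theorem norm_toLp_sq_eq {U : Type*} [NormedAddCommGroup U] {T : ℝ} (hT : 0 < T) {g : ℝ → U}
    (hg : MemLp g 2 (volume.restrict (Ioo 0 T))) :
    ‖hg.toLp g‖ ^ 2 = ∫ s in (0 : ℝ)..T, ‖g s‖ ^ 2 := by
  rw [Lp.norm_toLp, hg.eLpNorm_eq_integral_rpow_norm (by simp) (by simp),
    intervalIntegral.integral_of_le hT.le, integral_Ioc_eq_integral_Ioo]
  have h0 : 0 ≤ ∫ s in Ioo 0 T, ‖g s‖ ^ 2 := integral_nonneg fun s => sq_nonneg _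
  simp only [ENNReal.toReal_ofNat, Real.rpow_ofNat]
  rw [ENNReal.toReal_ofReal (by positivity), ← Real.rpow_natCast, ← Real.rpow_mul h0]
  simp

theorem Continuous.memLp_Ioo {U : Type*} [NormedAddCommGroup U] {g : ℝ → U} (hg : Continuous g)
    (T : ℝ) : MemLp g 2 (volume.restrict (Ioo 0 T)) := by
  obtain ⟨C, hC⟩ := (isCompact_Icc (a := 0) (b := T)).exists_bound_of_continuousOn hg.continuousOn
  exact MemLp.of_bound hg.aestronglyMeasurable C
    ((ae_restrict_iff' measurableSet_Ioo).2 (ae_of_all _ fun x hx => hC x (Ioo_subset_Icc_self hx)))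

/-! ### Admissibility by duality, and smoothing into `D(A*)`. -/

section Control

open C0Group

variable {𝕜 H U : Type*} [RCLike 𝕜] [NormedAddCommGroup H] [InnerProductSpace 𝕜 H]
  [CompleteSpace H] [NormedAddCommGroup U] [InnerProductSpace 𝕜 U] [CompleteSpace U]
  [NormedSpace ℝ H] [IsScalarTower ℝ 𝕜 H]

theorem C0Group.continuous_adjMap (S : C0Group 𝕜 H) (z : S.AdjDomain) :
    Continuous fun t => S.adjMap t z :=
  continuous_adjDomain_iff.2 ⟨S.dual.continuous_apply _, by
    simp_rw [adj_adjMap]; exact S.dual.continuous_apply _⟩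

/-- Admissibility is qualitative; the uniform boundedness principle makes it quantitative. Write `Ψ
Z` for `s ↦ B* S(T - s)* Z` in `L²`. Each `u` satisfies `⟪Ψ Z, u⟫ = ⟪Z, φ(T)⟫` for the function `φ`
produced by `u`, so the functionals `‖Z‖⁻¹ ⟪Ψ Z, ·⟫` (norm of `Z` in `H`) are pointwise bounded,
hence uniformly bounded. -/
theorem IsAdmissible.exists_sub_bound {S : C0Group 𝕜 H} {B : U →L[𝕜] S.AdjDual}
    (hB : IsAdmissible B) {T : ℝ} (hT : 0 < T) :
    ∃ C : ℝ, 0 ≤ C ∧ ∀ Z : S.AdjDomain,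
      ∫ s in (0 : ℝ)..T, ‖controlAdjoint B (S.adjMap (T - s) Z)‖ ^ 2 ≤
        C * ‖AdjDomain.vec Z‖ ^ 2 := by
  let ψ : S.AdjDomain → ℝ → U := fun Z s => controlAdjoint B (S.adjMap (T - s) Z)
  have hψ : ∀ Z, Continuous (ψ Z) := fun Z =>
    (controlAdjoint B).continuous.comp
      ((S.continuous_adjMap Z).comp (continuous_const.sub continuous_id))
  have hL : ∀ Z, MemLp (ψ Z) 2 (volume.restrict (Ioo 0 T)) := fun Z => (hψ Z).memLp_Ioo T
  let Ψ : S.AdjDomain → Lp U 2 (volume.restrict (Ioo 0 T)) := fun Z => (hL Z).toLp (ψ Z)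
  have hex : ∀ u : Lp U 2 (volume.restrict (Ioo 0 T)), ∃ p : H, ∀ Z : S.AdjDomain,
      ⟪Ψ Z, u⟫_𝕜 = ⟪AdjDomain.vec Z, p⟫_𝕜 := by
    intro u
    obtain ⟨φ, -, hφ⟩ := hB T hT u (Lp.memLp u)
    refine ⟨φ T, fun Z => ?_⟩
    rw [hφ T ⟨hT.le, le_rfl⟩ Z, L2.inner_def, intervalIntegral.integral_of_le hT.le,
      integral_Ioc_eq_integral_Ioo]
    refine integral_congr_ae ?_
    filter_upwards [(hL Z).coeFn_toLp] with s hs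
    rw [hs, ← inner_controlAdjoint]
  obtain ⟨C, hC⟩ := banach_steinhaus
    (g := fun Z : S.AdjDomain => ((‖AdjDomain.vec Z‖⁻¹ : ℝ) : 𝕜) • innerSL 𝕜 (Ψ Z)) fun u => by
      obtain ⟨p, hp⟩ := hex u
      refine ⟨‖p‖, fun Z => ?_⟩
      rw [_root_.smul_apply, innerSL_apply_apply, hp, norm_smul, RCLike.norm_ofReal,
        abs_of_nonneg (by positivity)]
      rcases eq_or_ne (‖AdjDomain.vec Z‖) 0 with h0 | h0
      · simp [h0]
      · rw [inv_mul_le_iff₀ (by positivity)]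
        exact norm_inner_le_norm _ _
  refine ⟨C ^ 2, sq_nonneg C, fun Z => ?_⟩
  rw [← norm_toLp_sq_eq hT (hL Z), ← mul_pow]
  refine pow_le_pow_left₀ (norm_nonneg _) ?_ 2
  change ‖Ψ Z‖ ≤ _
  -- If `Z` vanishes in `H`, the normalising factor is `0⁻¹ = 0` and the uniform bound is empty;
  -- testing with `u = Ψ Z` gives `‖Ψ Z‖² = 0` instead.
  rcases eq_or_ne (‖AdjDomain.vec Z‖) 0 with h0 | h0
  · obtain ⟨p, hp⟩ := hex (Ψ Z)
    have h1 := hp Z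
    rw [norm_eq_zero.1 h0, inner_zero_left, inner_self_eq_zero] at h1
    simp [h1, h0]
  · have h1 := hC Z
    rw [norm_smul, RCLike.norm_ofReal, abs_of_nonneg (by positivity), innerSL_apply_norm,
      inv_mul_le_iff₀ (by positivity)] at h1
    linarith

/-- The estimate is needed along the orbits of `-A*`. The group property allows replacing `Z` by
`S(-T)* Z`, at the price of the factor `‖S(-T)*‖²`. -/
theorem IsAdmissible.exists_bound {S : C0Group 𝕜 H} {B : U →L[𝕜] S.AdjDual}
    (hB : IsAdmissible B) {T : ℝ} (hT : 0 < T) :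
    ∃ C : ℝ, 0 ≤ C ∧ ∀ Z : S.AdjDomain,
      ∫ s in (0 : ℝ)..T, ‖controlAdjoint B (S.adjMap (-s) Z)‖ ^ 2 ≤
        C * ‖AdjDomain.vec Z‖ ^ 2 := by
  obtain ⟨C, hC, h⟩ := hB.exists_sub_bound hT
  refine ⟨C * ‖S.dual (-T)‖ ^ 2, by positivity, fun Z => ?_⟩
  have h1 := h (S.adjMap (-T) Z)
  have h2 : ∀ s, S.adjMap (T - s) (S.adjMap (-T) Z) = S.adjMap (-s) Z := fun s =>
    AdjDomain.ext (by
      rw [vec_adjMap, vec_adjMap, vec_adjMap, ← map_add_apply]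
      congr 2
      ring)
  simp_rw [h2] at h1
  refine h1.trans ?_
  rw [mul_assoc, ← mul_pow]
  gcongr
  exact (S.dual (-T)).le_opNorm _

/-- The operator `x ↦ τ⁻¹ ∫₀^τ S(s)* x ds` from `H` to `D(A*)`. -/
def C0Group.smoothing (S : C0Group 𝕜 H) (τ : ℝ) : H →L[𝕜] S.AdjDomain :=
  ContinuousLinearMap.codRestrict
    ((WithLp.prodContinuousLinearEquiv 2 𝕜 H H).symm.toContinuousLinearMap.comp
      (((τ⁻¹ : ℝ) : 𝕜) • (S.dual.integralCLM τ).prod (S.dual τ - ContinuousLinearMap.id 𝕜 H)))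
    S.AdjDomain fun x => by
      obtain ⟨Z, h1, h2⟩ := AdjDomain.exists_of_hasGenerator_dual
        ((S.dual.hasGenerator_integral τ x).smul ((τ⁻¹ : ℝ) : 𝕜))
      convert Z.2
      exact (WithLp.equiv 2 (H × H)).injective (Prod.ext h1.symm h2.symm)

theorem C0Group.vec_smoothing (S : C0Group 𝕜 H) (τ : ℝ) (x : H) :
    AdjDomain.vec (S.smoothing τ x) = τ⁻¹ • ∫ s in (0 : ℝ)..τ, S.dual s x := by
  rw [RCLike.real_smul_eq_coe_smul (K := 𝕜)]; rfl

theorem C0Group.adj_smoothing (S : C0Group 𝕜 H) (τ : ℝ) (x : H) :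
    AdjDomain.adj (S.smoothing τ x) = ((τ : 𝕜)⁻¹) • (S.dual τ x - x) := by
  rw [← RCLike.ofReal_inv]; rfl

theorem C0Group.tendsto_vec_smoothing (S : C0Group 𝕜 H) (x : H) :
    Tendsto (fun τ => AdjDomain.vec (S.smoothing τ x)) (𝓝[≠] 0) (𝓝 x) := by
  simp_rw [vec_smoothing]
  exact S.dual.tendsto_average x

/-- Convergence in the graph norm: the second component is the difference quotient `τ⁻¹ (S(τ)* z -
z)`, which tends to `A* z`. -/
theorem C0Group.tendsto_smoothing (S : C0Group 𝕜 H) (Z : S.AdjDomain) :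
    Tendsto (fun τ => S.smoothing τ (AdjDomain.vec Z)) (𝓝[≠] 0) (𝓝 Z) := by
  rw [tendsto_subtype_rng, ← (WithLp.homeomorphProd 2 H H).isInducing.tendsto_nhds_iff.symm.eq]
  refine Tendsto.prodMk_nhds (S.tendsto_vec_smoothing _) ?_
  have h : Tendsto (fun τ => AdjDomain.adj (S.smoothing τ (AdjDomain.vec Z))) (𝓝[≠] 0)
      (𝓝 (AdjDomain.adj Z)) := by
    simp_rw [adj_smoothing]
    exact AdjDomain.hasGenerator_dual Z
  exact h

theorem C0Group.smoothing_comm (S : C0Group 𝕜 H) (τ t : ℝ) (x : H) :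
    S.smoothing τ (S.dual t x) = S.adjMap t (S.smoothing τ x) := by
  refine AdjDomain.ext ?_
  rw [vec_adjMap, vec_smoothing, vec_smoothing, RCLike.real_smul_eq_coe_smul (K := 𝕜),
    RCLike.real_smul_eq_coe_smul (K := 𝕜), ContinuousLinearMap.map_smul,
    ← ContinuousLinearMap.intervalIntegral_comp_comm _
      ((S.dual.continuous_apply x).intervalIntegrable _ _)]
  simp_rw [S.dual.apply_comm t]

end Control

/-! ### Existence of the observation `B* z` of a mild solution. -/

section Control

open C0Group

variable {𝕜 H U : Type*} [RCLike 𝕜] [NormedAddCommGroup H] [InnerProductSpace 𝕜 H]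
  [CompleteSpace H] [NormedAddCommGroup U] [InnerProductSpace 𝕜 U] [CompleteSpace U]
  [NormedSpace ℝ H] [IsScalarTower ℝ 𝕜 H]

/-- An `L²` estimate along mild solutions for an operator that is `L²`-bounded along the orbits. -/
theorem C0Group.integral_norm_sq_mild_le (R : C0Group 𝕜 H) {D : H →L[𝕜] U} {m : H → ℝ}
    (hm : Continuous m) {T : ℝ} (hT : 0 < T)
    (hD : ∀ x, ∫ t in (0 : ℝ)..T, ‖D (R t x)‖ ^ 2 ≤ m x) (a : H) {g : ℝ → H} (hg : Continuous g) :
    ∫ t in (0 : ℝ)..T, ‖D (R.mild a g t)‖ ^ 2 ≤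
      2 * m a + 2 * T * ∫ s in (0 : ℝ)..T, m (R (-s) (g s)) := by
  let _ : NormedSpace ℝ U := NormedSpace.restrictScalars ℝ 𝕜 U
  have : IsScalarTower ℝ 𝕜 U := IsScalarTower.of_algebraMap_smul fun _ _ => rfl
  set q : ℝ → H := fun s => R (-s) (g s) with hq
  have hqc : Continuous q := R.continuous_comp continuous_neg hg
  have hF : Continuous fun p : ℝ × ℝ => ‖D (R p.1 (q p.2))‖ ^ 2 :=
    ((D.continuous.comp (R.continuous_comp continuous_fst (hqc.comp continuous_snd))).norm).pow 2
  have hFs : ∀ t, Continuous fun s => ‖D (R t (q s))‖ := fun t =>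
    (D.continuous.comp ((R t).continuous.comp hqc)).norm
  have hinner : Continuous fun t => ∫ s in (0 : ℝ)..T, ‖D (R t (q s))‖ ^ 2 :=
    intervalIntegral.continuous_parametric_intervalIntegral_of_continuous' hF 0 T
  have hinner' : Continuous fun s => ∫ t in (0 : ℝ)..T, ‖D (R t (q s))‖ ^ 2 :=
    intervalIntegral.continuous_parametric_intervalIntegral_of_continuous'
      (f := fun s t => ‖D (R t (q s))‖ ^ 2) (hF.comp continuous_swap) 0 T
  -- Write the Duhamel term as `∫₀ᵗ R(t) q(s) ds`. For a group `R(t) q(s)` makes sense for all `s`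
  -- and is the orbit of `q(s)` at time `t`, so the integral of norms may be enlarged to `[0, T]`
  -- before applying Cauchy–Schwarz; exchanging the integrals then lets `hD` act on each orbit.
  have h1 : ∀ t ∈ Icc 0 T, ‖D (R.mild a g t)‖ ^ 2 ≤
      2 * ‖D (R t a)‖ ^ 2 + 2 * T * ∫ s in (0 : ℝ)..T, ‖D (R t (q s))‖ ^ 2 := by
    intro t ht
    have e1 : D (R.mild a g t) = D (R t a) + ∫ s in (0 : ℝ)..t, D (R t (q s)) := by
      have := (D.comp (R t)).intervalIntegral_comp_comm (hqc.intervalIntegrable (μ := volume) 0 t)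
      simp only [ContinuousLinearMap.comp_apply] at this
      rw [this, mild, _root_.map_add, _root_.map_add]
    have e2 : ‖∫ s in (0 : ℝ)..t, D (R t (q s))‖ ≤ ∫ s in (0 : ℝ)..T, ‖D (R t (q s))‖ := by
      refine (intervalIntegral.norm_integral_le_integral_norm ht.1).trans ?_
      refine intervalIntegral.integral_mono_interval le_rfl ht.1 ht.2
        (Eventually.of_forall fun s => norm_nonneg _) ((hFs t).intervalIntegrable _ _)
    have e3 := sq_intervalIntegral_le hT (hFs t)
    have e4 : ‖D (R.mild a g t)‖ ≤ ‖D (R t a)‖ + ∫ s in (0 : ℝ)..T, ‖D (R t (q s))‖ := by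
      rw [e1]
      exact (norm_add_le _ _).trans (by gcongr)
    have e5 : ‖D (R.mild a g t)‖ ^ 2 ≤
        (‖D (R t a)‖ + ∫ s in (0 : ℝ)..T, ‖D (R t (q s))‖) ^ 2 :=
      pow_le_pow_left₀ (norm_nonneg _) e4 2
    nlinarith [sq_nonneg (‖D (R t a)‖ - ∫ s in (0 : ℝ)..T, ‖D (R t (q s))‖)]
  have hca : Continuous fun t => ‖D (R t a)‖ ^ 2 :=
    ((D.continuous.comp (R.continuous_apply a)).norm).pow 2
  have hcm : Continuous fun t => ‖D (R.mild a g t)‖ ^ 2 :=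
    ((D.continuous.comp (R.continuous_mild hg a)).norm).pow 2
  have hi1 : IntervalIntegrable (fun t => 2 * ‖D (R t a)‖ ^ 2) volume 0 T :=
    (continuous_const.mul hca).intervalIntegrable _ _
  have hi2 : IntervalIntegrable (fun t => 2 * T * ∫ s in (0 : ℝ)..T, ‖D (R t (q s))‖ ^ 2)
      volume 0 T := (continuous_const.mul hinner).intervalIntegrable _ _
  have h2 := intervalIntegral.integral_mono_on hT.le (hcm.intervalIntegrable _ _) (hi1.add hi2) h1
  refine h2.trans ?_
  rw [intervalIntegral.integral_add hi1 hi2, intervalIntegral.integral_const_mul,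
    intervalIntegral.integral_const_mul]
  have hswap : ∫ t in (0 : ℝ)..T, ∫ s in (0 : ℝ)..T, ‖D (R t (q s))‖ ^ 2 =
      ∫ s in (0 : ℝ)..T, ∫ t in (0 : ℝ)..T, ‖D (R t (q s))‖ ^ 2 := by
    refine intervalIntegral_intervalIntegral_swap (F := fun t s => ‖D (R t (q s))‖ ^ 2) ?_
    rw [uIoc_of_le hT.le]
    exact (hF.continuousOn.integrableOn_compact
      (isCompact_Icc.prod isCompact_Icc)).mono_set (prod_mono Ioc_subset_Icc_self Ioc_subset_Icc_self)
  rw [hswap]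
  have h3 : ∫ s in (0 : ℝ)..T, ∫ t in (0 : ℝ)..T, ‖D (R t (q s))‖ ^ 2 ≤
      ∫ s in (0 : ℝ)..T, m (q s) :=
    intervalIntegral.integral_mono_on hT.le (hinner'.intervalIntegrable _ _)
      ((hm.comp hqc).intervalIntegrable _ _) fun s _ => hD (q s)
  have h4 := hD a
  gcongr

theorem C0Group.exists_norm_vec_smoothing_le (S : C0Group 𝕜 H) :
    ∃ M : ℝ, 0 < M ∧ ∀ τ : ℝ, |τ| ≤ 1 → ∀ x, ‖AdjDomain.vec (S.smoothing τ x)‖ ≤ M * ‖x‖ := by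
  obtain ⟨M, hM, hS⟩ := S.dual.exists_norm_le 1
  refine ⟨M, hM, fun τ hτ x => ?_⟩
  rw [vec_smoothing, norm_smul, norm_inv, Real.norm_eq_abs]
  rcases eq_or_ne τ 0 with rfl | h0
  · simp; positivity
  · rw [inv_mul_le_iff₀ (abs_pos.2 h0)]
    exact (S.dual.norm_integral_le hS hτ x).trans (le_of_eq (by ring))

theorem C0Group.continuous_vec {S : C0Group 𝕜 H} :
    Continuous fun Z : S.AdjDomain => AdjDomain.vec Z :=
  (continuous_adjDomain_iff.1 continuous_id).1

theorem C0Group.vec_sub {S : C0Group 𝕜 H} (Z Z' : S.AdjDomain) :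
    AdjDomain.vec (Z - Z') = AdjDomain.vec Z - AdjDomain.vec Z' := rfl

/-- The smoothed observations of a mild solution of `z' = - A* z + g` form a Cauchy sequence. -/
theorem IsAdmissible.exists_cauchy_bound {S : C0Group 𝕜 H} {B : U →L[𝕜] S.AdjDual}
    (hB : IsAdmissible B) {T : ℝ} (hT : 0 < T) (a : H) {g : ℝ → H} (hg : Continuous g)
    {τ : ℕ → ℝ} (hτ1 : ∀ n, |τ n| ≤ 1) (hτ : Tendsto τ atTop (𝓝[≠] 0)) :
    ∃ β : ℕ → ℝ, Tendsto β atTop (𝓝 0) ∧ ∀ n k,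
      ∫ t in (0 : ℝ)..T, ‖controlAdjoint B (S.smoothing (τ n) (S.dual.rev.mild a g t))
        - controlAdjoint B (S.smoothing (τ k) (S.dual.rev.mild a g t))‖ ^ 2 ≤ β n + β k := by
  obtain ⟨C, hC, hbound⟩ := hB.exists_bound hT
  obtain ⟨M, hM, hJ⟩ := S.exists_norm_vec_smoothing_le
  let A : ℕ → H → H := fun n x => AdjDomain.vec (S.smoothing (τ n) x)
  have hAc : ∀ n, Continuous (A n) := fun n => continuous_vec.comp (S.smoothing (τ n)).continuous
  have hAt : ∀ x, Tendsto (fun n => ‖A n x - x‖ ^ 2) atTop (𝓝 0) := fun x => by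
    have h1 := ((S.tendsto_vec_smoothing x).comp hτ).sub_const x
    simpa using (h1.norm.pow 2)
  let q : ℝ → H := fun s => S.dual.rev (-s) (g s)
  have hqc : Continuous q := S.dual.rev.continuous_comp continuous_neg hg
  -- This is the admissibility bound for the orbit of `(Jₙ - Jₖ) x`, where `Jₙ` is smoothing with `τ
  -- n`, after the triangle inequality through `x`. It splits into a term in `n` and a term in `k`,
  -- each tending to zero.
  let m : ℕ → ℕ → H → ℝ := fun n k x => 2 * C * ‖A n x - x‖ ^ 2 + 2 * C * ‖A k x - x‖ ^ 2
  have hmc : ∀ n k, Continuous (m n k) := fun n k =>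
    (continuous_const.mul (((hAc n).sub continuous_id).norm.pow 2)).add
      (continuous_const.mul (((hAc k).sub continuous_id).norm.pow 2))
  have hcc : ∀ n, Continuous fun s => ‖A n (q s) - q s‖ ^ 2 := fun n =>
    (((hAc n).comp hqc).sub hqc).norm.pow 2
  have hci : ∀ n, IntervalIntegrable (fun s => ‖A n (q s) - q s‖ ^ 2) volume 0 T := fun n =>
    (hcc n).intervalIntegrable _ _
  refine ⟨fun n => 4 * C * ‖A n a - a‖ ^ 2
    + 4 * T * C * ∫ s in (0 : ℝ)..T, ‖A n (q s) - q s‖ ^ 2, ?_, fun n k => ?_⟩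
  · have h1 : Tendsto (fun n => ∫ s in (0 : ℝ)..T, ‖A n (q s) - q s‖ ^ 2) atTop
        (𝓝 (∫ s in (0 : ℝ)..T, (0 : ℝ))) := by
      refine intervalIntegral.tendsto_integral_filter_of_dominated_convergence
        (fun s => ((M + 1) * ‖q s‖) ^ 2) (Eventually.of_forall fun n => (hcc n).aestronglyMeasurable)
        (Eventually.of_forall fun n => Eventually.of_forall fun s _ => ?_)
        (((continuous_const.mul hqc.norm).pow 2).intervalIntegrable _ _)
        (Eventually.of_forall fun s _ => hAt (q s))
      rw [Real.norm_of_nonneg (sq_nonneg _)]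
      refine pow_le_pow_left₀ (norm_nonneg _) ?_ 2
      refine (norm_sub_le _ _).trans ?_
      have := hJ (τ n) (hτ1 n) (q s)
      simp only [A]
      linarith
    simpa using ((hAt a).const_mul (4 * C)).add (h1.const_mul (4 * T * C))
  · have h1 := S.dual.rev.integral_norm_sq_mild_le
      (D := (controlAdjoint B).comp (S.smoothing (τ n) - S.smoothing (τ k))) (hmc n k) hT
      (fun x => by
        have h2 := hbound (S.smoothing (τ n) x - S.smoothing (τ k) x)
        have h3 : ∀ t, ((controlAdjoint B).comp (S.smoothing (τ n) - S.smoothing (τ k)))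
            (S.dual.rev t x) =
              controlAdjoint B (S.adjMap (-t) (S.smoothing (τ n) x - S.smoothing (τ k) x)) := by
          intro t
          rw [ContinuousLinearMap.comp_apply, _root_.sub_apply, rev_apply, smoothing_comm,
            smoothing_comm]
          congr 1
          refine AdjDomain.ext ?_
          rw [vec_sub, vec_adjMap, vec_adjMap, vec_adjMap, vec_sub, _root_.map_sub]
        simp_rw [h3]
        refine h2.trans ?_
        have h4 : ‖AdjDomain.vec (S.smoothing (τ n) x - S.smoothing (τ k) x)‖ ≤
            ‖A n x - x‖ + ‖A k x - x‖ := by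
          rw [vec_sub, ← sub_sub_sub_cancel_right _ _ x]
          exact norm_sub_le _ _
        have h5 := pow_le_pow_left₀ (norm_nonneg _) h4 2
        have h6 : (‖A n x - x‖ + ‖A k x - x‖) ^ 2 ≤ 2 * ‖A n x - x‖ ^ 2 + 2 * ‖A k x - x‖ ^ 2 := by
          nlinarith [sq_nonneg (‖A n x - x‖ - ‖A k x - x‖)]
        calc _ ≤ C * (2 * ‖A n x - x‖ ^ 2 + 2 * ‖A k x - x‖ ^ 2) := by
              gcongr; exact h5.trans h6
          _ = m n k x := by simp only [m]; ring) a hg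
    have h7 : ∫ s in (0 : ℝ)..T, m n k (q s) =
        2 * C * (∫ s in (0 : ℝ)..T, ‖A n (q s) - q s‖ ^ 2)
          + 2 * C * ∫ s in (0 : ℝ)..T, ‖A k (q s) - q s‖ ^ 2 := by
      rw [← intervalIntegral.integral_const_mul, ← intervalIntegral.integral_const_mul,
        ← intervalIntegral.integral_add ((hci n).const_mul _) ((hci k).const_mul _)]
    simp only [ContinuousLinearMap.comp_apply, _root_.sub_apply, _root_.map_sub] at h1
    refine h1.trans (le_of_eq ?_)
    change 2 * m n k a + 2 * T * ∫ s in (0 : ℝ)..T, m n k (q s) = _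
    rw [h7]
    simp only [m]
    ring

/-- The primitive of a mild solution of `z' = - A* z + g` takes its values in `D(A*)`. -/
theorem C0Group.exists_vec_eq_integral_mild (S : C0Group 𝕜 H) (a : H) {g : ℝ → H}
    (hg : Continuous g) (t : ℝ) : ∃ Z : S.AdjDomain,
      AdjDomain.vec Z = ∫ s in (0 : ℝ)..t, S.dual.rev.mild a g s := by
  have hc := S.dual.rev.continuous_mild hg a
  -- The value proposed for `A* ∫₀ᵗ z` comes from integrating `z' = -A* z + g`.
  obtain ⟨Z, hZ, -⟩ := AdjDomain.exists_of_inner (S := S)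
    (x := ∫ s in (0 : ℝ)..t, S.dual.rev.mild a g s)
    (z := a + (∫ s in (0 : ℝ)..t, g s) - S.dual.rev.mild a g t) fun w => by
      have h1 := inner_mild_eq S.isDual_dual.symm.rev hg a (S.hasGenerator_generator w).rev t
      have hi1 : IntervalIntegrable (fun s => ⟪S.generator w, S.dual.rev.mild a g s⟫_𝕜) volume 0 t :=
        (continuous_const.inner hc).intervalIntegrable _ _
      have hi3 : IntervalIntegrable (fun s => -⟪S.generator w, S.dual.rev.mild a g s⟫_𝕜) volume 0 t :=
        hi1.neg
      have hi2 : IntervalIntegrable (fun s => ⟪(w : H), g s⟫_𝕜) volume 0 t :=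
        (continuous_const.inner hg).intervalIntegrable _ _
      simp only [inner_neg_left] at h1
      rw [intervalIntegral.integral_add hi3 hi2, intervalIntegral.integral_neg,
        ← inner_intervalIntegral_right (hc.intervalIntegrable _ _),
        ← inner_intervalIntegral_right (hg.intervalIntegrable _ _)] at h1
      rw [← inner_conj_symm, ← inner_conj_symm (∫ s in (0 : ℝ)..t, _)]
      congr 1
      rw [inner_sub_right, inner_add_right, h1]
      ring
  exact ⟨Z, hZ⟩

/-- The observation is the `L²` limit of `vₙ = B* Jₙ z`, with `Jₙ` the smoothing operators. Each
satisfies `∫₀ᵗ vₙ = B* Jₙ Z` with `Z = ∫₀ᵗ z` in `D(A*)`, and `Jₙ Z → Z` in `D(A*)`, where `B*` is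
continuous. -/
theorem IsAdmissible.exists_isObservation {S : C0Group 𝕜 H} {B : U →L[𝕜] S.AdjDual}
    (hB : IsAdmissible B) {T : ℝ} (hT : 0 < T) (a : H) {g : ℝ → H} (hg : Continuous g) :
    ∃ v : ℝ → U, IsObservation B T (S.dual.rev.mild a g) v := by
  let _ : NormedSpace ℝ U := NormedSpace.restrictScalars ℝ 𝕜 U
  have : IsScalarTower ℝ 𝕜 U := IsScalarTower.of_algebraMap_smul fun _ _ => rfl
  set z := S.dual.rev.mild a g with hz
  have hzc : Continuous z := S.dual.rev.continuous_mild hg a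
  let τ : ℕ → ℝ := fun n => 1 / ((n : ℝ) + 1)
  have hτ1 : ∀ n, |τ n| ≤ 1 := fun n => by
    have : (0 : ℝ) < n + 1 := by positivity
    rw [abs_of_pos (by positivity), div_le_one this]
    linarith [Nat.cast_nonneg (α := ℝ) n]
  have hτ : Tendsto τ atTop (𝓝[≠] 0) :=
    tendsto_nhdsWithin_iff.2 ⟨tendsto_one_div_add_atTop_nhds_zero_nat,
      Eventually.of_forall fun n => by
        have : (0 : ℝ) < n + 1 := by positivity
        exact (one_div_pos.2 this).ne'⟩
  obtain ⟨β, hβ, hbound⟩ := hB.exists_cauchy_bound hT a hg hτ1 hτ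
  let v : ℕ → ℝ → U := fun n t => controlAdjoint B (S.smoothing (τ n) (z t))
  have hvc : ∀ n, Continuous (v n) := fun n =>
    (controlAdjoint B).continuous.comp ((S.smoothing (τ n)).continuous.comp hzc)
  have hvL : ∀ n, MemLp (v n) 2 (volume.restrict (Ioo 0 T)) := fun n => (hvc n).memLp_Ioo T
  let V : ℕ → Lp U 2 (volume.restrict (Ioo 0 T)) := fun n => (hvL n).toLp (v n)
  have hV : ∀ n k, ‖V n - V k‖ ^ 2 ≤ β n + β k := fun n k => by
    have h1 : V n - V k = ((hvL n).sub (hvL k)).toLp (v n - v k) := (MemLp.toLp_sub _ _).symm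
    rw [h1, norm_toLp_sq_eq hT]
    exact hbound n k
  have hcauchy : CauchySeq V := by
    rw [Metric.cauchySeq_iff]
    intro ε hε
    have h1 : ∀ᶠ n in atTop, β n < ε ^ 2 / 2 := hβ.eventually (gt_mem_nhds (by positivity))
    obtain ⟨N, hN⟩ := eventually_atTop.1 h1
    refine ⟨N, fun n hn k hk => ?_⟩
    rw [dist_eq_norm]
    refine lt_of_pow_lt_pow_left₀ 2 hε.le ((hV n k).trans_lt ?_)
    linarith [hN n hn, hN k hk]
  obtain ⟨W, hW⟩ := cauchySeq_tendsto_of_complete hcauchy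
  refine ⟨W, Lp.memLp W, fun t ht => ?_⟩
  obtain ⟨Z, hZ⟩ := S.exists_vec_eq_integral_mild a hg t
  refine ⟨Z, fun h => ?_, fun w => ?_⟩
  · rw [hZ, inner_intervalIntegral_right (hzc.intervalIntegrable _ _)]
  · have hcoe : ∀ f : Lp U 2 (volume.restrict (Ioo 0 T)),
        ⟪indicatorConstLp 2 (μ := volume.restrict (Ioo 0 T)) measurableSet_Ioo
          (measure_ne_top _ (Ioo 0 t)) w, f⟫_𝕜 = ∫ s in (0 : ℝ)..t, ⟪w, f s⟫_𝕜 := fun f => by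
      rw [L2.inner_indicatorConstLp_eq_setIntegral_inner, Measure.restrict_restrict measurableSet_Ioo,
        inter_eq_self_of_subset_left (Ioo_subset_Ioo_right ht.2),
        intervalIntegral.integral_of_le ht.1, integral_Ioc_eq_integral_Ioo]
    have h1 : Tendsto (fun n => ∫ s in (0 : ℝ)..t, ⟪w, V n s⟫_𝕜) atTop
        (𝓝 (∫ s in (0 : ℝ)..t, ⟪w, W s⟫_𝕜)) := by
      simp_rw [← hcoe]
      exact Tendsto.inner tendsto_const_nhds hW
    have h2 : ∀ n, ∫ s in (0 : ℝ)..t, ⟪w, V n s⟫_𝕜 =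
        ⟪w, controlAdjoint B (S.smoothing (τ n) (AdjDomain.vec Z))⟫_𝕜 := by
      intro n
      have h3 : ∫ s in (0 : ℝ)..t, v n s =
          ((controlAdjoint B).comp (S.smoothing (τ n))) (∫ s in (0 : ℝ)..t, z s) :=
        ((controlAdjoint B).comp (S.smoothing (τ n))).intervalIntegral_comp_comm
        (hzc.intervalIntegrable (μ := volume) 0 t)
      rw [ContinuousLinearMap.comp_apply, ← hZ] at h3
      rw [← h3, inner_intervalIntegral_right ((hvc n).intervalIntegrable _ _),
        intervalIntegral.integral_of_le ht.1, intervalIntegral.integral_of_le ht.1,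
        integral_Ioc_eq_integral_Ioo, integral_Ioc_eq_integral_Ioo]
      refine integral_congr_ae ?_
      have h4 : ∀ᵐ s ∂(volume.restrict (Ioo 0 t)), V n s = v n s :=
        ae_restrict_of_ae_restrict_of_subset (Ioo_subset_Ioo_right ht.2) (hvL n).coeFn_toLp
      filter_upwards [h4] with s hs
      rw [hs]
    simp_rw [h2] at h1
    refine tendsto_nhds_unique (Tendsto.inner tendsto_const_nhds ?_) h1
    exact ((controlAdjoint B).continuous.tendsto Z).comp ((S.tendsto_smoothing Z).comp hτ)

end Control

/-! ### Radial truncation. -/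

section Radial

variable {E : Type*} [NormedAddCommGroup E] [NormedSpace ℝ E]

/-- The radial retraction onto the closed ball of radius `ρ`. -/
def radialProj (ρ : ℝ) (x : E) : E := (max 1 (‖x‖ / ρ))⁻¹ • x

theorem radialProj_of_norm_le {ρ : ℝ} (hρ : 0 < ρ) {x : E} (hx : ‖x‖ ≤ ρ) :
    radialProj ρ x = x := by
  rw [radialProj, max_eq_left ((div_le_one hρ).2 hx), inv_one, one_smul]

theorem radialProj_coeff_mem (ρ : ℝ) (x : E) :
    0 < (max 1 (‖x‖ / ρ))⁻¹ ∧ (max 1 (‖x‖ / ρ))⁻¹ ≤ 1 :=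
  ⟨inv_pos.2 (one_pos.trans_le (le_max_left _ _)), inv_le_one_of_one_le₀ (le_max_left _ _)⟩

theorem norm_radialProj_le {ρ : ℝ} (hρ : 0 < ρ) (x : E) : ‖radialProj ρ x‖ ≤ ρ := by
  have h := radialProj_coeff_mem ρ x
  rw [radialProj, norm_smul, Real.norm_of_nonneg h.1.le, inv_mul_le_iff₀ (inv_pos.1 h.1)]
  exact (div_le_iff₀ hρ).1 (le_max_right _ _)

theorem norm_radialProj_le_norm (ρ : ℝ) (x : E) : ‖radialProj ρ x‖ ≤ ‖x‖ := by
  have h := radialProj_coeff_mem ρ x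
  rw [radialProj, norm_smul, Real.norm_of_nonneg h.1.le]
  exact mul_le_of_le_one_left (norm_nonneg _) h.2

/-- The retraction will be used on `H × H` with the sup norm, where it need not be nonexpansive;
hence the constant 2. With `m = max 1 (‖·‖ / ρ)`, one contribution comes from `x - y` and one from
`m y - m x`, and `m` is `ρ⁻¹`-Lipschitz. -/
theorem norm_radialProj_sub_le {ρ : ℝ} (hρ : 0 < ρ) (x y : E) :
    ‖radialProj ρ x - radialProj ρ y‖ ≤ 2 * ‖x - y‖ := by
  set m : E → ℝ := fun z => max 1 (‖z‖ / ρ) with hm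
  have hmpos : ∀ z, 0 < m z := fun z => one_pos.trans_le (le_max_left _ _)
  have hx := radialProj_coeff_mem ρ x
  have h1 : radialProj ρ x - radialProj ρ y = (m x)⁻¹ • (x - y) + ((m x)⁻¹ * (m y - m x)) •
      radialProj ρ y := by
    have h2 : radialProj ρ y = (m y)⁻¹ • y := rfl
    have h3 : radialProj ρ x = (m x)⁻¹ • x := rfl
    have h4 : (m x)⁻¹ * (m y - m x) * (m y)⁻¹ = (m x)⁻¹ - (m y)⁻¹ := by
      have := (hmpos x).ne'
      have := (hmpos y).ne'
      field_simp
    rw [h2, h3, smul_smul, h4, smul_sub, sub_smul]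
    abel
  have h5 : |m y - m x| ≤ ‖x - y‖ / ρ := by
    have h6 := abs_max_sub_max_le_abs (‖y‖ / ρ) (‖x‖ / ρ) 1
    rw [max_comm _ (1 : ℝ), max_comm _ (1 : ℝ)] at h6
    refine h6.trans ?_
    rw [← sub_div, abs_div, abs_of_pos hρ, norm_sub_rev]
    gcongr
    exact abs_norm_sub_norm_le y x
  rw [h1, two_mul]
  refine (norm_add_le _ _).trans (add_le_add ?_ ?_)
  · rw [norm_smul, Real.norm_of_nonneg hx.1.le]
    exact mul_le_of_le_one_left (norm_nonneg _) hx.2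
  · rw [norm_smul, norm_mul, Real.norm_of_nonneg hx.1.le, Real.norm_eq_abs]
    calc (m x)⁻¹ * |m y - m x| * ‖radialProj ρ y‖ ≤ 1 * (‖x - y‖ / ρ) * ρ := by
          gcongr
          · exact hx.2
          · exact norm_radialProj_le hρ y
      _ = ‖x - y‖ := by field_simp

end Radial

/-! ### Global solutions of Lipschitz equations, and the scalar decay estimate. -/

section ODE

variable {X : Type*} [NormedAddCommGroup X] [NormedSpace ℝ X] [CompleteSpace X]

/-- Global solutions of `α' = F(t, α)` for a bounded and Lipschitz vector field. -/
theorem exists_hasDerivWithinAt_Ici {F : ℝ → X → X} (hc : ∀ x, Continuous fun t => F t x)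
    (hF : ∀ T : ℝ, 0 < T → ∃ K M : ℝ≥0, ∀ t ∈ Icc 0 T, LipschitzWith K (F t) ∧ ∀ x, ‖F t x‖ ≤ M)
    (x₀ : X) :
    ∃ α : ℝ → X, α 0 = x₀ ∧ ∀ t, 0 ≤ t → HasDerivWithinAt α (F t (α t)) (Ici 0) t := by
  have hloc : ∀ n : ℕ, ∃ α : ℝ → X, α 0 = x₀ ∧ ∀ t ∈ Icc (0 : ℝ) (n + 1),
      HasDerivWithinAt α (F t (α t)) (Icc 0 (n + 1)) t := by
    intro n
    have hn : (0 : ℝ) < n + 1 := by positivity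
    obtain ⟨K, M, h⟩ := hF (n + 1) hn
    -- The field is bounded by `M`, so on a ball of radius `M (n + 1)` the Picard–Lindelöf theorem
    -- covers the whole interval. The length `n + 1` keeps the interval nondegenerate for `n = 0`.
    have hPL : IsPicardLindelof F (⟨0, le_rfl, hn.le⟩ : Icc (0 : ℝ) (n + 1)) x₀
        (M * ⟨n + 1, hn.le⟩) 0 M K :=
      { lipschitzOnWith := fun t ht => (h t ht).1.lipschitzOnWith
        continuousOn := fun x _ => (hc x).continuousOn
        norm_le := fun t ht x _ => (h t ht).2 x
        mul_max_le := by simp [hn.le]; exact le_rfl }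
    exact hPL.exists_eq_forall_mem_Icc_hasDerivWithinAt₀
  choose α hα0 hα using hloc
  have hcont : ∀ n : ℕ, ContinuousOn (α n) (Icc 0 (n + 1)) := fun n t ht => (hα n t ht).continuousWithinAt
  have hright : ∀ n : ℕ, ∀ t ∈ Ico (0 : ℝ) (n + 1), HasDerivWithinAt (α n) (F t (α n t)) (Ici t) t :=
    fun n t ht => ((hα n t (Ico_subset_Icc_self ht)).mono (Icc_subset_Icc_left ht.1)).mono_of_mem_nhdsWithin
      (Icc_mem_nhdsGE ht.2)
  have hagree : ∀ n m : ℕ, n ≤ m → EqOn (α n) (α m) (Icc 0 (n + 1)) := by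
    intro n m hnm
    have hn : (0 : ℝ) < n + 1 := by positivity
    have hle : (n : ℝ) + 1 ≤ m + 1 := by gcongr
    obtain ⟨K, M, h⟩ := hF (n + 1) hn
    exact ODE_solution_unique_of_mem_Icc_right (v := F) (s := fun _ => univ) (K := K)
      (fun t ht => (h t (Ico_subset_Icc_self ht)).1.lipschitzOnWith) (hcont n) (hright n)
      (fun _ _ => mem_univ _) ((hcont m).mono (Icc_subset_Icc_right hle))
      (fun t ht => hright m t ⟨ht.1, ht.2.trans_le hle⟩) (fun _ _ => mem_univ _)
      ((hα0 n).trans (hα0 m).symm)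
  let β : ℝ → X := fun t => α ⌈t⌉₊ t
  have hβ : ∀ n : ℕ, EqOn β (α n) (Icc 0 n) := by
    intro n t ht
    refine hagree _ n (Nat.ceil_le.2 ht.2) ⟨ht.1, (Nat.le_ceil t).trans (by simp)⟩
  refine ⟨β, ?_, fun t ht => ?_⟩
  · simp [β, hα0]
  · obtain ⟨n, hn⟩ := exists_nat_gt t
    have h1 : HasDerivWithinAt (α n) (F t (α n t)) (Icc 0 (n : ℝ)) t :=
      (hα n t ⟨ht, hn.le.trans (by simp)⟩).mono (Icc_subset_Icc_right (by simp))
    have h2 := h1.congr (fun s hs => hβ n hs) (hβ n ⟨ht, hn.le⟩)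
    rw [← hβ n ⟨ht, hn.le⟩] at h2
    refine h2.mono_of_mem_nhdsWithin ?_
    rw [← Ici_inter_Iic]
    exact inter_mem self_mem_nhdsWithin (mem_nhdsWithin_of_mem_nhds (Iic_mem_nhds hn))

end ODE

/-- Exponential decay for a triangular pair of integral inequalities with a small perturbation. -/
theorem add_le_exp_of_triangular {β α μ c k η ε A₁ A₂ : ℝ} (hc : 0 < c) (hk : 0 ≤ k)
    (hη : 0 < η) (hη1 : η ≤ 1) (hηk : η * (c * k) ≤ β - α) (hε : 2 * c * ε ≤ η * (α - μ))
    (hε0 : 0 ≤ ε) (hαμ : μ ≤ α) (hA₂ : 0 ≤ A₂) {e y n₁ n₂ : ℝ → ℝ}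
    (hn₁ : Continuous n₁) (hn₂ : Continuous n₂)
    (he : ∀ t, 0 ≤ t → 0 ≤ e t ∧
      e t ≤ Real.exp (-β * t) * (c * A₁ + c * ∫ s in (0 : ℝ)..t, Real.exp (β * s) * n₁ s))
    (hy : ∀ t, 0 ≤ t → 0 ≤ y t ∧
      y t ≤ Real.exp (-α * t) * (c * A₂ + c * ∫ s in (0 : ℝ)..t, Real.exp (α * s) * n₂ s))
    (h₁ : ∀ t, 0 ≤ t → n₁ t ≤ ε * (e t + y t))
    (h₂ : ∀ t, 0 ≤ t → n₂ t ≤ k * e t + ε * (e t + y t)) :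
    ∀ t, 0 ≤ t → e t + y t ≤ c / η * Real.exp (-μ * t) * (A₁ + A₂) := by
  have hderiv : ∀ (b A : ℝ) (n : ℝ → ℝ), Continuous n → ∀ t, HasDerivAt
      (fun t => Real.exp (-b * t) * (c * A + c * ∫ s in (0 : ℝ)..t, Real.exp (b * s) * n s))
      (-b * (Real.exp (-b * t) * (c * A + c * ∫ s in (0 : ℝ)..t, Real.exp (b * s) * n s)) + c * n t)
      t := by
    intro b A n hn t
    have hcn : Continuous fun s => Real.exp (b * s) * n s := by fun_prop
    have d1 : HasDerivAt (fun t => ∫ s in (0 : ℝ)..t, Real.exp (b * s) * n s)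
        (Real.exp (b * t) * n t) t :=
      intervalIntegral.integral_hasDerivAt_right (hcn.intervalIntegrable _ _)
        hcn.aestronglyMeasurable.stronglyMeasurableAtFilter hcn.continuousAt
    have d2 : HasDerivAt (fun t => Real.exp (-b * t)) (Real.exp (-b * t) * (-b)) t := by
      simpa using ((hasDerivAt_id t).const_mul (-b)).exp
    have d3 := d2.mul ((d1.const_mul c).const_add (c * A))
    refine d3.congr_deriv ?_
    have h : Real.exp (-b * t) * Real.exp (b * t) = 1 := by
      rw [← Real.exp_add]; simp
    linear_combination (c * n t) * h
  set E : ℝ → ℝ := fun t =>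
    Real.exp (-β * t) * (c * A₁ + c * ∫ s in (0 : ℝ)..t, Real.exp (β * s) * n₁ s) with hE
  set Y : ℝ → ℝ := fun t =>
    Real.exp (-α * t) * (c * A₂ + c * ∫ s in (0 : ℝ)..t, Real.exp (α * s) * n₂ s) with hY
  have dE : ∀ t, HasDerivAt E (-β * E t + c * n₁ t) t := hderiv β A₁ n₁ hn₁
  have dY : ∀ t, HasDerivAt Y (-α * Y t + c * n₂ t) t := hderiv α A₂ n₂ hn₂
  -- The majorants solve `E' = -β E + c n₁` and `Y' = -α Y + c n₂`. The weight `η` is small so that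
  -- the coupling `k E` inside `Y'` is dominated by the faster decay of `E`.
  have dW : ∀ t, HasDerivAt (fun t => Real.exp (μ * t) * (E t + η * Y t))
      (Real.exp (μ * t) * (μ * (E t + η * Y t) + (-β * E t + c * n₁ t
        + η * (-α * Y t + c * n₂ t)))) t := by
    intro t
    have d2 : HasDerivAt (fun t => Real.exp (μ * t)) (Real.exp (μ * t) * μ) t := by
      simpa using ((hasDerivAt_id t).const_mul μ).exp
    refine (d2.mul ((dE t).add ((dY t).const_mul η))).congr_deriv ?_
    simp only [Pi.add_apply]
    ring
  have hanti : AntitoneOn (fun t => Real.exp (μ * t) * (E t + η * Y t)) (Ici 0) := by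
    refine antitoneOn_of_deriv_nonpos (convex_Ici 0)
      (fun t _ => (dW t).continuousAt.continuousWithinAt)
      (fun t _ => (dW t).differentiableAt.differentiableWithinAt) fun t ht => ?_
    rw [interior_Ici] at ht
    have ht0 : 0 ≤ t := ht.le
    rw [(dW t).deriv]
    refine mul_nonpos_of_nonneg_of_nonpos (Real.exp_pos _).le ?_
    obtain ⟨e0, e1⟩ := he t ht0
    obtain ⟨y0, y1⟩ := hy t ht0
    change e t ≤ E t at e1
    change y t ≤ Y t at y1
    have hE0 : 0 ≤ E t := e0.trans e1
    have hY0 : 0 ≤ Y t := y0.trans y1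
    have b1 : n₁ t ≤ ε * (E t + Y t) := (h₁ t ht0).trans (by gcongr)
    have b2 : n₂ t ≤ k * E t + ε * (E t + Y t) := (h₂ t ht0).trans (by gcongr)
    have b3 : c * n₁ t ≤ c * (ε * (E t + Y t)) := by gcongr
    have b4 : η * (c * n₂ t) ≤ η * (c * (k * E t + ε * (E t + Y t))) := by gcongr
    -- The coupling is absorbed by `η c k ≤ β - α`, and all terms in `ε` together by `2 c ε ≤ η (α -
    -- μ)`. What remains is at most `-(α - μ)(1 - η) E ≤ 0`.
    have b5 : η * (c * k) * E t ≤ (β - α) * E t := by gcongr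
    have b6 : η * (c * (ε * (E t + Y t))) ≤ 1 * (c * (ε * (E t + Y t))) := by gcongr
    have b7 : 2 * c * ε * (E t + Y t) ≤ η * (α - μ) * (E t + Y t) := by gcongr
    have b8 : η * ((α - μ) * E t) ≤ 1 * ((α - μ) * E t) := by
      have : 0 ≤ α - μ := by linarith
      gcongr
    linarith
  intro t ht
  have h3 := hanti (mem_Ici.2 le_rfl) (mem_Ici.2 ht) ht
  have hE0 : E 0 = c * A₁ := by simp [hE]
  have hY0 : Y 0 = c * A₂ := by simp [hY]
  simp only [mul_zero, Real.exp_zero, one_mul, hE0, hY0] at h3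
  obtain ⟨e0, e1⟩ := he t ht
  obtain ⟨y0, y1⟩ := hy t ht
  change e t ≤ E t at e1
  change y t ≤ Y t at y1
  have h4 : η * (e t + y t) ≤ E t + η * Y t := by nlinarith
  have h5 : E t + η * Y t ≤ Real.exp (-μ * t) * (c * (A₁ + A₂)) := by
    have h6 : Real.exp (-μ * t) * Real.exp (μ * t) = 1 := by rw [← Real.exp_add]; simp
    calc E t + η * Y t = Real.exp (-μ * t) * (Real.exp (μ * t) * (E t + η * Y t)) := by
          linear_combination -(E t + η * Y t) * h6
      _ ≤ Real.exp (-μ * t) * (c * A₁ + η * (c * A₂)) := by gcongr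
      _ ≤ Real.exp (-μ * t) * (c * (A₁ + A₂)) := by
          have : η * (c * A₂) ≤ 1 * (c * A₂) := by gcongr
          gcongr
          linarith
  have h7 : c / η * Real.exp (-μ * t) * (A₁ + A₂) = (Real.exp (-μ * t) * (c * (A₁ + A₂))) / η := by
    ring
  rw [h7, le_div_iff₀ hη]
  linarith

/-! ### Semilinear pairs of mild equations: existence, uniqueness, stability. -/

namespace C0Group

variable {𝕜 H : Type*} [RCLike 𝕜] [NormedAddCommGroup H] [InnerProductSpace 𝕜 H] [CompleteSpace H]
  [NormedSpace ℝ H] [IsScalarTower ℝ 𝕜 H]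

/-- Since `S(t) S(-s) = S(t - s)`, only forward times enter. The bound has the form of the solution
of a scalar linear equation, as `add_le_exp_of_triangular` expects. -/
theorem norm_mild_le (S : C0Group 𝕜 H) {c β : ℝ}
    (hS : ∀ t, 0 ≤ t → ‖S t‖ ≤ c * Real.exp (-β * t)) (a : H) {h : ℝ → H} (hh : Continuous h)
    {t : ℝ} (ht : 0 ≤ t) :
    ‖S.mild a h t‖ ≤
      Real.exp (-β * t) * (c * ‖a‖ + c * ∫ s in (0 : ℝ)..t, Real.exp (β * s) * ‖h s‖) := by
  have hc : Continuous fun s => S (-s) (h s) := S.continuous_comp continuous_neg hh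
  have hc2 : Continuous fun s => c * Real.exp (-β * t) * (Real.exp (β * s) * ‖h s‖) := by fun_prop
  rw [mild, _root_.map_add, ← ContinuousLinearMap.intervalIntegral_comp_comm _
    (hc.intervalIntegrable _ _), mul_add]
  refine (norm_add_le _ _).trans (add_le_add ?_ ?_)
  · exact ((S t).le_of_opNorm_le (hS t ht) a).trans (le_of_eq (by ring))
  · have h1 : ∀ s ∈ Ioc 0 t, ‖S t (S (-s) (h s))‖ ≤
        c * Real.exp (-β * t) * (Real.exp (β * s) * ‖h s‖) := by
      intro s hs
      rw [← map_add_apply]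
      refine ((S _).le_of_opNorm_le (hS (t + -s) (by linarith [hs.2])) _).trans (le_of_eq ?_)
      rw [mul_add, Real.exp_add]
      ring_nf
    refine (intervalIntegral.norm_integral_le_of_norm_le ht
      (Eventually.of_forall h1) (hc2.intervalIntegrable _ _)).trans (le_of_eq ?_)
    rw [intervalIntegral.integral_const_mul]
    ring

/-- `(e, y)` is a mild solution on `[0, T]` of a semilinear system driven by two groups. -/
def IsMildPair (T₁ T₂ : C0Group 𝕜 H) (N₁ N₂ : H × H → H) (a₁ a₂ : H) (T : ℝ) (e y : ℝ → H) : Prop :=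
  ∀ t ∈ Icc 0 T, e t = T₁.mild a₁ (fun s => N₁ (e s, y s)) t ∧
    y t = T₂.mild a₂ (fun s => N₂ (e s, y s)) t

/-- The semilinear vector field in the variables `T₁(-t) e` and `T₂(-t) y`. -/
def pairField (T₁ T₂ : C0Group 𝕜 H) (N₁ N₂ : H × H → H) (t : ℝ) (p : H × H) : H × H :=
  (T₁ (-t) (N₁ (T₁ t p.1, T₂ t p.2)), T₂ (-t) (N₂ (T₁ t p.1, T₂ t p.2)))

theorem continuous_pairField (T₁ T₂ : C0Group 𝕜 H) {N₁ N₂ : H × H → H} (h₁ : Continuous N₁)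
    (h₂ : Continuous N₂) (p : H × H) : Continuous fun t => pairField T₁ T₂ N₁ N₂ t p := by
  have h : Continuous fun t : ℝ => (T₁ t p.1, T₂ t p.2) :=
    (T₁.continuous_apply _).prodMk (T₂.continuous_apply _)
  exact (T₁.continuous_comp continuous_neg (h₁.comp h)).prodMk
    (T₂.continuous_comp continuous_neg (h₂.comp h))

/-- Conjugating by the groups costs at most the factor `M` twice, where `M` bounds both groups on
`[-T, T]`. No unbounded operator is left in the field. -/
theorem exists_pairField_lipschitz (T₁ T₂ : C0Group 𝕜 H) {N₁ N₂ : H × H → H} {L D : ℝ} (hL : 0 ≤ L)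
    (hD : 0 ≤ D) (h₁ : ∀ x x', ‖N₁ x - N₁ x'‖ ≤ L * ‖x - x'‖)
    (h₂ : ∀ x x', ‖N₂ x - N₂ x'‖ ≤ L * ‖x - x'‖) (b₁ : ∀ x, ‖N₁ x‖ ≤ D) (b₂ : ∀ x, ‖N₂ x‖ ≤ D)
    (T : ℝ) : ∃ K M : ℝ≥0, ∀ t ∈ Icc 0 T, LipschitzWith K (pairField T₁ T₂ N₁ N₂ t) ∧
      ∀ x, ‖pairField T₁ T₂ N₁ N₂ t x‖ ≤ M := by
  obtain ⟨M₁, hM₁, hT₁⟩ := T₁.exists_norm_le T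
  obtain ⟨M₂, hM₂, hT₂⟩ := T₂.exists_norm_le T
  set M := max M₁ M₂
  have hM : 0 < M := lt_max_of_lt_left hM₁
  have g₁ : ∀ t ∈ Icc (-T) T, ∀ x, ‖T₁ t x‖ ≤ M * ‖x‖ := fun t ht x =>
    (T₁ t).le_of_opNorm_le ((hT₁ t ht).trans (le_max_left _ _)) x
  have g₂ : ∀ t ∈ Icc (-T) T, ∀ x, ‖T₂ t x‖ ≤ M * ‖x‖ := fun t ht x =>
    (T₂ t).le_of_opNorm_le ((hT₂ t ht).trans (le_max_right _ _)) x
  refine ⟨⟨M * (L * M), by positivity⟩, ⟨M * D, by positivity⟩, fun t ht => ⟨?_, fun x => ?_⟩⟩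
  · have ht1 : t ∈ Icc (-T) T := ⟨by linarith [ht.1, ht.2], ht.2⟩
    have ht2 : -t ∈ Icc (-T) T := ⟨by linarith [ht.2], by linarith [ht.1, ht.2]⟩
    refine LipschitzWith.of_dist_le_mul fun p p' => ?_
    have hin : ‖(T₁ t p.1, T₂ t p.2) - (T₁ t p'.1, T₂ t p'.2)‖ ≤ M * ‖p - p'‖ := by
      rw [Prod.mk_sub_mk, ← _root_.map_sub, ← _root_.map_sub]
      refine max_le ?_ ?_
      · exact (g₁ t ht1 _).trans (by gcongr; exact norm_fst_le (p - p'))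
      · exact (g₂ t ht1 _).trans (by gcongr; exact norm_snd_le (p - p'))
    rw [dist_eq_norm, dist_eq_norm, pairField, pairField, Prod.mk_sub_mk, ← _root_.map_sub,
      ← _root_.map_sub]
    change _ ≤ M * (L * M) * _
    refine max_le ?_ ?_
    · refine (g₁ _ ht2 _).trans ?_
      rw [mul_assoc, mul_assoc]
      gcongr
      exact (h₁ _ _).trans (by gcongr)
    · refine (g₂ _ ht2 _).trans ?_
      rw [mul_assoc, mul_assoc]
      gcongr
      exact (h₂ _ _).trans (by gcongr)
  · have ht2 : -t ∈ Icc (-T) T := ⟨by linarith [ht.2], by linarith [ht.1, ht.2]⟩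
    change _ ≤ M * D
    refine max_le ?_ ?_
    · exact (g₁ _ ht2 _).trans (by gcongr; exact b₁ _)
    · exact (g₂ _ ht2 _).trans (by gcongr; exact b₂ _)

/-- Global mild solutions for bounded and Lipschitz nonlinearities. -/
theorem exists_isMildPair (T₁ T₂ : C0Group 𝕜 H) {N₁ N₂ : H × H → H} {L D : ℝ} (hL : 0 ≤ L)
    (hD : 0 ≤ D) (h₁ : ∀ x x', ‖N₁ x - N₁ x'‖ ≤ L * ‖x - x'‖)
    (h₂ : ∀ x x', ‖N₂ x - N₂ x'‖ ≤ L * ‖x - x'‖) (b₁ : ∀ x, ‖N₁ x‖ ≤ D) (b₂ : ∀ x, ‖N₂ x‖ ≤ D)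
    (c₁ : Continuous N₁) (c₂ : Continuous N₂) (a₁ a₂ : H) :
    ∃ e y : ℝ → H, Continuous e ∧ Continuous y ∧ ∀ T, IsMildPair T₁ T₂ N₁ N₂ a₁ a₂ T e y := by
  obtain ⟨p, hp0, hp⟩ := exists_hasDerivWithinAt_Ici (continuous_pairField T₁ T₂ c₁ c₂)
    (fun T _ => exists_pairField_lipschitz T₁ T₂ hL hD h₁ h₂ b₁ b₂ T) (a₁, a₂)
  have hpc : ContinuousOn p (Ici 0) := fun t ht => (hp t ht).continuousWithinAt
  -- Freezing `p` for negative times yields functions continuous on all of `ℝ`, as the lemmas on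
  -- mild solutions require.
  have hq : Continuous fun t => p (max t 0) :=
    hpc.comp_continuous (by fun_prop) fun t => mem_Ici.2 (le_max_right _ _)
  set e : ℝ → H := fun t => T₁ t (p (max t 0)).1 with he_def
  set y : ℝ → H := fun t => T₂ t (p (max t 0)).2 with hy_def
  have he : Continuous e := T₁.continuous_comp continuous_id (continuous_fst.comp hq)
  have hy : Continuous y := T₂.continuous_comp continuous_id (continuous_snd.comp hq)
  have hpt : ∀ t : ℝ, 0 ≤ t → max t 0 = t := fun t ht => max_eq_left ht
  have hint : ∀ (P : H × H →L[ℝ] H) (t : ℝ), 0 ≤ t → P (p t) = P (a₁, a₂) +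
      ∫ s in (0 : ℝ)..t, P (T₁ (-s) (N₁ (e s, y s)), T₂ (-s) (N₂ (e s, y s))) := by
    intro P t ht
    have hcF : Continuous fun s => P (T₁ (-s) (N₁ (e s, y s)), T₂ (-s) (N₂ (e s, y s))) :=
      P.continuous.comp ((T₁.continuous_comp continuous_neg (c₁.comp (he.prodMk hy))).prodMk
        (T₂.continuous_comp continuous_neg (c₂.comp (he.prodMk hy))))
    rw [intervalIntegral.integral_eq_sub_of_hasDeriv_right (f := fun t => P (p t)) ?_ ?_
      (hcF.intervalIntegrable _ _), hp0, add_sub_cancel]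
    · rw [uIcc_of_le ht]
      exact P.continuous.comp_continuousOn (hpc.mono Icc_subset_Ici_self)
    · intro s hs
      rw [min_eq_left ht, max_eq_right ht] at hs
      have h3 := P.hasFDerivAt.comp_hasDerivWithinAt s
        ((hp s hs.1.le).mono (Ioi_subset_Ici hs.1.le))
      simp only [he_def, hy_def, hpt s hs.1.le]
      exact h3
  refine ⟨e, y, he, hy, fun T t ht => ⟨?_, ?_⟩⟩
  · have h3 := hint (ContinuousLinearMap.fst ℝ H H) t ht.1
    simp only [ContinuousLinearMap.coe_fst'] at h3
    simp only [mild, ← h3]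
    simp only [he_def, hpt t ht.1]
  · have h3 := hint (ContinuousLinearMap.snd ℝ H H) t ht.1
    simp only [ContinuousLinearMap.coe_snd'] at h3
    simp only [mild, ← h3]
    simp only [hy_def, hpt t ht.1]

/-- Mild solutions for nonlinearities that agree on a ball with Lipschitz ones coincide with a mild
solution that stays in the interior of the ball. -/
theorem IsMildPair.eqOn {T₁ T₂ : C0Group 𝕜 H} {N₁ N₂ M₁ M₂ : H × H → H} {L D ρ : ℝ} (hL : 0 ≤ L)
    (hD : 0 ≤ D) (h₁ : ∀ x x', ‖M₁ x - M₁ x'‖ ≤ L * ‖x - x'‖)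
    (h₂ : ∀ x x', ‖M₂ x - M₂ x'‖ ≤ L * ‖x - x'‖) (b₁ : ∀ x, ‖M₁ x‖ ≤ D) (b₂ : ∀ x, ‖M₂ x‖ ≤ D)
    (hM₁ : ∀ x, ‖x‖ ≤ ρ → M₁ x = N₁ x) (hM₂ : ∀ x, ‖x‖ ≤ ρ → M₂ x = N₂ x)
    (c₁ : Continuous N₁) (c₂ : Continuous N₂) {a₁ a₂ : H} {T : ℝ} {e y e' y' : ℝ → H}
    (he : Continuous e) (hy : Continuous y) (he' : Continuous e') (hy' : Continuous y')
    (h : IsMildPair T₁ T₂ N₁ N₂ a₁ a₂ T e y) (hρ : ∀ t ∈ Icc 0 T, ‖(e t, y t)‖ < ρ)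
    (h' : IsMildPair T₁ T₂ N₁ N₂ a₁ a₂ T e' y') :
    EqOn e' e (Icc 0 T) ∧ EqOn y' y (Icc 0 T) := by
  let P : (ℝ → H) → (ℝ → H) → ℝ → H × H := fun e y t =>
    (a₁ + ∫ s in (0 : ℝ)..t, T₁ (-s) (N₁ (e s, y s)),
      a₂ + ∫ s in (0 : ℝ)..t, T₂ (-s) (N₂ (e s, y s)))
  have hPd : ∀ {e y : ℝ → H}, Continuous e → Continuous y → ∀ t, HasDerivAt (P e y)
      (T₁ (-t) (N₁ (e t, y t)), T₂ (-t) (N₂ (e t, y t))) t := fun he hy t =>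
    (T₁.hasDerivAt_primitive (c₁.comp (he.prodMk hy)) a₁ t).prodMk
      (T₂.hasDerivAt_primitive (c₂.comp (he.prodMk hy)) a₂ t)
  have hPc : ∀ {e y : ℝ → H}, Continuous e → Continuous y → Continuous (P e y) := fun he hy =>
    continuous_iff_continuousAt.2 fun t => (hPd he hy t).continuousAt
  have hPe : ∀ {e y : ℝ → H}, IsMildPair T₁ T₂ N₁ N₂ a₁ a₂ T e y → ∀ t ∈ Icc 0 T,
      (e t, y t) = (T₁ t (P e y t).1, T₂ t (P e y t).2) := fun h t ht =>
    Prod.ext (h t ht).1 (h t ht).2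
  have hode : ∀ {e y : ℝ → H}, Continuous e → Continuous y →
      IsMildPair T₁ T₂ N₁ N₂ a₁ a₂ T e y → ∀ t ∈ Icc 0 T, ‖(e t, y t)‖ ≤ ρ →
      HasDerivAt (P e y) (pairField T₁ T₂ M₁ M₂ t (P e y t)) t := by
    intro e y he hy h t ht hb
    rw [pairField, ← hPe h t ht, hM₁ _ hb, hM₂ _ hb]
    exact hPd he hy t
  obtain ⟨K, M, hK⟩ := exists_pairField_lipschitz T₁ T₂ hL hD h₁ h₂ b₁ b₂ T
  -- Continuation: the coincidence set is closed. At a point of it the second solution is also in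
  -- the open ball, so for a short time both solve the truncated equation, whose field is Lipschitz.
  -- The competitor is not assumed to be small beforehand.
  have hsub : Icc 0 T ⊆ {t | P e' y' t = P e y t} := by
    refine IsClosed.Icc_subset_of_forall_exists_gt ?_ (by simp [P]) ?_
    · exact (isClosed_eq (hPc he' hy') (hPc he hy)).inter isClosed_Icc
    · rintro x ⟨hx, hx0, hxT⟩ z hz
      have hxe : (e' x, y' x) = (e x, y x) := by
        rw [hPe h' x ⟨hx0, hxT.le⟩, hPe h x ⟨hx0, hxT.le⟩, show P e' y' x = P e y x from hx]
      have hnear : ∀ᶠ t in 𝓝 x, ‖(e' t, y' t)‖ < ρ := by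
        refine (he'.prodMk hy').norm.continuousAt.eventually (gt_mem_nhds ?_)
        change ‖(e' x, y' x)‖ < ρ
        rw [hxe]
        exact hρ x ⟨hx0, hxT.le⟩
      obtain ⟨δ, hδ, hball⟩ := Metric.eventually_nhds_iff.1 hnear
      set w := min z (min T (x + δ / 2)) with hw
      have hxw : x < w := lt_min hz (lt_min hxT (by linarith))
      have hwT : w ≤ T := (min_le_right _ _).trans (min_le_left _ _)
      have hwδ : w ≤ x + δ / 2 := (min_le_right _ _).trans (min_le_right _ _)
      have hIcc : ∀ t ∈ Ico x w, t ∈ Icc 0 T := fun t ht =>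
        ⟨hx0.trans ht.1, ht.2.le.trans hwT⟩
      refine ⟨w, ?_, hxw, min_le_left _ _⟩
      exact ODE_solution_unique_of_mem_Icc_right (v := pairField T₁ T₂ M₁ M₂)
        (s := fun _ => univ) (K := K) (fun t ht => (hK t (hIcc t ht)).1.lipschitzOnWith)
        (hPc he' hy').continuousOn
        (fun t ht => (hode he' hy' h' t (hIcc t ht) (hball (by
          rw [Real.dist_eq, abs_of_nonneg (by linarith [ht.1])]
          linarith [ht.2])).le).hasDerivWithinAt) (fun _ _ => mem_univ _)
        (hPc he hy).continuousOn
        (fun t ht => (hode he hy h t (hIcc t ht) (hρ t (hIcc t ht)).le).hasDerivWithinAt)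
        (fun _ _ => mem_univ _) hx ⟨hxw.le, le_rfl⟩
  have hfin : ∀ t ∈ Icc 0 T, (e' t, y' t) = (e t, y t) := fun t ht => by
    rw [hPe h' t ht, hPe h t ht, show P e' y' t = P e y t from hsub ht]
  exact ⟨fun t ht => congrArg Prod.fst (hfin t ht), fun t ht => congrArg Prod.snd (hfin t ht)⟩

/-- Local exponential stability of a semilinear system whose linearisation is triangular. -/
theorem exists_stable_isMildPair {T₁ T₂ : C0Group 𝕜 H} {N₁ N₂ : H × H → H} {c α β μ k r L : ℝ}
    (hc : 0 < c) (hαβ : α < β) (hμα : μ < α) (hμ : 0 ≤ μ) (hk : 0 ≤ k)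
    (hT₁ : ∀ t, 0 ≤ t → ‖T₁ t‖ ≤ c * Real.exp (-β * t))
    (hT₂ : ∀ t, 0 ≤ t → ‖T₂ t‖ ≤ c * Real.exp (-α * t))
    (c₁ : Continuous N₁) (c₂ : Continuous N₂) (hr : 0 < r) (hL : 0 ≤ L)
    (l₁ : ∀ x x', ‖x‖ < r → ‖x'‖ < r → ‖N₁ x - N₁ x'‖ ≤ L * ‖x - x'‖)
    (l₂ : ∀ x x', ‖x‖ < r → ‖x'‖ < r → ‖N₂ x - N₂ x'‖ ≤ L * ‖x - x'‖)
    (s₁ : ∀ ε, 0 < ε → ∃ δ, 0 < δ ∧ ∀ x, ‖x‖ < δ → ‖N₁ x‖ ≤ ε * ‖x‖)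
    (s₂ : ∀ ε, 0 < ε → ∃ δ, 0 < δ ∧ ∀ x, ‖x‖ < δ → ‖N₂ x‖ ≤ k * ‖x.1‖ + ε * ‖x‖) :
    ∃ ε : ℝ, 0 < ε ∧ ∃ C : ℝ, 0 < C ∧ ∀ a₁ a₂ : H, ‖a₁‖ ≤ ε → ‖a₂‖ ≤ ε →
      ∃ e y : ℝ → H, Continuous e ∧ Continuous y ∧
        (∀ T, IsMildPair T₁ T₂ N₁ N₂ a₁ a₂ T e y) ∧
        (∀ T, 0 < T → ∀ e' y' : ℝ → H, Continuous e' → Continuous y' →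
          IsMildPair T₁ T₂ N₁ N₂ a₁ a₂ T e' y' → EqOn e' e (Icc 0 T) ∧ EqOn y' y (Icc 0 T)) ∧
        ∀ t, 0 ≤ t → ‖e t‖ + ‖y t‖ ≤ C * Real.exp (-μ * t) * (‖a₁‖ + ‖a₂‖) := by
  obtain ⟨η, hη, hη1, hηk⟩ : ∃ η : ℝ, 0 < η ∧ η ≤ 1 ∧ η * (c * k) ≤ β - α := by
    have h1 : 0 < β - α := by linarith
    have h2 : 0 < c * k + 1 := by positivity
    refine ⟨min 1 ((β - α) / (c * k + 1)), lt_min one_pos (div_pos h1 h2), min_le_left _ _, ?_⟩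
    calc min 1 ((β - α) / (c * k + 1)) * (c * k) ≤ (β - α) / (c * k + 1) * (c * k + 1) := by
          gcongr
          · exact min_le_right _ _
          · linarith
      _ = β - α := by field_simp
  set ε := η * (α - μ) / (2 * c) with hε_def
  have hε : 0 < ε := div_pos (mul_pos hη (by linarith)) (by positivity)
  have hε2 : 2 * c * ε ≤ η * (α - μ) := by rw [hε_def]; field_simp; exact le_rfl
  obtain ⟨δ₁, hδ₁, s₁⟩ := s₁ ε hε
  obtain ⟨δ₂, hδ₂, s₂⟩ := s₂ ε hε
  -- Halving puts the closed ball of radius `ρ`, which contains the range of the retraction, inside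
  -- the open balls of validity of the hypotheses.
  set ρ := min r (min δ₁ δ₂) / 2 with hρ_def
  have hmin : 0 < min r (min δ₁ δ₂) := lt_min hr (lt_min hδ₁ hδ₂)
  have hρ : 0 < ρ := half_pos hmin
  have hρlt : ρ < min r (min δ₁ δ₂) := half_lt_self hmin
  have hρr : ρ < r := hρlt.trans_le (min_le_left _ _)
  have hρ1 : ρ < δ₁ := hρlt.trans_le ((min_le_right _ _).trans (min_le_left _ _))
  have hρ2 : ρ < δ₂ := hρlt.trans_le ((min_le_right _ _).trans (min_le_right _ _))
  let M₁ : H × H → H := fun x => N₁ (radialProj ρ x)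
  let M₂ : H × H → H := fun x => N₂ (radialProj ρ x)
  have hlip : ∀ {N : H × H → H}, (∀ x x', ‖x‖ < r → ‖x'‖ < r → ‖N x - N x'‖ ≤ L * ‖x - x'‖) →
      ∀ x x', ‖N (radialProj ρ x) - N (radialProj ρ x')‖ ≤ L * 2 * ‖x - x'‖ := by
    intro N hN x x'
    refine (hN _ _ ((norm_radialProj_le hρ x).trans_lt hρr)
      ((norm_radialProj_le hρ x').trans_lt hρr)).trans ?_
    rw [mul_assoc]
    gcongr
    exact norm_radialProj_sub_le hρ x x'
  have hcont : ∀ {M : H × H → H}, (∀ x x', ‖M x - M x'‖ ≤ L * 2 * ‖x - x'‖) → Continuous M := by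
    intro M hM
    refine (LipschitzWith.of_dist_le_mul (K := ⟨L * 2, by positivity⟩) fun x x' => ?_).continuous
    rw [dist_eq_norm, dist_eq_norm]
    exact hM x x'
  have hfst : ∀ x : H × H, ‖(radialProj ρ x).1‖ ≤ ‖x.1‖ := fun x => by
    have h1 := radialProj_coeff_mem ρ x
    rw [radialProj, Prod.smul_fst, norm_smul, Real.norm_of_nonneg h1.1.le]
    exact mul_le_of_le_one_left (norm_nonneg _) h1.2
  have m₁ : ∀ x, ‖M₁ x‖ ≤ ε * ‖x‖ := fun x =>
    (s₁ _ ((norm_radialProj_le hρ x).trans_lt hρ1)).trans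
      (by gcongr; exact norm_radialProj_le_norm ρ x)
  have m₂ : ∀ x, ‖M₂ x‖ ≤ k * ‖x.1‖ + ε * ‖x‖ := fun x =>
    (s₂ _ ((norm_radialProj_le hρ x).trans_lt hρ2)).trans
      (by gcongr; exacts [hfst x, norm_radialProj_le_norm ρ x])
  have b₁ : ∀ x, ‖M₁ x‖ ≤ k * ρ + ε * ρ := fun x => by
    refine (s₁ _ ((norm_radialProj_le hρ x).trans_lt hρ1)).trans ?_
    have h1 : ε * ‖radialProj ρ x‖ ≤ ε * ρ := by gcongr; exact norm_radialProj_le hρ x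
    have h2 : 0 ≤ k * ρ := by positivity
    linarith
  have b₂ : ∀ x, ‖M₂ x‖ ≤ k * ρ + ε * ρ := fun x =>
    (s₂ _ ((norm_radialProj_le hρ x).trans_lt hρ2)).trans (by
      gcongr
      · exact (norm_fst_le _).trans (norm_radialProj_le hρ x)
      · exact norm_radialProj_le hρ x)
  have k₁ := hcont (hlip l₁)
  have k₂ := hcont (hlip l₂)
  have hL2 : 0 ≤ L * 2 := by positivity
  have hD : 0 ≤ k * ρ + ε * ρ := by positivity
  -- With this radius the decay estimate gives `‖e‖ + ‖y‖ ≤ (c / η) · 2 · ρ η / (4 c) = ρ / 2`, so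
  -- the truncated solution stays where the truncation is inactive. This uses `μ ≥ 0`.
  refine ⟨ρ * η / (4 * c), by positivity, c / η, by positivity, fun a₁ a₂ ha₁ ha₂ => ?_⟩
  obtain ⟨e, y, he, hy, hm⟩ := exists_isMildPair T₁ T₂ hL2 hD (hlip l₁) (hlip l₂) b₁ b₂ k₁ k₂ a₁ a₂
  have hpair : ∀ t, ‖(e t, y t)‖ ≤ ‖e t‖ + ‖y t‖ := fun t =>
    max_le (le_add_of_nonneg_right (norm_nonneg _)) (le_add_of_nonneg_left (norm_nonneg _))
  have n₁ : Continuous fun s => M₁ (e s, y s) := k₁.comp (he.prodMk hy)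
  have n₂ : Continuous fun s => M₂ (e s, y s) := k₂.comp (he.prodMk hy)
  have hdecay := add_le_exp_of_triangular (β := β) (α := α) (μ := μ) (A₁ := ‖a₁‖) (A₂ := ‖a₂‖)
    (e := fun t => ‖e t‖) (y := fun t => ‖y t‖) hc hk hη hη1 hηk hε2 hε.le hμα.le
    (norm_nonneg a₂) n₁.norm n₂.norm
    (fun t ht => ⟨norm_nonneg _, by
      rw [(hm t t ⟨ht, le_rfl⟩).1]
      exact T₁.norm_mild_le hT₁ a₁ n₁ ht⟩)
    (fun t ht => ⟨norm_nonneg _, by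
      rw [(hm t t ⟨ht, le_rfl⟩).2]
      exact T₂.norm_mild_le hT₂ a₂ n₂ ht⟩)
    (fun t _ => (m₁ _).trans (by gcongr; exact hpair t))
    (fun t _ => (m₂ _).trans (by gcongr; exact hpair t))
  have hball : ∀ t, 0 ≤ t → ‖(e t, y t)‖ < ρ := by
    intro t ht
    refine ((hpair t).trans (hdecay t ht)).trans_lt ?_
    have h1 : Real.exp (-μ * t) ≤ 1 := by
      rw [Real.exp_le_one_iff]
      nlinarith
    calc c / η * Real.exp (-μ * t) * (‖a₁‖ + ‖a₂‖)
        ≤ c / η * 1 * (ρ * η / (4 * c) + ρ * η / (4 * c)) := by gcongr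
      _ = ρ / 2 := by field_simp; ring
      _ < ρ := half_lt_self hρ
  have hM₁ : ∀ x, ‖x‖ ≤ ρ → M₁ x = N₁ x := fun x hx => by
    simp only [M₁, radialProj_of_norm_le hρ hx]
  have hM₂ : ∀ x, ‖x‖ ≤ ρ → M₂ x = N₂ x := fun x hx => by
    simp only [M₂, radialProj_of_norm_le hρ hx]
  have hmN : ∀ T, IsMildPair T₁ T₂ N₁ N₂ a₁ a₂ T e y := fun T t ht => by
    obtain ⟨q₁, q₂⟩ := hm T t ht
    constructor
    · rw [q₁]
      exact T₁.mild_congr a₁ ht.1 fun s hs => hM₁ _ (hball s hs.1).le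
    · rw [q₂]
      exact T₂.mild_congr a₂ ht.1 fun s hs => hM₂ _ (hball s hs.1).le
  exact ⟨e, y, he, hy, hmN, fun T _ e' y' he' hy' h' =>
    IsMildPair.eqOn hL2 hD (hlip l₁) (hlip l₂) b₁ b₂ hM₁ hM₂ c₁ c₂ he hy he' hy' (hmN T)
      (fun t ht => hball t ht.1) h', hdecay⟩

end C0Group

/-! ### From distributional equations to integrated and mild ones. -/

theorem hasDistribDeriv_iff {𝕜 : Type*} [RCLike 𝕜] {T : ℝ} (hT : 0 < T) {F G : ℝ → 𝕜}
    (hF : ContinuousOn F (Icc 0 T)) (hG : IntervalIntegrable G volume 0 T) :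
    HasDistribDeriv T F G ↔ ∀ t ∈ Icc 0 T, F t = F 0 + ∫ s in (0 : ℝ)..t, G s :=
  ⟨fun h => h.eq_add_integral hT hF hG, fun h => hasDistribDeriv_primitive hT hG h⟩

theorem HasDistribDeriv.congr {𝕜 : Type*} [RCLike 𝕜] {T : ℝ} {F G F' G' : ℝ → 𝕜}
    (h : HasDistribDeriv T F G) (hF : EqOn F' F (Icc 0 T)) (hG : EqOn G' G (Icc 0 T)) :
    HasDistribDeriv T F' G' := by
  intro θ h1 h2 h3
  have e1 : ∫ t in Ioo 0 T, ((deriv θ t : ℝ) : 𝕜) * F' t =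
      ∫ t in Ioo 0 T, ((deriv θ t : ℝ) : 𝕜) * F t :=
    setIntegral_congr_fun measurableSet_Ioo fun t ht => by
      simp only [hF (Ioo_subset_Icc_self ht)]
  have e2 : ∫ t in Ioo 0 T, ((θ t : ℝ) : 𝕜) * G' t = ∫ t in Ioo 0 T, ((θ t : ℝ) : 𝕜) * G t :=
    setIntegral_congr_fun measurableSet_Ioo fun t ht => by
      simp only [hG (Ioo_subset_Icc_self ht)]
  rw [e1, e2, h θ h1 h2 h3]

namespace C0Group

variable {𝕜 H : Type*} [RCLike 𝕜] [NormedAddCommGroup H] [InnerProductSpace 𝕜 H] [CompleteSpace H]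
  [NormedSpace ℝ H] [IsScalarTower ℝ 𝕜 H]

theorem ext {S S' : C0Group 𝕜 H} (h : ∀ t, S t = S' t) : S = S' := by
  cases S
  cases S'
  congr
  exact funext h

theorem rev_rev (S : C0Group 𝕜 H) : S.rev.rev = S :=
  ext fun t => by rw [rev_apply, rev_apply, neg_neg]

theorem scale_neg_scale (S : C0Group 𝕜 H) (a : ℝ) : (S.scale a).scale (-a) = S :=
  ext fun t => ContinuousLinearMap.ext fun x => by
    rw [scale_apply, scale_apply, smul_smul, ← RCLike.ofReal_mul, ← Real.exp_add]
    simp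

/-- A zero-order term `b e` is absorbed into the rescaled group, whose generator is `A + b`. For the
converse, scaling back by `-b` turns test vectors of the rescaled adjoint group into those of the
original one. -/
theorem eqOn_scale_mild_iff {S S' : C0Group 𝕜 H} (hS : S.IsDual S') (b : ℝ) {e h : ℝ → H}
    (he : Continuous e) (hh : Continuous h) {a : H} {T : ℝ} :
    EqOn e ((S.scale b).mild a h) (Icc 0 T) ↔
      ∀ φ φ' : H, S'.HasGenerator φ φ' → ∀ t ∈ Icc 0 T, ⟪φ, e t⟫_𝕜 =
        ⟪φ, a⟫_𝕜 + ∫ s in (0 : ℝ)..t, (⟪φ', e s⟫_𝕜 + ⟪φ, (b : 𝕜) • e s + h s⟫_𝕜) := by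
  have hsum : ∀ (φ φ' x w : H), ⟪φ' + (b : 𝕜) • φ, x⟫_𝕜 + ⟪φ, w⟫_𝕜 =
      ⟪φ', x⟫_𝕜 + ⟪φ, (b : 𝕜) • x + w⟫_𝕜 := fun φ φ' x w => by
    rw [inner_add_left, inner_add_right, inner_smul_left, inner_smul_right, RCLike.conj_ofReal,
      add_assoc]
  constructor
  · intro hm φ φ' hφ t ht
    rw [hm ht, inner_mild_eq (hS.scale b) hh a (hφ.scale b) t]
    congr 1
    refine intervalIntegral.integral_congr fun s hs => ?_
    rw [uIcc_of_le ht.1] at hs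
    simp only [hm ⟨hs.1, hs.2.trans ht.2⟩, hsum]
  · intro hw
    refine eqOn_mild_of_weak (hS.scale b) he hh fun φ φ' hφ t ht => ?_
    have h1 := hφ.scale (-b)
    rw [scale_neg_scale] at h1
    rw [hw φ _ h1 t ht]
    congr 1
    refine intervalIntegral.integral_congr fun s _ => ?_
    simp only [← hsum]
    congr 2
    simp

end C0Group

/-! ### The closed loop in the variables `(y₁ - Q y₂, y₂)`. -/

section Control

open C0Group

variable {𝕜 H U : Type*} [RCLike 𝕜] [NormedAddCommGroup H] [InnerProductSpace 𝕜 H]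
  [CompleteSpace H] [NormedAddCommGroup U] [InnerProductSpace 𝕜 U] [CompleteSpace U]

theorem IsObservation.congr {S : C0Group 𝕜 H} {B : U →L[𝕜] S.AdjDual} {T : ℝ} {z z' : ℝ → H}
    {v : ℝ → U} (h : IsObservation B T z v) (hz : EqOn z' z (Icc 0 T)) :
    IsObservation B T z' v := by
  refine ⟨h.1, fun t ht => ?_⟩
  obtain ⟨Z, h1, h2⟩ := h.2 t ht
  refine ⟨Z, fun x => (h1 x).trans (intervalIntegral.integral_congr fun s hs => ?_), h2⟩
  rw [uIcc_of_le ht.1] at hs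
  simp only [hz ⟨hs.1, hs.2.trans ht.2⟩]

theorem IsClosedLoopSolution.congr {S : C0Group 𝕜 H} {B : U →L[𝕜] S.AdjDual} {Q : H ≃L[𝕜] H}
    {W : U →L[𝕜] U} {f : H → H} {lam lam₁ : ℝ} {a₁ a₂ : H} {T : ℝ} (hT : 0 ≤ T)
    {y₁ y₂ z₁ z₂ : ℝ → H} (h : IsClosedLoopSolution B Q W f lam lam₁ a₁ a₂ T y₁ y₂)
    (h₁ : EqOn z₁ y₁ (Icc 0 T)) (h₂ : EqOn z₂ y₂ (Icc 0 T)) :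
    IsClosedLoopSolution B Q W f lam lam₁ a₁ a₂ T z₁ z₂ := by
  obtain ⟨c1, c2, i1, i2, ⟨v, hv, d1⟩, d2⟩ := h
  have h0 : (0 : ℝ) ∈ Icc 0 T := ⟨le_rfl, hT⟩
  refine ⟨c1.congr h₁, c2.congr h₂, (h₁ h0).trans i1, (h₂ h0).trans i2,
    ⟨v, hv.congr h₂, fun φ => (d1 φ).congr (fun t ht => ?_) fun t ht => ?_⟩,
    fun ψ => (d2 ψ).congr (fun t ht => ?_) fun t ht => ?_⟩
  · simp only [h₁ ht]
  · simp only [h₁ ht]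
  · simp only [h₂ ht]
  · simp only [h₁ ht, h₂ ht]

/-- The nonlinearity `f(e + Q y) - f(Q y)` in the equation of the error `e = y₁ - Q y₂`. -/
def errorNonlinearity (Q : H ≃L[𝕜] H) (f : H → H) (x : H × H) : H := f (x.1 + Q x.2) - f (Q x.2)

/-- The nonlinearity `Q⁻¹ f(Q y) + λ₁ Q⁻¹ e` in the equation of `y = y₂`. -/
def observerNonlinearity (Q : H ≃L[𝕜] H) (f : H → H) (lam₁ : ℝ) (x : H × H) : H :=
  Q.symm (f (Q x.2)) + (lam₁ : 𝕜) • Q.symm x.1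

theorem continuous_errorNonlinearity {Q : H ≃L[𝕜] H} {f : H → H} (hf : Continuous f) :
    Continuous (errorNonlinearity Q f) :=
  (hf.comp (continuous_fst.add (Q.continuous.comp continuous_snd))).sub
    (hf.comp (Q.continuous.comp continuous_snd))

theorem continuous_observerNonlinearity {Q : H ≃L[𝕜] H} {f : H → H} (hf : Continuous f) (lam₁ : ℝ) :
    Continuous (observerNonlinearity Q f lam₁) :=
  (Q.symm.continuous.comp (hf.comp (Q.continuous.comp continuous_snd))).add
    ((Q.symm.continuous.comp continuous_fst).const_smul _)

variable [NormedSpace ℝ H] [IsScalarTower ℝ 𝕜 H]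

/-- The control term, expressed through the Riccati identity. -/
theorem RiccatiIdentity.integral_inner_observation {S : C0Group 𝕜 H} {B : U →L[𝕜] S.AdjDual}
    {Q : H ≃L[𝕜] H} (hQsymm : ∀ x y, ⟪Q x, y⟫_𝕜 = ⟪x, Q y⟫_𝕜) {W : U →L[𝕜] U}
    (hW : ∀ x y, ⟪W x, y⟫_𝕜 = ⟪x, W y⟫_𝕜) {lam : ℝ}
    (hQ : RiccatiIdentity B (Q : H →L[𝕜] H) 0 W lam) {y g : ℝ → H} (hy : Continuous y)
    (hg : Continuous g) {a : H} {T : ℝ}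
    (hw : ∀ ψ ψ' : H, S.HasGenerator ψ ψ' → ∀ t ∈ Icc 0 T,
      ⟪ψ, y t⟫_𝕜 = ⟪ψ, a⟫_𝕜 + ∫ s in (0 : ℝ)..t, (⟪-ψ', y s⟫_𝕜 + ⟪ψ, g s⟫_𝕜))
    {v : ℝ → U} (hv : IsObservation B T y v) (φ : S.AdjDomain) {t : ℝ} (ht : t ∈ Icc 0 T) :
    ∫ s in (0 : ℝ)..t, ⟪controlAdjoint B φ, W (v s)⟫_𝕜 =
      ⟪AdjDomain.vec φ, Q a⟫_𝕜 - ⟪AdjDomain.vec φ, Q (y t)⟫_𝕜 +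
        ∫ s in (0 : ℝ)..t, (⟪AdjDomain.adj φ, Q (y s)⟫_𝕜
          + ⟪AdjDomain.vec φ, Q (g s) + (2 * (lam : 𝕜)) • Q (y s)⟫_𝕜) := by
  obtain ⟨Z, hZ, hBZ⟩ := hv.2 t ht
  have hyi : IntervalIntegrable y volume 0 t := hy.intervalIntegrable _ _
  have hgi : IntervalIntegrable g volume 0 t := hg.intervalIntegrable _ _
  have hvec : AdjDomain.vec Z = ∫ s in (0 : ℝ)..t, y s :=
    ext_inner_left 𝕜 fun x => by rw [hZ, inner_intervalIntegral_right hyi]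
  -- The integrated second equation, tested on the dense domain of `A`, identifies `A* Z`.
  have hadj : AdjDomain.adj Z = a - y t + ∫ s in (0 : ℝ)..t, g s := by
    refine S.dense_generator_domain.eq_of_inner_right 𝕜 ?_
    rintro ψ ⟨ψ', hψ⟩
    have h1 := hw ψ ψ' hψ t ht
    have hi1 : IntervalIntegrable (fun s => ⟪-ψ', y s⟫_𝕜) volume 0 t :=
      (continuous_const.inner hy).intervalIntegrable _ _
    have hi2 : IntervalIntegrable (fun s => ⟪ψ, g s⟫_𝕜) volume 0 t :=
      (continuous_const.inner hg).intervalIntegrable _ _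
    rw [intervalIntegral.integral_add hi1 hi2, ← inner_intervalIntegral_right hyi,
      ← inner_intervalIntegral_right hgi, ← hvec, inner_neg_left] at h1
    have h2 : ⟪ψ, AdjDomain.adj Z⟫_𝕜 = ⟪ψ', AdjDomain.vec Z⟫_𝕜 := by
      rw [← inner_conj_symm, AdjDomain.inner_adj_of_hasGenerator Z hψ, inner_conj_symm]
    rw [h2, inner_add_right, inner_sub_right, h1]
    ring
  -- Symmetry of `W` moves it onto `B* φ`, and the definition of the observation turns `∫₀ᵗ v` into
  -- `B* Z`. The Riccati identity at the pair `(φ, Z)` then eliminates `B`.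
  have h3 : ∫ s in (0 : ℝ)..t, ⟪controlAdjoint B φ, W (v s)⟫_𝕜 =
      ⟪W (controlAdjoint B φ), controlAdjoint B Z⟫_𝕜 := by
    rw [hBZ]
    simp_rw [hW]
  have h4 := hQ φ Z
  simp only [ContinuousLinearEquiv.coe_coe, _root_.zero_apply, inner_zero_left, add_zero] at h4
  have hcQ : Continuous fun s => ⟪AdjDomain.adj φ, Q (y s)⟫_𝕜 :=
    continuous_const.inner (Q.continuous.comp hy)
  have hcg : Continuous fun s => ⟪AdjDomain.vec φ, Q (g s)⟫_𝕜 :=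
    continuous_const.inner (Q.continuous.comp hg)
  have hcy : Continuous fun s => ⟪AdjDomain.vec φ, Q (y s)⟫_𝕜 :=
    continuous_const.inner (Q.continuous.comp hy)
  have hQint : ∀ {u : ℝ → H}, Continuous u → ∀ x : H,
      ∫ s in (0 : ℝ)..t, ⟪x, Q (u s)⟫_𝕜 = ⟪x, Q (∫ s in (0 : ℝ)..t, u s)⟫_𝕜 := by
    intro u hu x
    have h5 := (Q : H →L[𝕜] H).intervalIntegral_comp_comm (hu.intervalIntegrable (μ := volume) 0 t)
    simp only [ContinuousLinearEquiv.coe_coe] at h5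
    have h6 : IntervalIntegrable (fun s => Q (u s)) volume 0 t :=
      (Q.continuous.comp hu).intervalIntegrable _ _
    rw [← h5, inner_intervalIntegral_right h6]
  simp only [inner_add_right, inner_smul_right]
  have hi1 : IntervalIntegrable (fun s => ⟪AdjDomain.vec φ, Q (g s)⟫_𝕜
      + 2 * (lam : 𝕜) * ⟪AdjDomain.vec φ, Q (y s)⟫_𝕜) volume 0 t :=
    (hcg.add (continuous_const.mul hcy)).intervalIntegrable _ _
  have hi2 : IntervalIntegrable (fun s => 2 * (lam : 𝕜) * ⟪AdjDomain.vec φ, Q (y s)⟫_𝕜)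
      volume 0 t := (continuous_const.mul hcy).intervalIntegrable _ _
  rw [intervalIntegral.integral_add (hcQ.intervalIntegrable _ _) hi1,
    intervalIntegral.integral_add (hcg.intervalIntegrable _ _) hi2,
    intervalIntegral.integral_const_mul, hQint hy, hQint hg, hQint hy, ← hvec, h3]
  rw [hQsymm, hQsymm, hadj, _root_.map_add, _root_.map_sub, inner_add_right, inner_sub_right] at h4
  linear_combination -h4

/-- Both systems are compared through their integrated weak forms. Once the second equation holds,
the control term is given by the Riccati identity for any observation `v`, and the first equation
becomes the one for the error. -/
theorem isClosedLoopSolution_iff_isMildPair {S : C0Group 𝕜 H} {B : U →L[𝕜] S.AdjDual}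
    (hB : IsAdmissible B) {Q : H ≃L[𝕜] H} (hQsymm : ∀ x y, ⟪Q x, y⟫_𝕜 = ⟪x, Q y⟫_𝕜)
    {W : U →L[𝕜] U} (hW : ∀ x y, ⟪W x, y⟫_𝕜 = ⟪x, W y⟫_𝕜) {lam lam₁ : ℝ}
    (hQ : RiccatiIdentity B (Q : H →L[𝕜] H) 0 W lam) {f : H → H} (hf : Continuous f)
    {a₁ a₂ : H} {T : ℝ} (hT : 0 < T) {y₁ y₂ : ℝ → H} (h₁ : Continuous y₁) (h₂ : Continuous y₂) :
    IsClosedLoopSolution B Q W f lam lam₁ a₁ a₂ T y₁ y₂ ↔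
      IsMildPair (S.scale (-lam₁)) (S.dual.rev.scale (-(2 * lam))) (errorNonlinearity Q f)
        (observerNonlinearity Q f lam₁) (a₁ - Q a₂) a₂ T (fun t => y₁ t - Q (y₂ t)) y₂ := by
  set e : ℝ → H := fun t => y₁ t - Q (y₂ t) with he_def
  have he : Continuous e := h₁.sub (Q.continuous.comp h₂)
  have hN₁ : Continuous fun s => errorNonlinearity Q f (e s, y₂ s) :=
    (continuous_errorNonlinearity hf).comp (he.prodMk h₂)
  have hN₂ : Continuous fun s => observerNonlinearity Q f lam₁ (e s, y₂ s) :=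
    (continuous_observerNonlinearity hf lam₁).comp (he.prodMk h₂)
  set g : ℝ → H := fun s => ((-(2 * lam) : ℝ) : 𝕜) • y₂ s + observerNonlinearity Q f lam₁ (e s, y₂ s)
    with hg_def
  have hg : Continuous g := (h₂.const_smul _).add hN₂
  have hfy₁ : Continuous fun s => f (y₁ s) := hf.comp h₁
  have h0 : (0 : ℝ) ∈ Icc 0 T := ⟨le_rfl, hT.le⟩
  have hmild : IsMildPair (S.scale (-lam₁)) (S.dual.rev.scale (-(2 * lam))) (errorNonlinearity Q f)
      (observerNonlinearity Q f lam₁) (a₁ - Q a₂) a₂ T e y₂ ↔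
      EqOn e ((S.scale (-lam₁)).mild (a₁ - Q a₂) fun s => errorNonlinearity Q f (e s, y₂ s))
        (Icc 0 T) ∧
      EqOn y₂ ((S.dual.rev.scale (-(2 * lam))).mild a₂
        fun s => observerNonlinearity Q f lam₁ (e s, y₂ s)) (Icc 0 T) :=
    ⟨fun h => ⟨fun t ht => (h t ht).1, fun t ht => (h t ht).2⟩, fun h t ht => ⟨h.1 ht, h.2 ht⟩⟩
  have hweak₂ : EqOn y₂ ((S.dual.rev.scale (-(2 * lam))).mild a₂
        fun s => observerNonlinearity Q f lam₁ (e s, y₂ s)) (Icc 0 T) ↔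
      ∀ ψ ψ' : H, S.HasGenerator ψ ψ' → ∀ t ∈ Icc 0 T,
        ⟪ψ, y₂ t⟫_𝕜 = ⟪ψ, a₂⟫_𝕜 + ∫ s in (0 : ℝ)..t, (⟪-ψ', y₂ s⟫_𝕜 + ⟪ψ, g s⟫_𝕜) := by
    rw [eqOn_scale_mild_iff S.isDual_dual.symm.rev _ h₂ hN₂]
    refine ⟨fun h ψ ψ' hψ => h ψ (-ψ') hψ.rev, fun h ψ ψ' hψ => ?_⟩
    have h3 := hψ.rev
    rw [rev_rev] at h3
    have h4 := h ψ _ h3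
    rwa [neg_neg] at h4
  have hG₂ : ∀ (ψ : S.generator.domain) (s : ℝ),
      - ⟪S.generator ψ, y₂ s⟫_𝕜 - 2 * (lam : 𝕜) * ⟪(ψ : H), y₂ s⟫_𝕜
        + ⟪(ψ : H), Q.symm (f (Q (y₂ s)))⟫_𝕜
        + (lam₁ : 𝕜) * ⟪(ψ : H), Q.symm (y₁ s - Q (y₂ s))⟫_𝕜 =
      ⟪-S.generator ψ, y₂ s⟫_𝕜 + ⟪(ψ : H), g s⟫_𝕜 := by
    intro ψ s
    simp only [hg_def, observerNonlinearity, he_def, inner_add_right, inner_smul_right,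
      inner_neg_left]
    push_cast
    ring
  have hdist₂ : y₂ 0 = a₂ → ((∀ ψ : S.generator.domain,
      HasDistribDeriv T (fun t => ⟪(ψ : H), y₂ t⟫_𝕜)
        (fun t => - ⟪S.generator ψ, y₂ t⟫_𝕜 - 2 * (lam : 𝕜) * ⟪(ψ : H), y₂ t⟫_𝕜
          + ⟪(ψ : H), Q.symm (f (Q (y₂ t)))⟫_𝕜
          + (lam₁ : 𝕜) * ⟪(ψ : H), Q.symm (y₁ t - Q (y₂ t))⟫_𝕜)) ↔
      ∀ ψ ψ' : H, S.HasGenerator ψ ψ' → ∀ t ∈ Icc 0 T,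
        ⟪ψ, y₂ t⟫_𝕜 = ⟪ψ, a₂⟫_𝕜 + ∫ s in (0 : ℝ)..t, (⟪-ψ', y₂ s⟫_𝕜 + ⟪ψ, g s⟫_𝕜)) := by
    intro hy0
    have h3 : ∀ ψ : S.generator.domain, HasDistribDeriv T (fun t => ⟪(ψ : H), y₂ t⟫_𝕜)
        (fun t => ⟪-S.generator ψ, y₂ t⟫_𝕜 + ⟪(ψ : H), g t⟫_𝕜) ↔ ∀ t ∈ Icc 0 T,
        ⟪(ψ : H), y₂ t⟫_𝕜 =
          ⟪(ψ : H), a₂⟫_𝕜 + ∫ s in (0 : ℝ)..t, (⟪-S.generator ψ, y₂ s⟫_𝕜 + ⟪(ψ : H), g s⟫_𝕜) := by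
      intro ψ
      rw [hasDistribDeriv_iff hT (continuous_const.inner h₂).continuousOn
        (((continuous_const.inner h₂).add (continuous_const.inner hg)).intervalIntegrable _ _), hy0]
    simp_rw [hG₂, h3]
    refine ⟨fun h ψ ψ' hψ => ?_, fun h ψ => h ψ _ (S.hasGenerator_generator ψ)⟩
    have h4 := h ⟨ψ, ψ', hψ⟩
    rwa [hψ.generator_eq] at h4
  have hweak₁ : EqOn e ((S.scale (-lam₁)).mild (a₁ - Q a₂)
        fun s => errorNonlinearity Q f (e s, y₂ s)) (Icc 0 T) ↔
      ∀ φ : S.AdjDomain, ∀ t ∈ Icc 0 T, ⟪AdjDomain.vec φ, e t⟫_𝕜 = ⟪AdjDomain.vec φ, a₁ - Q a₂⟫_𝕜 +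
        ∫ s in (0 : ℝ)..t, (⟪AdjDomain.adj φ, e s⟫_𝕜
          + ⟪AdjDomain.vec φ, ((-lam₁ : ℝ) : 𝕜) • e s + errorNonlinearity Q f (e s, y₂ s)⟫_𝕜) := by
    rw [eqOn_scale_mild_iff S.isDual_dual _ he hN₁]
    refine ⟨fun h φ => h _ _ (AdjDomain.hasGenerator_dual φ), fun h φ φ' hφ => ?_⟩
    obtain ⟨Z, rfl, rfl⟩ := AdjDomain.exists_of_hasGenerator_dual hφ
    exact h Z
  have hdist₁ : y₁ 0 = a₁ → (∀ ψ ψ' : H, S.HasGenerator ψ ψ' → ∀ t ∈ Icc 0 T,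
        ⟪ψ, y₂ t⟫_𝕜 = ⟪ψ, a₂⟫_𝕜 + ∫ s in (0 : ℝ)..t, (⟪-ψ', y₂ s⟫_𝕜 + ⟪ψ, g s⟫_𝕜)) →
      ∀ v, IsObservation B T y₂ v → ∀ φ : S.AdjDomain,
      (HasDistribDeriv T (fun t => ⟪AdjDomain.vec φ, y₁ t⟫_𝕜)
        (fun t => ⟪AdjDomain.adj φ, y₁ t⟫_𝕜 + ⟪AdjDomain.vec φ, f (y₁ t)⟫_𝕜
          - ⟪controlAdjoint B φ, W (v t)⟫_𝕜) ↔
      ∀ t ∈ Icc 0 T, ⟪AdjDomain.vec φ, e t⟫_𝕜 = ⟪AdjDomain.vec φ, a₁ - Q a₂⟫_𝕜 +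
        ∫ s in (0 : ℝ)..t, (⟪AdjDomain.adj φ, e s⟫_𝕜
          + ⟪AdjDomain.vec φ, ((-lam₁ : ℝ) : 𝕜) • e s + errorNonlinearity Q f (e s, y₂ s)⟫_𝕜)) := by
    intro hy0 hw v hv φ
    have hvi : IntervalIntegrable (fun s => ⟪controlAdjoint B φ, W (v s)⟫_𝕜) volume 0 T := by
      simp_rw [← hW]
      rw [intervalIntegrable_iff_integrableOn_Ioo_of_le hT.le]
      exact (hv.1.const_inner _).integrable (by norm_num)
    have hc : Continuous fun s => ⟪AdjDomain.adj φ, y₁ s⟫_𝕜 + ⟪AdjDomain.vec φ, f (y₁ s)⟫_𝕜 :=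
      (continuous_const.inner h₁).add (continuous_const.inner hfy₁)
    rw [hasDistribDeriv_iff hT (continuous_const.inner h₁).continuousOn
      ((hc.intervalIntegrable _ _).sub hvi), hy0]
    refine forall₂_congr fun t ht => ?_
    have hcK : Continuous fun s => ⟪AdjDomain.adj φ, Q (y₂ s)⟫_𝕜
        + ⟪AdjDomain.vec φ, Q (g s) + (2 * (lam : 𝕜)) • Q (y₂ s)⟫_𝕜 :=
      (continuous_const.inner (Q.continuous.comp h₂)).add (continuous_const.inner
        ((Q.continuous.comp hg).add ((Q.continuous.comp h₂).const_smul _)))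
    have hK := RiccatiIdentity.integral_inner_observation hQsymm hW hQ h₂ hg hw hv φ ht
    rw [intervalIntegral.integral_sub (hc.intervalIntegrable _ _)
      (hvi.mono_set (uIcc_subset_uIcc_left (by rwa [uIcc_of_le hT.le]))), hK]
    -- Pointwise cancellation: `Q g` contains `-2λ Q y₂ + f(Q y₂) + λ₁ e`, the term `2λ Q y₂`
    -- cancels, and what is left is `A e - λ₁ e + f(y₁) - f(Q y₂)` in weak form.
    have hsplit : ∫ s in (0 : ℝ)..t, (⟪AdjDomain.adj φ, e s⟫_𝕜
          + ⟪AdjDomain.vec φ, ((-lam₁ : ℝ) : 𝕜) • e s + errorNonlinearity Q f (e s, y₂ s)⟫_𝕜) =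
        (∫ s in (0 : ℝ)..t, (⟪AdjDomain.adj φ, y₁ s⟫_𝕜 + ⟪AdjDomain.vec φ, f (y₁ s)⟫_𝕜)) -
        ∫ s in (0 : ℝ)..t, (⟪AdjDomain.adj φ, Q (y₂ s)⟫_𝕜
          + ⟪AdjDomain.vec φ, Q (g s) + (2 * (lam : 𝕜)) • Q (y₂ s)⟫_𝕜) := by
      rw [← intervalIntegral.integral_sub (hc.intervalIntegrable _ _) (hcK.intervalIntegrable _ _)]
      refine intervalIntegral.integral_congr fun s _ => ?_
      simp only [hg_def, observerNonlinearity, errorNonlinearity, he_def, _root_.map_add,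
        _root_.map_sub, ContinuousLinearEquiv.map_smul, ContinuousLinearEquiv.apply_symm_apply,
        sub_add_cancel, inner_add_right, inner_sub_right, inner_smul_right]
      push_cast
      ring
    rw [hsplit]
    simp only [he_def, inner_sub_right]
    constructor
    · intro h; linear_combination h
    · intro h; linear_combination h
  rw [hmild, hweak₁, hweak₂]
  constructor
  · rintro ⟨-, -, i1, i2, ⟨v, hv, d1⟩, d2⟩
    have hw := (hdist₂ i2).1 d2
    exact ⟨fun φ => (hdist₁ i1 hw v hv φ).1 (d1 φ), hw⟩
  · rintro ⟨he', hw⟩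
    have i2 : y₂ 0 = a₂ := by
      rw [hweak₂.2 hw h0, mild_zero]
    have i1 : y₁ 0 = a₁ := by
      have h3 := hweak₁.2 he' h0
      rw [mild_zero] at h3
      simp only [he_def, i2] at h3
      exact sub_left_injective h3
    -- A mild pair carries no observation. Admissibility supplies one, because `y₂` is also a mild
    -- solution for the unscaled group with the continuous source `g`.
    have hobs : ∃ v, IsObservation B T y₂ v := by
      obtain ⟨v, hv⟩ := hB.exists_isObservation hT a₂ hg
      refine ⟨v, hv.congr (eqOn_mild_of_weak S.isDual_dual.symm.rev h₂ hg fun φ φ' hφ => ?_)⟩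
      have h3 := hφ.rev
      rw [rev_rev] at h3
      have h4 := hw φ _ h3
      rwa [neg_neg] at h4
    obtain ⟨v, hv⟩ := hobs
    exact ⟨h₁.continuousOn, h₂.continuousOn, i1, i2,
      ⟨v, hv, fun φ => (hdist₁ i1 hw v hv φ).2 (he' φ)⟩, (hdist₂ i2).2 hw⟩

end Control

/-! ### Local Lipschitz and smallness estimates of the transformed nonlinearities. -/

section Nonlinearities

variable {𝕜 H : Type*} [RCLike 𝕜] [NormedAddCommGroup H] [InnerProductSpace 𝕜 H]

theorem norm_add_apply_le (Q : H ≃L[𝕜] H) (x : H × H) :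
    ‖x.1 + Q x.2‖ ≤ (1 + ‖(Q : H →L[𝕜] H)‖) * ‖x‖ ∧ ‖Q x.2‖ ≤ ‖(Q : H →L[𝕜] H)‖ * ‖x‖ := by
  have h1 : ‖Q x.2‖ ≤ ‖(Q : H →L[𝕜] H)‖ * ‖x‖ :=
    ((Q : H →L[𝕜] H).le_opNorm x.2).trans (by gcongr; exact norm_snd_le x)
  refine ⟨(norm_add_le _ _).trans ?_, h1⟩
  have h2 := norm_fst_le x
  linarith

theorem exists_lipschitz_nonlinearities (Q : H ≃L[𝕜] H) {f : H → H} (lam₁ : ℝ)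
    (hf : ∃ r : ℝ, 0 < r ∧ ∃ Λ : ℝ, 0 < Λ ∧
      ∀ x x' : H, ‖x‖ < r → ‖x'‖ < r → ‖f x - f x'‖ ≤ Λ * ‖x - x'‖) :
    ∃ r L : ℝ, 0 < r ∧ 0 ≤ L ∧
      (∀ x x', ‖x‖ < r → ‖x'‖ < r →
        ‖errorNonlinearity Q f x - errorNonlinearity Q f x'‖ ≤ L * ‖x - x'‖) ∧
      ∀ x x', ‖x‖ < r → ‖x'‖ < r →
        ‖observerNonlinearity Q f lam₁ x - observerNonlinearity Q f lam₁ x'‖ ≤ L * ‖x - x'‖ := by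
  obtain ⟨r, hr, Λ, hΛ, hlip⟩ := hf
  set q := ‖(Q : H →L[𝕜] H)‖ with hq
  set p := ‖(Q.symm : H →L[𝕜] H)‖ with hp
  have hq0 : 0 ≤ q := norm_nonneg _
  have hp0 : 0 ≤ p := norm_nonneg _
  have hball : ∀ x : H × H, ‖x‖ < r / (1 + q) → ‖x.1 + Q x.2‖ < r ∧ ‖Q x.2‖ < r := by
    intro x hx
    rw [lt_div_iff₀ (by positivity)] at hx
    obtain ⟨h1, h2⟩ := norm_add_apply_le Q x
    have := norm_nonneg x
    exact ⟨by linarith, by nlinarith⟩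
  have hQf : ∀ x x' : H × H, ‖x‖ < r / (1 + q) → ‖x'‖ < r / (1 + q) →
      ‖f (Q x.2) - f (Q x'.2)‖ ≤ Λ * (q * ‖x - x'‖) := by
    intro x x' hx hx'
    refine (hlip _ _ (hball x hx).2 (hball x' hx').2).trans ?_
    rw [← _root_.map_sub]
    gcongr
    exact (norm_add_apply_le Q (x - x')).2
  -- The radius sends both `x.1 + Q x.2` and `Q x.2` into the ball of radius `r`. The constant is
  -- the sum of those of the two nonlinearities.
  refine ⟨r / (1 + q), Λ * (1 + q) + Λ * q + p * (Λ * q) + |lam₁| * p, by positivity, by positivity,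
    fun x x' hx hx' => ?_, fun x x' hx hx' => ?_⟩
  · have h1 : ‖f (x.1 + Q x.2) - f (x'.1 + Q x'.2)‖ ≤ Λ * ((1 + q) * ‖x - x'‖) := by
      refine (hlip _ _ (hball x hx).1 (hball x' hx').1).trans ?_
      have h2 : x.1 + Q x.2 - (x'.1 + Q x'.2) = (x - x').1 + Q (x - x').2 := by
        rw [Prod.fst_sub, Prod.snd_sub, _root_.map_sub]; abel
      rw [h2]
      gcongr
      exact (norm_add_apply_le Q (x - x')).1
    have h3 : errorNonlinearity Q f x - errorNonlinearity Q f x' =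
        (f (x.1 + Q x.2) - f (x'.1 + Q x'.2)) - (f (Q x.2) - f (Q x'.2)) := by
      rw [errorNonlinearity, errorNonlinearity]; abel
    have h4 := hQf x x' hx hx'
    have h5 : 0 ≤ (p * (Λ * q) + |lam₁| * p) * ‖x - x'‖ := by positivity
    rw [h3]
    refine (norm_sub_le _ _).trans ?_
    linarith
  · have h3 : observerNonlinearity Q f lam₁ x - observerNonlinearity Q f lam₁ x' =
        Q.symm (f (Q x.2) - f (Q x'.2)) + (lam₁ : 𝕜) • Q.symm (x - x').1 := by
      rw [observerNonlinearity, observerNonlinearity, Prod.fst_sub, _root_.map_sub, _root_.map_sub,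
        smul_sub]
      abel
    have h4 : ‖Q.symm (f (Q x.2) - f (Q x'.2))‖ ≤ p * (Λ * (q * ‖x - x'‖)) :=
      ((Q.symm : H →L[𝕜] H).le_opNorm _).trans (by gcongr; exact hQf x x' hx hx')
    have h5 : ‖(lam₁ : 𝕜) • Q.symm (x - x').1‖ ≤ |lam₁| * (p * ‖x - x'‖) := by
      rw [norm_smul, RCLike.norm_ofReal]
      gcongr
      exact ((Q.symm : H →L[𝕜] H).le_opNorm _).trans (by gcongr; exact norm_fst_le (x - x'))
    have h6 : 0 ≤ (Λ * (1 + q) + Λ * q) * ‖x - x'‖ := by positivity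
    rw [h3]
    refine (norm_add_le _ _).trans ?_
    linarith

/-- The only first-order term is `λ₁ Q⁻¹ e`, in the second equation and depending on `e` alone; this
is the triangular structure. -/
theorem exists_small_nonlinearities (Q : H ≃L[𝕜] H) {f : H → H} (lam₁ : ℝ)
    (hf : ∀ ε : ℝ, 0 < ε → ∃ δ : ℝ, 0 < δ ∧ ∀ x : H, ‖x‖ < δ → ‖f x‖ ≤ ε * ‖x‖)
    {ε : ℝ} (hε : 0 < ε) : ∃ δ, 0 < δ ∧ ∀ x : H × H, ‖x‖ < δ →
      ‖errorNonlinearity Q f x‖ ≤ ε * ‖x‖ ∧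
      ‖observerNonlinearity Q f lam₁ x‖ ≤
        |lam₁| * ‖(Q.symm : H →L[𝕜] H)‖ * ‖x.1‖ + ε * ‖x‖ := by
  set q := ‖(Q : H →L[𝕜] H)‖ with hq
  set p := ‖(Q.symm : H →L[𝕜] H)‖ with hp
  have hq0 : 0 ≤ q := norm_nonneg _
  have hp0 : 0 ≤ p := norm_nonneg _
  -- The denominator collects the factors in the bounds of `f(e + Q y)`, `f(Q y)` and `Q⁻¹ f(Q y)`.
  set ε' := ε / ((1 + q) + q + p * q) with hε'
  have hε'0 : 0 < ε' := by positivity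
  have hε'1 : ε' * ((1 + q) + q + p * q) = ε := by rw [hε']; field_simp
  obtain ⟨δ, hδ, h⟩ := hf ε' hε'0
  refine ⟨δ / (1 + q), by positivity, fun x hx => ?_⟩
  rw [lt_div_iff₀ (by positivity)] at hx
  obtain ⟨h1, h2⟩ := norm_add_apply_le Q x
  have hx0 := norm_nonneg x
  have f1 : ‖f (x.1 + Q x.2)‖ ≤ ε' * ((1 + q) * ‖x‖) :=
    (h _ (by linarith)).trans (by gcongr)
  have f2 : ‖f (Q x.2)‖ ≤ ε' * (q * ‖x‖) :=
    (h _ (by nlinarith)).trans (by gcongr)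
  have hsplit : ε * ‖x‖ = ε' * ((1 + q) * ‖x‖) + ε' * (q * ‖x‖) + p * (ε' * (q * ‖x‖)) := by
    rw [← hε'1]; ring
  constructor
  · have h3 : 0 ≤ p * (ε' * (q * ‖x‖)) := by positivity
    refine (norm_sub_le _ _).trans ?_
    linarith
  · have h3 : ‖Q.symm (f (Q x.2))‖ ≤ p * (ε' * (q * ‖x‖)) :=
      ((Q.symm : H →L[𝕜] H).le_opNorm _).trans (by gcongr)
    have h4 : ‖(lam₁ : 𝕜) • Q.symm x.1‖ ≤ |lam₁| * (p * ‖x.1‖) := by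
      rw [norm_smul, RCLike.norm_ofReal]
      gcongr
      exact (Q.symm : H →L[𝕜] H).le_opNorm _
    have h5 : 0 ≤ ε' * ((1 + q) * ‖x‖) + ε' * (q * ‖x‖) := by positivity
    refine (norm_add_le _ _).trans ?_
    linarith

end Nonlinearities

/-! ### Groups with skew-adjoint generator. -/

namespace C0Group

variable {𝕜 H : Type*} [RCLike 𝕜] [NormedAddCommGroup H] [InnerProductSpace 𝕜 H] [CompleteSpace H]
  [NormedSpace ℝ H] [IsScalarTower ℝ 𝕜 H]

/-- A group with a skew-adjoint generator consists of contractions. -/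
theorem norm_le_one_of_skewAdjoint (S : C0Group 𝕜 H) (hS : S.generator.adjoint = -S.generator)
    (t : ℝ) : ‖S t‖ ≤ 1 := by
  have hskew : ∀ x z : H, S.HasGenerator x z → ⟪z, x⟫_𝕜 + ⟪x, z⟫_𝕜 = 0 := by
    intro x z hx
    have hmem : (x, -z) ∈ S.generator.adjoint.graph := by
      rw [hS, LinearPMap.mem_graph_iff]
      exact ⟨⟨x, z, hx⟩, rfl, congrArg Neg.neg hx.generator_eq⟩
    obtain ⟨Z, hZ1, hZ2⟩ : ∃ Z : S.AdjDomain, AdjDomain.vec Z = x ∧ AdjDomain.adj Z = -z :=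
      ⟨⟨WithLp.toLp 2 (x, -z), hmem⟩, rfl, rfl⟩
    have h1 := AdjDomain.inner_adj_of_hasGenerator Z hx
    rw [hZ1, hZ2, inner_neg_left] at h1
    rw [← h1, add_neg_cancel]
  -- On the domain `⟪A x, x⟫ + ⟪x, A x⟫ = 0`, so `‖S(s) x‖²` has zero derivative. Density extends
  -- the isometry to `H`.
  have hiso : ∀ x ∈ S.generator.domain, ‖S t x‖ = ‖x‖ := by
    rintro x ⟨z, hx⟩
    have hd : ∀ s, HasDerivAt (fun s => ⟪S s x, S s x⟫_𝕜) 0 s := fun s => by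
      have h1 := (hx.hasDerivAt s).inner 𝕜 (hx.hasDerivAt s)
      rwa [add_comm, hskew _ _ (hx.map s)] at h1
    have h2 := is_const_of_deriv_eq_zero (fun s => (hd s).differentiableAt)
      (fun s => (hd s).deriv) t 0
    simp only [map_zero_apply, inner_self_eq_norm_sq_to_K] at h2
    have h3 : ‖S t x‖ ^ 2 = ‖x‖ ^ 2 := by exact_mod_cast h2
    exact (pow_left_inj₀ (norm_nonneg _) (norm_nonneg _) two_ne_zero).1 h3
  have hall : ∀ x, ‖S t x‖ = ‖x‖ := fun x =>
    congrFun (Continuous.ext_on S.dense_generator_domain (S t).continuous.norm continuous_norm hiso) x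
  exact ContinuousLinearMap.opNorm_le_bound _ zero_le_one fun x => by rw [hall, one_mul]

end C0Group

/-! ### Local exponential stabilization of the closed loop. -/

section Control

open C0Group

variable {𝕜 H U : Type*} [RCLike 𝕜] [NormedAddCommGroup H] [InnerProductSpace 𝕜 H]
  [CompleteSpace H] [NormedAddCommGroup U] [InnerProductSpace 𝕜 U] [CompleteSpace U]

/-- Local stabilization of the closed-loop system for given exponential bounds of the groups. -/
theorem exists_stable_closedLoop (S : C0Group 𝕜 H) (B : U →L[𝕜] S.AdjDual) (hB : IsAdmissible B)
    (lam lam₁ γ : ℝ) (hγ : γ < lam) (Q : H ≃L[𝕜] H) (hQsymm : ∀ x y, ⟪Q x, y⟫_𝕜 = ⟪x, Q y⟫_𝕜)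
    (W : U →L[𝕜] U) (hW : ∀ x y, ⟪W x, y⟫_𝕜 = ⟪x, W y⟫_𝕜)
    (hQ : RiccatiIdentity B (Q : H →L[𝕜] H) 0 W lam) (f : H → H) (hf : Continuous f)
    (hf_small : ∀ ε : ℝ, 0 < ε → ∃ δ : ℝ, 0 < δ ∧ ∀ x : H, ‖x‖ < δ → ‖f x‖ ≤ ε * ‖x‖)
    (hf_lip : ∃ r : ℝ, 0 < r ∧ ∃ Λ : ℝ, 0 < Λ ∧
      ∀ x x' : H, ‖x‖ < r → ‖x'‖ < r → ‖f x - f x'‖ ≤ Λ * ‖x - x'‖)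
    (ωA ωA' c : ℝ) (hc : 0 < c) (hS : ∀ t : ℝ, 0 ≤ t → ‖S t‖ ≤ c * Real.exp (t * ωA))
    (hS' : ∀ t : ℝ, 0 ≤ t → ‖ContinuousLinearMap.adjoint (S (-t))‖ ≤ c * Real.exp (t * ωA'))
    (h₁ : lam₁ - 2 * lam > ωA - ωA') (h₂ : 2 * γ - ωA' > 0) :
    ∃ ε : ℝ, 0 < ε ∧ ∃ C : ℝ, 0 < C ∧
      ∀ a₁ a₂ : H, Real.sqrt (‖a₁‖ ^ 2 + ‖a₂‖ ^ 2) ≤ ε →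
        ∃ y₁ y₂ : ℝ → H,
          (∀ T : ℝ, 0 < T → IsClosedLoopSolution B Q W f lam lam₁ a₁ a₂ T y₁ y₂) ∧
          (∀ T : ℝ, 0 < T → ∀ z₁ z₂ : ℝ → H,
            IsClosedLoopSolution B Q W f lam lam₁ a₁ a₂ T z₁ z₂ →
            EqOn z₁ y₁ (Icc 0 T) ∧ EqOn z₂ y₂ (Icc 0 T)) ∧
          (∀ t : ℝ, 0 ≤ t →
            ‖y₁ t‖ + ‖y₂ t‖ ≤ C * Real.exp ((ωA' - 2 * γ) * t) * (‖y₁ 0‖ + ‖y₂ 0‖)) := by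
  let _ : NormedSpace ℝ H := NormedSpace.restrictScalars ℝ 𝕜 H
  have : IsScalarTower ℝ 𝕜 H := IsScalarTower.of_algebraMap_smul fun _ _ => rfl
  set q := ‖(Q : H →L[𝕜] H)‖ with hq
  have hq0 : 0 ≤ q := norm_nonneg _
  have hQle : ∀ x, ‖Q x‖ ≤ q * ‖x‖ := (Q : H →L[𝕜] H).le_opNorm
  have hexp : ∀ a b t : ℝ, Real.exp (-a * t) * (c * Real.exp (t * b)) =
      c * Real.exp (-(a - b) * t) := fun a b t => by
    rw [mul_left_comm, ← Real.exp_add]; ring_nf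
  obtain ⟨r, L, hr, hL, l₁, l₂⟩ := exists_lipschitz_nonlinearities Q lam₁ hf_lip
  -- Here `α < β` is the hypothesis on `λ₁ - 2λ`, `μ < α` is `γ < λ`, and `0 ≤ μ` follows from `2γ >
  -- ωA'`.
  obtain ⟨ε, hε, C, hC, hmain⟩ := exists_stable_isMildPair
    (T₁ := S.scale (-lam₁)) (T₂ := S.dual.rev.scale (-(2 * lam)))
    (N₁ := errorNonlinearity Q f) (N₂ := observerNonlinearity Q f lam₁) (c := c)
    (α := 2 * lam - ωA') (β := lam₁ - ωA) (μ := 2 * γ - ωA')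
    (k := |lam₁| * ‖(Q.symm : H →L[𝕜] H)‖) (r := r) (L := L)
    hc (by linarith) (by linarith) (by linarith) (by positivity)
    (fun t ht => (norm_scale_le (-lam₁) (hS t ht)).trans_eq (hexp _ _ _))
    (fun t ht => (norm_scale_le (S := S.dual.rev) (-(2 * lam)) (hS' t ht)).trans_eq (hexp _ _ _))
    (continuous_errorNonlinearity hf) (continuous_observerNonlinearity hf lam₁) hr hL l₁ l₂
    (fun ε hε => by
      obtain ⟨δ, hδ, h⟩ := exists_small_nonlinearities Q lam₁ hf_small hε
      exact ⟨δ, hδ, fun x hx => (h x hx).1⟩)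
    (fun ε hε => by
      obtain ⟨δ, hδ, h⟩ := exists_small_nonlinearities Q lam₁ hf_small hε
      exact ⟨δ, hδ, fun x hx => (h x hx).2⟩)
  -- Each passage between `(y₁, y₂)` and `(y₁ - Q y₂, y₂)` costs a factor `1 + q`: once on the data,
  -- once on the solution.
  refine ⟨ε / (1 + q), by positivity, (1 + q) * C * (1 + q), by positivity, fun a₁ a₂ ha => ?_⟩
  have hn₁ : ‖a₁‖ ≤ ε / (1 + q) := (Real.le_sqrt_of_sq_le (by nlinarith [sq_nonneg ‖a₂‖])).trans ha
  have hn₂ : ‖a₂‖ ≤ ε / (1 + q) := (Real.le_sqrt_of_sq_le (by nlinarith [sq_nonneg ‖a₁‖])).trans ha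
  have hε1 : ε / (1 + q) * (1 + q) = ε := by field_simp
  have ha₀ : ‖a₁ - Q a₂‖ ≤ ‖a₁‖ + q * ‖a₂‖ :=
    (norm_sub_le _ _).trans (by gcongr; exact hQle a₂)
  have hm₁ : ‖a₁ - Q a₂‖ ≤ ε := by
    have : q * ‖a₂‖ ≤ q * (ε / (1 + q)) := by gcongr
    linarith
  have hm₂ : ‖a₂‖ ≤ ε := hn₂.trans (div_le_self hε.le (by linarith))
  obtain ⟨e, y, he, hy, hmild, huniq, hdecay⟩ := hmain (a₁ - Q a₂) a₂ hm₁ hm₂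
  have hy₁ : Continuous fun t => e t + Q (y t) := he.add (Q.continuous.comp hy)
  have hsol : ∀ T : ℝ, 0 < T →
      IsClosedLoopSolution B Q W f lam lam₁ a₁ a₂ T (fun t => e t + Q (y t)) y := by
    intro T hT
    refine (isClosedLoopSolution_iff_isMildPair hB hQsymm hW hQ hf hT hy₁ hy).2 ?_
    simp only [add_sub_cancel_right]
    exact hmild T
  have hi₁ : e 0 + Q (y 0) = a₁ := (hsol 1 one_pos).2.2.1
  have hi₂ : y 0 = a₂ := (hsol 1 one_pos).2.2.2.1
  refine ⟨fun t => e t + Q (y t), y, hsol, fun T hT z₁ z₂ hz => ?_, fun t ht => ?_⟩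
  -- A competing solution is continuous only on `[0, T]`; it is extended by its end values, since
  -- the equivalence with mild pairs is stated for functions continuous on `ℝ`.
  · have hz₁ : Continuous (IccExtend hT.le ((Icc 0 T).domRestrict z₁)) :=
      (continuousOn_iff_continuous_domRestrict.1 hz.1).Icc_extend'
    have hz₂ : Continuous (IccExtend hT.le ((Icc 0 T).domRestrict z₂)) :=
      (continuousOn_iff_continuous_domRestrict.1 hz.2.1).Icc_extend'
    have hE : ∀ z : ℝ → H, EqOn (IccExtend hT.le ((Icc 0 T).domRestrict z)) z (Icc 0 T) :=
      fun z t ht => by rw [IccExtend_of_mem _ _ ht, domRestrict_apply]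
    have hsol' := hz.congr hT.le (hE z₁) (hE z₂)
    rw [isClosedLoopSolution_iff_isMildPair hB hQsymm hW hQ hf hT hz₁ hz₂] at hsol'
    obtain ⟨u₁, u₂⟩ := huniq T hT _ _ (hz₁.sub (Q.continuous.comp hz₂)) hz₂ hsol'
    have v₂ : EqOn z₂ y (Icc 0 T) := fun t ht => (hE z₂ ht).symm.trans (u₂ ht)
    refine ⟨fun t ht => ?_, v₂⟩
    have h3 : IccExtend hT.le ((Icc 0 T).domRestrict z₁) t -
        Q (IccExtend hT.le ((Icc 0 T).domRestrict z₂) t) = e t := u₁ ht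
    change z₁ t = e t + Q (y t)
    rw [hE z₁ ht, hE z₂ ht, v₂ ht] at h3
    rw [← h3, sub_add_cancel]
  · change ‖e t + Q (y t)‖ + ‖y t‖ ≤ _ * (‖e 0 + Q (y 0)‖ + ‖y 0‖)
    rw [hi₁, hi₂]
    have h3 := hdecay t ht
    have h4 : -(2 * γ - ωA') * t = (ωA' - 2 * γ) * t := by ring
    rw [h4] at h3
    have h5 : ‖e t + Q (y t)‖ ≤ ‖e t‖ + q * ‖y t‖ :=
      (norm_add_le _ _).trans (by gcongr; exact hQle _)
    have h6 : 0 ≤ q * ‖e t‖ := by positivity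
    have h7 : 0 ≤ q * ‖a₁‖ := by positivity
    calc ‖e t + Q (y t)‖ + ‖y t‖ ≤ (1 + q) * (‖e t‖ + ‖y t‖) := by linarith
      _ ≤ (1 + q) * (C * Real.exp ((ωA' - 2 * γ) * t) * (‖a₁ - Q a₂‖ + ‖a₂‖)) := by gcongr
      _ ≤ (1 + q) * (C * Real.exp ((ωA' - 2 * γ) * t) * ((1 + q) * (‖a₁‖ + ‖a₂‖))) := by
          gcongr
          linarith
      _ = _ := by ring

end Control

end

theorem mainTheorem4 {𝕜 H U : Type*} [RCLike 𝕜]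
    [NormedAddCommGroup H] [InnerProductSpace 𝕜 H] [CompleteSpace H]
    [NormedAddCommGroup U] [InnerProductSpace 𝕜 U] [CompleteSpace U]
    (S : C0Group 𝕜 H) (B : U →L[𝕜] S.AdjDual) (hB : IsAdmissible B)
    (lam lam₁ γ : ℝ) (hγ : γ < lam)
    (Q : H ≃L[𝕜] H) (hQsymm : (Q : H →L[𝕜] H).IsSymmetric)
    (hQpos : ∃ κ : ℝ, 0 < κ ∧ ∀ x : H, κ * ‖x‖ ^ 2 ≤ RCLike.re ⟪Q x, x⟫_𝕜)
    (W : U →L[𝕜] U) (hW : W.IsPositive)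
    (hQ : RiccatiIdentity B (Q : H →L[𝕜] H) 0 W lam)
    (f : H → H) (hf : Continuous f)
    (hf_small : ∀ ε : ℝ, 0 < ε → ∃ δ : ℝ, 0 < δ ∧ ∀ x : H, ‖x‖ < δ → ‖f x‖ ≤ ε * ‖x‖)
    (hf_lip : ∃ r : ℝ, 0 < r ∧ ∃ Λ : ℝ, 0 < Λ ∧
      ∀ x x' : H, ‖x‖ < r → ‖x'‖ < r → ‖f x - f x'‖ ≤ Λ * ‖x - x'‖) :
    (∀ ωA ωA' c : ℝ,
      growthBound (fun t => S t) ≤ (ωA : EReal) →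
      growthBound (fun t => ContinuousLinearMap.adjoint (S (-t))) ≤ (ωA' : EReal) →
      0 < c →
      (∀ t : ℝ, 0 ≤ t → ‖S t‖ ≤ c * Real.exp (t * ωA)) →
      (∀ t : ℝ, 0 ≤ t → ‖ContinuousLinearMap.adjoint (S (-t))‖ ≤ c * Real.exp (t * ωA')) →
      lam₁ - 2 * lam > ωA - ωA' →
      2 * γ - ωA' > 0 →
      ∃ ε : ℝ, 0 < ε ∧ ∃ C : ℝ, 0 < C ∧
        ∀ a₁ a₂ : H, Real.sqrt (‖a₁‖ ^ 2 + ‖a₂‖ ^ 2) ≤ ε →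
          ∃ y₁ y₂ : ℝ → H,
            (∀ T : ℝ, 0 < T → IsClosedLoopSolution B Q W f lam lam₁ a₁ a₂ T y₁ y₂) ∧
            (∀ T : ℝ, 0 < T → ∀ z₁ z₂ : ℝ → H,
              IsClosedLoopSolution B Q W f lam lam₁ a₁ a₂ T z₁ z₂ →
              EqOn z₁ y₁ (Icc 0 T) ∧ EqOn z₂ y₂ (Icc 0 T)) ∧
            (∀ t : ℝ, 0 ≤ t →
              ‖y₁ t‖ + ‖y₂ t‖ ≤ C * Real.exp ((ωA' - 2 * γ) * t) * (‖y₁ 0‖ + ‖y₂ 0‖))) ∧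
    (S.generator.adjoint = -S.generator → lam₁ > 2 * lam → 2 * lam > 2 * γ → 2 * γ > 0 →
      ∃ ε : ℝ, 0 < ε ∧ ∃ C : ℝ, 0 < C ∧
        ∀ a₁ a₂ : H, Real.sqrt (‖a₁‖ ^ 2 + ‖a₂‖ ^ 2) ≤ ε →
          ∃ y₁ y₂ : ℝ → H,
            (∀ T : ℝ, 0 < T → IsClosedLoopSolution B Q W f lam lam₁ a₁ a₂ T y₁ y₂) ∧
            (∀ T : ℝ, 0 < T → ∀ z₁ z₂ : ℝ → H,
              IsClosedLoopSolution B Q W f lam lam₁ a₁ a₂ T z₁ z₂ →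
              EqOn z₁ y₁ (Icc 0 T) ∧ EqOn z₂ y₂ (Icc 0 T)) ∧
            (∀ t : ℝ, 0 ≤ t →
              ‖y₁ t‖ + ‖y₂ t‖ ≤ C * Real.exp (-2 * γ * t) * (‖y₁ 0‖ + ‖y₂ 0‖))) := by
  have hQ' : ∀ x y, ⟪Q x, y⟫_𝕜 = ⟪x, Q y⟫_𝕜 := fun x y => hQsymm x y
  have hW' : ∀ x y, ⟪W x, y⟫_𝕜 = ⟪x, W y⟫_𝕜 := fun x y => hW.isSymmetric x y
  refine ⟨fun ωA ωA' c _ _ hc hS hS' h₁ h₂ => exists_stable_closedLoop S B hB lam lam₁ γ hγ Q hQ' W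
    hW' hQ f hf hf_small hf_lip ωA ωA' c hc hS hS' h₁ h₂, fun hskew h₁ _ h₃ => ?_⟩
  let _ : NormedSpace ℝ H := NormedSpace.restrictScalars ℝ 𝕜 H
  have : IsScalarTower ℝ 𝕜 H := IsScalarTower.of_algebraMap_smul fun _ _ => rfl
  have hS := S.norm_le_one_of_skewAdjoint hskew
  -- In the skew-adjoint case both groups are contractions, so both rates may be taken 0 with
  -- constant 1.
  have h := exists_stable_closedLoop S B hB lam lam₁ γ hγ Q hQ' W hW' hQ f hf hf_small hf_lip 0 0 1
    one_pos (fun t _ => by simpa using hS t)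
    (fun t _ => by simpa [LinearIsometryEquiv.norm_map] using hS (-t)) (by linarith) (by linarith)
  simpa only [zero_sub, neg_mul] using h
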